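/- All simplices are full-dimensional simplices in $\mathbb{Q}^d$, $d\ge 2$, with respect to the lattice $\mathbb{Z}^d$. A *Fano simplex* is a simplex $\Delta\subseteq\mathbb{Q}^d$ that contains the origin in its interior and whose vertices are primitive lattice vectors. Its dual is $\Delta^*=\{u\in\mathbb{Q}^d:\langle u,v\rangle\ge -1\text{ for all }v\in\Delta\}$. Its *Gorenstein index* is the smallest integer $g\ge1$ such that $g\Delta^*$ is a lattice simplex. Its *multiplicity* $\mathrm{mult}(\Delta)$ is the index in $\mathbb{Z}^d$ of the sublattice generated by the vertices of $\Delta$. We write $\Delta\cong\Delta'$ if a lattice isomorphism maps $\Delta$ onto $\Delta'$, and $\Delta(P)$ for the convex hull of the columns of a $d\times(d+1)$ matrix $P$. For $g\ge 1$ put $s_{g,1}=g+1$, $s_{g,k+1}=s_{g,k}(s_{g,k}-1)+1$ and $t_{g,k}=s_{g,k}-1$. **Theorem.** Let $d\ge 2$, $g\ge1$, and let $\Delta$ be any $d$-dimensional Fano simplex of Gorenstein index $g$. (i) If $d=3$ and $g\in\{1,2\}$, then $\mathrm{mult}(\Delta)\le 16g^2$. Equality holds if and only if $\Delta\cong\Delta(P)$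 for $$P=\begin{bmatrix}1&4g-3&4g-3&5-8g\\0&4g&0&-4g\\0&0&4g&-4g\end{bmatrix},$$ and this $\Delta(P)$ is a Fano simplex of Gorenstein index $g$. (ii) If $(d,g)=(4,1)$, then $\mathrm{mult}(\Delta)\le128$. Equality holds if and only if $\Delta\cong\Delta(P)$ for $$P=\begin{bmatrix}1&1&1&1&-7\\0&2&2&2&-6\\0&0&8&0&-8\\0&0&0&8&-8\end{bmatrix},$$ and this $\Delta(P)$ is a Fano simplex of Gorenstein index $1$. (iii) In all other cases $$\mathrm{mult}(\Delta)\le\frac{3t_{g,d-1}^2}{g}.$$ If equality holds, then either $(d,g)=(3,3)$ and $\Delta\cong\Delta(P)$ for $$P=\begin{bmatrix}1&1&5&-7\\0&12&0&-12\\0&0&12&-12\end{bmatrix},$$ or there are integers $a_1,\dots,a_{d-1}\ge1$ such that $\Delta\cong\Delta(P)$ for the $d\times(d+1)$ matrix $P=P(a_1,\dots,a_{d-1})$ with the following columns, where $e_1,\dots,e_d$ is the standard basis and $c_k=\frac{s_{g,k}-g}{s_{g,k}}\frac{t_{g,d-1}}{g}$: the first $d-2$ columns are $e_1,\dots,e_{d-2}$,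 and the last three columns are $$\sum_{k=1}^{d-2}c_k e_k+\frac{t_{g,d-1}}{g}e_{d-1},\qquad \sum_{k=1}^{d-1}a_ke_k+3t_{g,d-1}e_d,$$ $$-\sum_{k=1}^{d-2}\left(\frac{s_{g,k}+2g}{s_{g,k}}\frac{t_{g,d-1}}{g}+a_k\right)e_k-\left(\frac{t_{g,d-1}}{g}+a_{d-1}\right)e_{d-1}-3t_{g,d-1}e_d.$$ Moreover, if $g$ is odd (and $(d,g)$ is as in (iii)), then the values $a_k=c_k$ for $1\le k\le d-2$ and $a_{d-1}=\frac{t_{g,d-1}}{g}$ are positive integers, and for them $\Delta(P(a_1,\dots,a_{d-1}))$ is a Fano simplex of Gorenstein index $g$ with multiplicity $\frac{3t_{g,d-1}^2}{g}$. -/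

import Mathlib

open scoped Pointwise

/-- The standard lattice `ℤ^d` inside `ℚ^d`: the vectors all of whose coordinates are integers. -/
def stdLattice (d : ℕ) : AddSubgroup (Fin d → ℚ) :=
  AddSubgroup.pi Set.univ fun _ => (Int.castAddHom ℚ).range

/-- A lattice vector is primitive if it is not a multiple `k • y` of a lattice vector `y`
with an integer `k ≠ ±1` (in particular it is nonzero). -/
def IsPrimitiveVector {d : ℕ} (x : Fin d → ℚ) : Prop :=
  x ∈ stdLattice d ∧ ∀ y ∈ stdLattice d, ∀ k : ℤ, x = k • y → IsUnit k

/-- A full-dimensional simplex in `ℚ^d`. -/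
def IsFullSimplex {d : ℕ} (Δ : Set (Fin d → ℚ)) : Prop :=
  ∃ v : Fin (d + 1) → Fin d → ℚ, AffineIndependent ℚ v ∧ Δ = convexHull ℚ (Set.range v)

/-- The vertices of a polytope, i.e. its extreme points. -/
def polytopeVertices {d : ℕ} (Δ : Set (Fin d → ℚ)) : Set (Fin d → ℚ) :=
  Set.extremePoints ℚ Δ

/-- A lattice simplex: a full-dimensional simplex whose vertices are lattice points. -/
def IsLatticeSimplex {d : ℕ} (Δ : Set (Fin d → ℚ)) : Prop :=
  IsFullSimplex Δ ∧ ∀ x ∈ polytopeVertices Δ, x ∈ stdLattice d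

/-- A Fano simplex: a full-dimensional simplex having the origin in its interior
and primitive lattice points as its vertices. -/
def IsFanoSimplex {d : ℕ} (Δ : Set (Fin d → ℚ)) : Prop :=
  IsFullSimplex Δ ∧ (0 : Fin d → ℚ) ∈ interior Δ ∧
    ∀ x ∈ polytopeVertices Δ, IsPrimitiveVector x

/-- The dual polytope `{u | ⟨u, v⟩ ≥ -1 for all v ∈ Δ}`; the dual of `ℚ^d` is identified
with `ℚ^d` (and the dual of `ℤ^d` with `ℤ^d`) by the dot product. -/
def dualPolytope {d : ℕ} (Δ : Set (Fin d → ℚ)) : Set (Fin d → ℚ) :=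
  {u | ∀ v ∈ Δ, -1 ≤ dotProduct u v}

/-- The index of rationality: the smallest `k ≥ 1` such that `k Δ` is a lattice simplex. -/
noncomputable def rationalityIndex {d : ℕ} (Δ : Set (Fin d → ℚ)) : ℕ :=
  sInf {k : ℕ | 1 ≤ k ∧ IsLatticeSimplex ((k : ℚ) • Δ)}

/-- The Gorenstein index of a simplex with the origin in its interior. For a lattice simplex
the first factor is `1`. -/
noncomputable def gorensteinIndex {d : ℕ} (Δ : Set (Fin d → ℚ)) : ℕ :=
  rationalityIndex Δ * rationalityIndex (dualPolytope Δ)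

/-- The multiplicity of a lattice simplex: the index `[ℤ^d : L]` of the sublattice `L`
generated by the vertices. -/
noncomputable def simplexMultiplicity {d : ℕ} (Δ : Set (Fin d → ℚ)) : ℕ :=
  (AddSubgroup.closure (polytopeVertices Δ)).relIndex (stdLattice d)

/-- Isomorphy of polytopes: some linear isomorphism that restricts to an isomorphism of the
standard lattices maps `Δ` onto `Δ'`. -/
def LatticeIsomorphic {d d' : ℕ} (Δ : Set (Fin d → ℚ)) (Δ' : Set (Fin d' → ℚ)) : Prop :=
  ∃ φ : (Fin d → ℚ) ≃ₗ[ℚ] (Fin d' → ℚ),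
    (∀ x, φ x ∈ stdLattice d' ↔ x ∈ stdLattice d) ∧ φ '' Δ = Δ'

/-- `Δ(P)`: the convex hull of the columns of `P`. -/
def simplexOfMatrix {d : ℕ} (P : Matrix (Fin d) (Fin (d + 1)) ℚ) : Set (Fin d → ℚ) :=
  convexHull ℚ (Set.range fun j i => P i j)

/-- The `g`-Sylvester sequence `s_{g,1} = g + 1`, `s_{g,k+1} = s_{g,k} (s_{g,k} - 1) + 1`.
The sequence starts at `k = 1`; the value at `0` is a placeholder that is never used. -/
def gSylvester (g : ℕ) : ℕ → ℕ
  | 0 => 0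
  | 1 => g + 1
  | k + 2 => gSylvester g (k + 1) * (gSylvester g (k + 1) - 1) + 1

/-- The truncated `g`-Sylvester sequence `t_{g,k} = s_{g,k} - 1`. -/
def gSylvesterTrunc (g k : ℕ) : ℕ := gSylvester g k - 1

/-- The extremal matrix in dimension three for `g = 1, 2`. -/
def matrixDimThree (g : ℕ) : Matrix (Fin 3) (Fin 4) ℚ :=
  !![1, 4 * g - 3, 4 * g - 3, 5 - 8 * g;
     0, 4 * g, 0, -4 * g;
     0, 0, 4 * g, -4 * g]

/-- The extremal matrix in dimension four for `g = 1`. -/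
def matrixDimFour : Matrix (Fin 4) (Fin 5) ℚ :=
  !![1, 1, 1, 1, -7;
     0, 2, 2, 2, -6;
     0, 0, 8, 0, -8;
     0, 0, 0, 8, -8]

/-- The exceptional matrix for dimension three and Gorenstein index three. -/
def matrixThreeThree : Matrix (Fin 3) (Fin 4) ℚ :=
  !![1, 1, 5, -7;
     0, 12, 0, -12;
     0, 0, 12, -12]

/-- The entry `((s_{g,k} - g) / s_{g,k}) * (t_{g,d-1} / g)`. -/
def sylvesterEntry (d g k : ℕ) : ℚ :=
  (((gSylvester g k : ℚ) - g) / gSylvester g k) * ((gSylvesterTrunc g (d - 1) : ℚ) / g)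

/-- The general `d × (d+1)` matrix (`d ≥ 2`) with parameters `a 1, …, a (d-1)`. With rows `k`
and columns `l` counted from `1`: the columns `1, …, d-2` are the first standard basis vectors,
then follow the columns `d-1`, `d` and `d+1`. -/
def matrixGeneral (d g : ℕ) (a : ℕ → ℕ) : Matrix (Fin d) (Fin (d + 1)) ℚ :=
  Matrix.of fun i j =>
    let k : ℕ := i.val + 1
    let l : ℕ := j.val + 1
    let t : ℚ := gSylvesterTrunc g (d - 1)
    let s : ℚ := gSylvester g k
    if l + 2 ≤ d then
      (if k = l then 1 else 0)
    else if l + 1 = d then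
      (if k + 2 ≤ d then sylvesterEntry d g k else if k + 1 = d then t / g else 0)
    else if l = d then
      (if k + 1 ≤ d then (a k : ℚ) else 3 * t)
    else
      (if k + 2 ≤ d then -(((s + 2 * g) / s) * (t / g) + a k)
        else if k + 1 = d then -(t / g + a k) else -3 * t)

/-! ### Simplices over an ordered field -/

section AffineBasis

variable {𝕜 E ι : Type*} [Field 𝕜] [LinearOrder 𝕜] [IsStrictOrderedRing 𝕜] [AddCommGroup E]
  [Module 𝕜 E]

/-! Let `v_0, …, v_d` be the vertices of a Fano simplex and `w_i` the barycentric coordinates of the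
origin. The dual vertex `U_i` takes the value -1 at every `v_j` with `j ≠ i`. For Gorenstein index
`g` the vectors `u_i = g U_i` are integral, so `A_i = ⟨u_i, v_i⟩ + g = g / w_i` is a positive
integer and the `1 / A_i` sum to `1 / g`: each simplex gives a unit fraction partition of `1 / g` of
length `d + 1`.

The matrix of pairings of `u_0, …, u_{d-1}` with `v_0, …, v_{d-1}` is a diagonal matrix minus a
constant one, and its determinant yields `det u * det v * A_d ^ 2 = g * ∏ A_i`
(`IsFanoPair.det_mul_det`). Primitivity of the vertices forces `g ∣ det u`
(`IsFanoPair.dvd_det_functionalMatrix`). Hence the multiplicity is at most `∏ A_i / A_d ^ 2`, and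
for increasing `A_i` at most `A_0 ⋯ A_{d-2}`.

It remains to maximize this product. The reciprocals `x_i = 1 / A_i` decrease, and integrality gives
`∏_{i<k} x_i ≤ g * ∑_{i≥k} x_i`. A majorization argument (`sum_le_sum_of_prod_le_prod`,
`eq_of_prod_le_of_tight`) compares `x` with sequences that are Sylvester reciprocals, then one free
value, then constant. Quasi-concavity in the constant leaves as possible maximizers only the
partitions `s_1, …, s_j` followed by `d + 1 - j` copies of `(d + 1 - j) t_{j+1}`
(`IsUnitFractionLike.eq_candidate`). Their products increase up to `j = d - 3`, and the sign of the
last step is that of `(3 t - 1) (t - 3)` with `t = t_{g,d-2}`. So `j = d - 2` is optimal, except for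
`t < 3`, which means `(d, g) = (3, 1), (3, 2), (4, 1)`; there is a tie for `t = 3`, which means `(3,
3)`.

Equality also forces `|det u| = g`. For `g = 1` the functionals then form a lattice basis, and the
coordinates of the vertices in it depend only on `A`. For `d = 3` and `g = 2, 3` a linear relation
modulo `g` makes one functional, or a sum of two, divisible by `g`, and division restores a basis.
In the general case the first `d - 2` vertices extend to a lattice basis in which the vertex matrix
is triangular with forced diagonal; this is the normal form. For odd `g` the example is checked by
writing down its dual vertices. -/

theorem AffineBasis.extremePoints_convexHull [Finite ι] (b : AffineBasis ι 𝕜 E) :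
    Set.extremePoints 𝕜 (convexHull 𝕜 (Set.range b)) = Set.range b := by
  classical
  refine Set.Subset.antisymm extremePoints_convexHull_subset ?_
  rintro _ ⟨i, rfl⟩
  refine ⟨subset_convexHull 𝕜 _ ⟨i, rfl⟩, ?_⟩
  rw [b.convexHull_eq_nonneg_coord]
  intro x hx y hy hxy
  obtain ⟨s, t, hs, ht, hst, h⟩ := hxy
  -- A coordinate that vanishes at the vertex is a positive combination of two nonnegative
  -- coordinates, so both vanish.
  have key : ∀ j, j ≠ i → b.coord j x = 0 := by
    intro j hj
    have h1 : b.coord j (s • x + t • y) = s * b.coord j x + t * b.coord j y := by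
      have := Convex.combo_affine_apply (f := b.coord j) (x := x) (y := y) hst
      simpa using this
    rw [h, b.coord_apply_ne hj] at h1
    have h2 := mul_nonneg hs.le (hx j)
    have h3 := mul_nonneg ht.le (hy j)
    have h4 : s * b.coord j x = 0 := by linarith
    exact (mul_eq_zero.mp h4).resolve_left hs.ne'
  refine b.ext_elem fun j => ?_
  by_cases hj : j = i
  · subst hj
    have := Fintype.ofFinite ι
    have h1 := b.sum_coord_apply_eq_one x
    have h2 : ∑ k, b.coord k x = b.coord j x :=
      Finset.sum_eq_single j (fun k _ hk => key k hk) (by simp)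
    rw [b.coord_apply_eq]
    rw [← h2, h1]
  · rw [key j hj, b.coord_apply_ne hj]

end AffineBasis

theorem AffineBasis.interior_convexHull_of_pos {d : ℕ} {ι : Type*} [Finite ι]
    (b : AffineBasis ι ℚ (Fin d → ℚ)) {x : Fin d → ℚ} :
    x ∈ interior (convexHull ℚ (Set.range b)) ↔ ∀ i, 0 < b.coord i x := by
  have hcont : ∀ i, Continuous (b.coord i) := by
    intro i
    have h : Continuous ((b.coord i).linear) := LinearMap.continuous_on_pi _
    have h2 : (b.coord i : (Fin d → ℚ) → ℚ) = fun x => (b.coord i).linear x + b.coord i 0 :=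
      AffineMap.decomp (b.coord i)
    rw [h2]
    exact h.add continuous_const
  constructor
  · intro hx i
    have h0 : 0 ≤ b.coord i x := by
      have := interior_subset hx
      rw [b.convexHull_eq_nonneg_coord] at this
      exact this i
    refine lt_of_le_of_ne h0 fun hne => ?_
    -- If the coordinate were zero, moving from `x` straight away from the vertex `b i` would make
    -- it negative at once, although small moves stay in the hull.
    have hl : Filter.Tendsto (fun t : ℚ => x + t • (x - b i)) (nhds 0) (nhds (x + (0:ℚ) • (x - b i))) := by
      refine Continuous.tendsto ?_ 0
      fun_prop
    rw [zero_smul, add_zero] at hl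
    have hev := hl.eventually (mem_interior_iff_mem_nhds.mp hx)
    have hpos : ∃ᶠ t : ℚ in nhds 0, 0 < t := by
      exact (frequently_gt_nhds (0 : ℚ))
    obtain ⟨t, ht0, ht⟩ := (hpos.and_eventually hev).exists
    rw [b.convexHull_eq_nonneg_coord] at ht
    have h1 := ht i
    have h2 : b.coord i (x + t • (x - b i)) = -t := by
      have : x + t • (x - b i) = AffineMap.lineMap x (b i) (-t) := by
        simp [AffineMap.lineMap_apply, smul_sub]; abel
      rw [this, AffineMap.apply_lineMap, ← hne, b.coord_apply_eq]
      simp [AffineMap.lineMap_apply]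
    rw [h2] at h1
    linarith
  · intro hx
    have hopen : IsOpen {y : Fin d → ℚ | ∀ i, 0 < b.coord i y} := by
      rw [Set.ofPred_forall]
      exact isOpen_iInter_of_finite fun i => isOpen_lt continuous_const (hcont i)
    refine mem_interior.mpr ⟨_, fun y hy => ?_, hopen, hx⟩
    rw [b.convexHull_eq_nonneg_coord]
    exact fun i => (hy i).le

/-- The affine basis given by the vertices of a full-dimensional simplex in `ℚ^d`. -/
noncomputable def simplexBasis {d : ℕ} (v : Fin (d + 1) → Fin d → ℚ) (hv : AffineIndependent ℚ v) :
    AffineBasis (Fin (d + 1)) ℚ (Fin d → ℚ) :=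
  ⟨v, hv, by
    rw [hv.affineSpan_eq_top_iff_card_eq_finrank_add_one]
    simp⟩

@[simp] theorem coe_simplexBasis {d : ℕ} (v : Fin (d + 1) → Fin d → ℚ)
    (hv : AffineIndependent ℚ v) : ⇑(simplexBasis v hv) = v := rfl

/-! ### Vertices, lattice points and primitive vectors in coordinates. -/

theorem polytopeVertices_convexHull {d : ℕ} {v : Fin (d + 1) → Fin d → ℚ}
    (hv : AffineIndependent ℚ v) :
    polytopeVertices (convexHull ℚ (Set.range v)) = Set.range v :=
  (simplexBasis v hv).extremePoints_convexHull

theorem mem_stdLattice {d : ℕ} {x : Fin d → ℚ} :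
    x ∈ stdLattice d ↔ ∃ y : Fin d → ℤ, x = fun i => (y i : ℚ) := by
  simp only [stdLattice, AddSubgroup.mem_pi, Set.mem_univ, forall_const, AddMonoidHom.mem_range,
    Int.coe_castAddHom]
  constructor
  · intro h
    choose y hy using h
    exact ⟨y, funext fun i => (hy i).symm⟩
  · rintro ⟨y, rfl⟩ i
    exact ⟨y i, rfl⟩

theorem smul_extremePoints {d : ℕ} (Δ : Set (Fin d → ℚ)) {c : ℚ} (hc : c ≠ 0) :
    polytopeVertices (c • Δ) = c • polytopeVertices Δ :=
  (image_extremePoints (LinearEquiv.smulOfNeZero ℚ (Fin d → ℚ) c hc) Δ).symm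

theorem isPrimitiveVector_intCast {d : ℕ} {y : Fin d → ℤ} :
    IsPrimitiveVector (fun i => (y i : ℚ)) ↔ ∀ k : ℤ, (∀ i, k ∣ y i) → IsUnit k := by
  constructor
  · rintro ⟨-, h⟩ k hk
    choose z hz using hk
    refine h (fun i => (z i : ℚ)) (mem_stdLattice.mpr ⟨z, rfl⟩) k ?_
    ext i
    simp [hz i]
  · refine fun h => ⟨mem_stdLattice.mpr ⟨y, rfl⟩, fun x hx k hk => ?_⟩
    obtain ⟨z, rfl⟩ := mem_stdLattice.mp hx
    refine h k fun i => ⟨z i, ?_⟩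
    have := congrFun hk i
    simp only [Pi.smul_apply, zsmul_eq_mul] at this
    exact_mod_cast this

theorem IsFanoSimplex.rationalityIndex_eq_one {d : ℕ} {Δ : Set (Fin d → ℚ)}
    (h : IsFanoSimplex Δ) : rationalityIndex Δ = 1 := by
  have h1 : (1 : ℕ) ∈ {k : ℕ | 1 ≤ k ∧ IsLatticeSimplex ((k : ℚ) • Δ)} := by
    refine ⟨le_rfl, ?_⟩
    rw [Nat.cast_one, one_smul]
    exact ⟨h.1, fun x hx => (h.2.2 x hx).1⟩
  exact le_antisymm (Nat.sInf_le h1) (Nat.sInf_mem ⟨1, h1⟩).1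

/-- The convex hull of integral points in `ℚ^d`. -/
def integralHull {d : ℕ} (v : Fin (d + 1) → Fin d → ℤ) : Set (Fin d → ℚ) :=
  convexHull ℚ (Set.range fun j i => (v j i : ℚ))

/-- The primitive vertices `v` of a simplex, the vertices `u` of `g` times its dual and the
numbers `A i` for which `g / A i` are the barycentric coordinates of the origin. -/
structure IsFanoPair {d : ℕ} (g : ℕ) (A : Fin (d + 1) → ℤ) (v u : Fin (d + 1) → Fin d → ℤ) :
    Prop where
  index_pos : 0 < g
  pos : ∀ i, 0 < A i
  pairing : ∀ i j, u i ⬝ᵥ v j = (if i = j then A i else 0) - g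
  sum_inv : ∑ i, (g : ℚ) / A i = 1
  relation : ∀ k, ∑ j, (g : ℚ) / A j * v j k = 0
  primitive : ∀ j (k : ℤ), (∀ i, k ∣ v j i) → IsUnit k

/-- This passes from convex geometry to integer data: `u i` is `g` times the functional equal to -1
on the facet opposite to `v i`, and it is integral because it is a vertex of `g` times the dual. -/
theorem exists_isFanoPair {d g : ℕ} (hg : 1 ≤ g) {Δ : Set (Fin d → ℚ)} (hΔ : IsFanoSimplex Δ)
    (hind : gorensteinIndex Δ = g) :
    ∃ A v u, IsFanoPair g A v u ∧ Δ = integralHull v := by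
  have hr := hΔ.rationalityIndex_eq_one
  obtain ⟨⟨v, hv, rfl⟩, h0, hprim⟩ := hΔ
  rw [gorensteinIndex, hr, one_mul] at hind
  rw [polytopeVertices_convexHull hv] at hprim
  have hlat := fun j => mem_stdLattice.mp (hprim (v j) ⟨j, rfl⟩).1
  choose V hV using hlat
  set b := simplexBasis v hv with hb
  have hbv : ∀ j, b j = v j := fun j => rfl
  have hw : ∀ i, 0 < b.coord i 0 := b.interior_convexHull_of_pos.mp h0
  set w : Fin (d + 1) → ℚ := fun i => b.coord i 0 with hwdef
  have hmem : (g : ℕ) ∈ {k : ℕ | 1 ≤ k ∧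
      IsLatticeSimplex ((k : ℚ) • dualPolytope (convexHull ℚ (Set.range v)))} := by
    rw [← hind]
    -- The infimum of the empty set is 0, which `1 ≤ g` excludes.
    refine Nat.sInf_mem ?_
    by_contra hne
    rw [Set.not_nonempty_iff_eq_empty] at hne
    rw [rationalityIndex, hne, Nat.sInf_empty] at hind
    omega
  obtain ⟨-, -, hvert⟩ := hmem
  have hg0 : (g : ℚ) ≠ 0 := by positivity
  rw [smul_extremePoints _ hg0] at hvert
  -- The gradient of the `i`-th barycentric coordinate divided by its value at the origin, so that
  -- this coordinate of `x` is `w i * (1 + U i ⬝ᵥ x)`.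
  set U : Fin (d + 1) → Fin d → ℚ :=
    fun i k => (b.coord i).linear (Pi.single k 1) / w i with hU
  have hUdot : ∀ i x, U i ⬝ᵥ x = -1 + b.coord i x / w i := by
    intro i x
    have h1 : (b.coord i).linear x = ∑ k, x k * (b.coord i).linear (Pi.single k 1) := by
      conv_lhs => rw [LinearMap.pi_apply_eq_sum_univ (b.coord i).linear x]
      refine Finset.sum_congr rfl fun k _ => ?_
      rw [smul_eq_mul]
      congr 2
      ext j
      simp [Pi.single_apply, eq_comm]
    have h2 : b.coord i x = (b.coord i).linear x + w i :=
      congrFun (AffineMap.decomp (b.coord i)) x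
    have hwi : w i ≠ 0 := (hw i).ne'
    have h3 : U i ⬝ᵥ x = (b.coord i).linear x / w i := by
      rw [h1, dotProduct, Finset.sum_div]
      refine Finset.sum_congr rfl fun k _ => ?_
      simp only [hU]
      ring
    rw [h3, h2, add_div, div_self hwi]
    ring
  have hUext : ∀ i, U i ∈ polytopeVertices (dualPolytope (convexHull ℚ (Set.range v))) := by
    intro i
    constructor
    · intro x hx
      have hx' : x ∈ convexHull ℚ (Set.range b) := hx
      rw [b.convexHull_eq_nonneg_coord] at hx'
      rw [hUdot]
      have := div_nonneg (hx' i) (hw i).le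
      linarith
    · intro x hx y hy hxy
      obtain ⟨s, t, hs, ht, hst, h⟩ := hxy
      -- The `d` inequalities that are tight at `U i` are tight at `x` as well; the relation `∑ w j
      -- • v j = 0` then fixes the remaining pairing, and the vertices span.
      have key : ∀ j, j ≠ i → x ⬝ᵥ v j = U i ⬝ᵥ v j := by
        intro j hj
        have e1 : U i ⬝ᵥ v j = -1 := by
          rw [hUdot, ← hbv, b.coord_apply_ne hj.symm]
          simp
        have e2 : s * (x ⬝ᵥ v j) + t * (y ⬝ᵥ v j) = -1 := by
          rw [← e1, ← h, add_dotProduct, smul_dotProduct, smul_dotProduct, smul_eq_mul, smul_eq_mul]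
        have e3 := hx (v j) (subset_convexHull ℚ _ ⟨j, rfl⟩)
        have e4 := hy (v j) (subset_convexHull ℚ _ ⟨j, rfl⟩)
        have e5 : s * (x ⬝ᵥ v j + 1) + t * (y ⬝ᵥ v j + 1) = 0 := by
          linear_combination e2 + hst
        have e6 : 0 ≤ s * (x ⬝ᵥ v j + 1) := mul_nonneg hs.le (by linarith)
        have e7 : 0 ≤ t * (y ⬝ᵥ v j + 1) := mul_nonneg ht.le (by linarith)
        have e8 : s * (x ⬝ᵥ v j + 1) = 0 := by linarith
        rw [e1]
        have := (mul_eq_zero.mp e8).resolve_left hs.ne'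
        linarith
      have hsum : ∀ z : Fin d → ℚ, ∑ j, w j * (z ⬝ᵥ v j) = 0 := by
        intro z
        have h1 : ∑ j, w j • v j = 0 := b.linear_combination_coord_eq_self 0
        have h2 : z ⬝ᵥ ∑ j, w j • v j = ∑ j, w j * (z ⬝ᵥ v j) := by
          rw [dotProduct_sum]
          simp [dotProduct_smul]
        rw [← h2, h1, dotProduct_zero]
      have hi : x ⬝ᵥ v i = U i ⬝ᵥ v i := by
        have h1 : ∑ j, w j * ((x - U i) ⬝ᵥ v j) = w i * ((x - U i) ⬝ᵥ v i) := by
          refine Finset.sum_eq_single i (fun j _ hj => ?_) (by simp)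
          rw [sub_dotProduct, key j hj, sub_self, mul_zero]
        rw [hsum] at h1
        have h2 := (mul_eq_zero.mp h1.symm).resolve_left (hw i).ne'
        rw [sub_dotProduct] at h2
        linarith
      have hall : ∀ j, (x - U i) ⬝ᵥ v j = 0 := by
        intro j
        rw [sub_dotProduct, sub_eq_zero]
        by_cases hj : j = i
        · rw [hj, hi]
        · exact key j hj
      have hz : ∀ z : Fin d → ℚ, (x - U i) ⬝ᵥ z = 0 := by
        intro z
        have h1 : ∑ j, b.coord j z • v j = z := b.linear_combination_coord_eq_self z
        rw [← h1, dotProduct_sum]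
        refine Finset.sum_eq_zero fun j _ => ?_
        rw [dotProduct_smul, hall, smul_zero]
      have := dotProduct_self_eq_zero.mp (hz (x - U i))
      exact sub_eq_zero.mp this
  have hUint : ∀ i, ∃ y : Fin d → ℤ, (g : ℚ) • U i = fun k => (y k : ℚ) := fun i =>
    mem_stdLattice.mp (hvert _ (Set.smul_mem_smul_set (hUext i)))
  choose u hu using hUint
  have hpair : ∀ i j, ((u i ⬝ᵥ V j : ℤ) : ℚ) = -g + g * (b.coord i (v j) / w i) := by
    intro i j
    have h1 : ((u i ⬝ᵥ V j : ℤ) : ℚ) = (fun k => (u i k : ℚ)) ⬝ᵥ fun k => (V j k : ℚ) := by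
      simp [dotProduct]
    rw [h1, ← hu i, ← hV j, smul_dotProduct, hUdot, smul_eq_mul]
    ring
  set A : Fin (d + 1) → ℤ := fun i => u i ⬝ᵥ V i + g with hA
  have hAw : ∀ i, (A i : ℚ) = g / w i := by
    intro i
    simp only [hA]
    push_cast
    rw [hpair, ← hbv, b.coord_apply_eq]
    field_simp
    ring
  have hgw : ∀ i, (g : ℚ) / A i = w i := by
    intro i
    have hwi : w i ≠ 0 := (hw i).ne'
    rw [hAw]
    field_simp
  refine ⟨A, V, u, ⟨hg, ?_, ?_, ?_, ?_, ?_⟩, ?_⟩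
  · intro i
    have : (0 : ℚ) < A i := by
      rw [hAw]
      have := hw i
      have hgpos : (0 : ℚ) < g := by positivity
      exact div_pos hgpos this
    exact_mod_cast this
  · intro i j
    by_cases hij : i = j
    · subst hij
      simp [hA]
    · have : ((u i ⬝ᵥ V j : ℤ) : ℚ) = ((-g : ℤ) : ℚ) := by
        rw [hpair, ← hbv, b.coord_apply_ne hij]
        simp
      have := Int.cast_injective this
      simp [hij, this]
  · simp_rw [hgw]
    exact b.sum_coord_apply_eq_one 0
  · intro k
    have h1 : ∑ j, w j • v j = 0 := b.linear_combination_coord_eq_self 0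
    have h2 := congrFun h1 k
    simp only [Finset.sum_apply, Pi.smul_apply, smul_eq_mul, Pi.zero_apply] at h2
    rw [← h2]
    refine Finset.sum_congr rfl fun j _ => ?_
    rw [hgw, hV j]
  · intro j
    have := hprim (v j) ⟨j, rfl⟩
    rw [hV j] at this
    exact isPrimitiveVector_intCast.mp this
  · rw [integralHull]
    congr 2
    exact funext hV

/-! ### Determinants and multiplicities -/

/-- The square matrix whose columns are all vertices except the last one. -/
def vertexMatrix {d : ℕ} (v : Fin (d + 1) → Fin d → ℤ) : Matrix (Fin d) (Fin d) ℤ :=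
  Matrix.of fun i j => v j.castSucc i

/-- The square matrix whose rows are all the functionals except the last one. -/
def functionalMatrix {d : ℕ} (u : Fin (d + 1) → Fin d → ℤ) : Matrix (Fin d) (Fin d) ℤ :=
  Matrix.of fun i => u i.castSucc

/-- The matrix determinant lemma for a rank one perturbation of an invertible diagonal matrix. -/
theorem Matrix.det_diagonal_sub_const {n K : Type*} [Fintype n] [DecidableEq n] [Field K]
    (a : n → K) (ha : ∀ i, a i ≠ 0) (c : K) :
    (Matrix.diagonal a - Matrix.of fun _ _ => c).det = (∏ i, a i) * (1 - ∑ i, c / a i) := by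
  have hu : IsUnit (Matrix.diagonal a) := by
    rw [Matrix.isUnit_diagonal, Pi.isUnit_iff]
    exact fun i => (ha i).isUnit
  have h := Matrix.det_add_replicateCol_mul_replicateRow (ι := Unit) (A := Matrix.diagonal a)
    (by rw [← Matrix.isUnit_iff_isUnit_det]; exact hu) (fun _ => -c) (fun _ => (1 : K))
  have e : Matrix.diagonal a - (Matrix.of fun _ _ => c) = Matrix.diagonal a +
      Matrix.replicateCol Unit (fun _ : n => -c) * Matrix.replicateRow Unit (fun _ : n => (1 : K)) := by
    ext i j
    simp [Matrix.mul_apply, sub_eq_add_neg]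
  rw [e, h, Matrix.det_diagonal]
  congr 1
  have hinv : (Matrix.diagonal a)⁻¹ = Matrix.diagonal fun i => (a i)⁻¹ := by
    refine Matrix.inv_eq_left_inv ?_
    rw [Matrix.diagonal_mul_diagonal, ← Matrix.diagonal_one]
    congr 1
    ext i
    simp [ha i]
  rw [hinv, Matrix.det_unique]
  simp [Matrix.mul_apply, Matrix.diagonal_apply, sub_eq_add_neg, div_eq_mul_inv, mul_comm]

namespace IsFanoPair

variable {d g : ℕ} {A : Fin (d + 1) → ℤ} {v u : Fin (d + 1) → Fin d → ℤ}

theorem comp_perm (h : IsFanoPair g A v u) (σ : Equiv.Perm (Fin (d + 1))) :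
    IsFanoPair g (A ∘ σ) (v ∘ σ) (u ∘ σ) where
  index_pos := h.index_pos
  pos i := h.pos _
  pairing i j := by simp [h.pairing]
  sum_inv := by
    rw [← h.sum_inv]
    exact Equiv.sum_comp σ fun i => (g : ℚ) / A i
  relation k := by
    rw [← h.relation k]
    exact Equiv.sum_comp σ fun i => (g : ℚ) / A i * v i k
  primitive j := h.primitive _

theorem cast_ne_zero (h : IsFanoPair g A v u) (i : Fin (d + 1)) : (A i : ℚ) ≠ 0 := by
  have := h.pos i
  exact_mod_cast this.ne'

theorem functionalMatrix_mul_vertexMatrix (h : IsFanoPair g A v u) :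
    functionalMatrix u * vertexMatrix v =
      Matrix.diagonal (fun i : Fin d => A i.castSucc) - Matrix.of fun _ _ => (g : ℤ) := by
  ext i j
  have := h.pairing i.castSucc j.castSucc
  simp only [Fin.castSucc_inj] at this
  simp only [Matrix.mul_apply, functionalMatrix, vertexMatrix, Matrix.of_apply, Matrix.sub_apply,
    Matrix.diagonal_apply]
  exact this

/-- The rank one formula leaves the factor `1 - ∑_{i<d} g / A i`, which equals `g / A_d` since all
the `g / A i` sum to 1. -/
theorem det_mul_det (h : IsFanoPair g A v u) :
    (functionalMatrix u).det * (vertexMatrix v).det * A (Fin.last d) ^ 2 = g * ∏ i, A i := by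
  have h1 := congrArg (fun M : Matrix (Fin d) (Fin d) ℤ => ((M.det : ℤ) : ℚ))
    h.functionalMatrix_mul_vertexMatrix
  simp only [Matrix.det_mul] at h1
  have h2 : (((Matrix.diagonal (fun i : Fin d => A i.castSucc) -
      Matrix.of fun _ _ => (g : ℤ)).det : ℤ) : ℚ) =
      (Matrix.diagonal (fun i : Fin d => (A i.castSucc : ℚ)) - Matrix.of fun _ _ => (g : ℚ)).det := by
    rw [Int.cast_det]
    congr 1
    ext i j
    simp [Matrix.diagonal_apply, apply_ite]
  rw [h2, Matrix.det_diagonal_sub_const _ fun i => h.cast_ne_zero _] at h1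
  have h3 := h.sum_inv
  rw [Fin.sum_univ_castSucc] at h3
  have h4 : 1 - ∑ i : Fin d, (g : ℚ) / A i.castSucc = g / A (Fin.last d) := by linarith
  rw [h4] at h1
  have h5 := h.cast_ne_zero (Fin.last d)
  have : (((functionalMatrix u).det * (vertexMatrix v).det * A (Fin.last d) ^ 2 : ℤ) : ℚ) =
      ((g * ∏ i, A i : ℤ) : ℚ) := by
    push_cast at h1 ⊢
    rw [h1, Fin.prod_univ_castSucc]
    field_simp
  exact_mod_cast this

theorem det_functionalMatrix_ne_zero (h : IsFanoPair g A v u) : (functionalMatrix u).det ≠ 0 := by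
  intro h0
  have h1 := h.det_mul_det
  rw [h0, zero_mul, zero_mul] at h1
  have h2 : 0 < ∏ i, A i := Finset.prod_pos fun i _ => h.pos i
  have h3 : (0 : ℤ) < g := by exact_mod_cast h.index_pos
  exact (mul_pos h3 h2).ne h1

theorem det_vertexMatrix_ne_zero (h : IsFanoPair g A v u) : (vertexMatrix v).det ≠ 0 := by
  intro h0
  have h1 := h.det_mul_det
  rw [h0, mul_zero, zero_mul] at h1
  have h2 : 0 < ∏ i, A i := Finset.prod_pos fun i _ => h.pos i
  have h3 : (0 : ℤ) < g := by exact_mod_cast h.index_pos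
  exact (mul_pos h3 h2).ne h1

/-- All pairings with `v j` are divisible by `m`. Multiplying by the adjugate gives `m ∣ det * v j
k` for every `k`, and the coordinates of `v j` have gcd one. -/
theorem dvd_det_functionalMatrix_of_dvd (h : IsFanoPair g A v u) {m : ℤ} (hmg : m ∣ g)
    {j : Fin (d + 1)} (hmA : m ∣ A j) : m ∣ (functionalMatrix u).det := by
  have h1 : ∀ i, m ∣ u i ⬝ᵥ v j := by
    intro i
    rw [h.pairing]
    refine dvd_sub ?_ hmg
    split_ifs with hij
    · rwa [hij]
    · exact dvd_zero m
  have h2 : ∀ k, m ∣ (functionalMatrix u).det * v j k := by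
    intro k
    have e : (functionalMatrix u).adjugate.mulVec ((functionalMatrix u).mulVec (v j)) =
        (functionalMatrix u).det • v j := by
      rw [Matrix.mulVec_mulVec, Matrix.adjugate_mul, Matrix.smul_mulVec, Matrix.one_mulVec]
    have e2 := congrFun e k
    rw [Pi.smul_apply, smul_eq_mul] at e2
    rw [← e2]
    rw [Matrix.mulVec, dotProduct]
    exact Finset.dvd_sum fun i _ => dvd_mul_of_dvd_right (h1 i.castSucc) _
  have h3 : m ∣ (functionalMatrix u).det * Finset.univ.gcd (v j) := by
    rw [← (Finset.gcd_mul_left' Finset.univ (f := v j) (functionalMatrix u).det).dvd_iff_dvd_right]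
    exact Finset.dvd_gcd fun k _ => h2 k
  have h4 : IsUnit (Finset.univ.gcd (v j)) :=
    h.primitive j _ fun i => Finset.gcd_dvd (Finset.mem_univ i)
  exact (IsUnit.dvd_mul_right h4).mp h3

/-- Every prime power dividing `g` divides one of the `A j`. -/
theorem exists_prime_pow_dvd (h : IsFanoPair g A v u) {p k : ℕ} (hp : p.Prime)
    (hpk : p ^ k ∣ g) : ∃ j, ((p ^ k : ℕ) : ℤ) ∣ A j := by
  by_contra! hcon
  have := Fact.mk hp
  have hg0 : (g : ℚ) ≠ 0 := by
    have := h.index_pos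
    positivity
  have hk : (k : ℤ) ≤ padicValRat p (g : ℚ) := by
    rw [padicValRat.of_nat]
    have := (padicValNat_dvd_iff_le (p := p) h.index_pos.ne').mp hpk
    exact_mod_cast this
  have hterm : ∀ i, padicNorm p ((g : ℚ) / A i) < 1 := by
    intro i
    have hA0 := h.cast_ne_zero i
    have hval : padicValRat p (A i : ℚ) < k := by
      rw [padicValRat.of_int]
      by_contra! hle
      refine hcon i ?_
      have hle' : k ≤ padicValInt p (A i) := by exact_mod_cast hle
      have h2 := (padicValInt_dvd_iff (p := p) k (A i)).mpr (Or.inr hle')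
      exact_mod_cast h2
    have hpos : 0 < padicValRat p ((g : ℚ) / A i) := by
      rw [padicValRat.div hg0 hA0]
      omega
    rw [padicNorm.eq_zpow_of_nonzero (div_ne_zero hg0 hA0)]
    have hp1 : (1 : ℚ) < p := by exact_mod_cast hp.one_lt
    exact zpow_lt_one_of_neg₀ hp1 (by omega)
  -- If `p ^ k` divided no `A i`, every summand of `∑ g / A i = 1` would have `p`-adic norm below 1,
  -- contradicting the ultrametric inequality.
  have hsum : padicNorm p (∑ i, (g : ℚ) / A i) < 1 :=
    padicNorm.sum_lt' (fun i _ => hterm i) one_pos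
  rw [h.sum_inv, padicNorm.one] at hsum
  exact lt_irrefl _ hsum

theorem dvd_det_functionalMatrix (h : IsFanoPair g A v u) :
    (g : ℤ) ∣ (functionalMatrix u).det := by
  rw [Int.natCast_dvd]
  refine (Nat.dvd_iff_prime_pow_dvd_dvd _ _).mpr fun p k hp hpk => ?_
  obtain ⟨j, hj⟩ := h.exists_prime_pow_dvd hp hpk
  rw [← Int.natCast_dvd]
  exact h.dvd_det_functionalMatrix_of_dvd (Int.natCast_dvd_natCast.mpr hpk) hj

/-- Pairing the relation with `u i` leaves only `c i * A i`: the constant part `-g` of the pairings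
is killed by `∑ c j = 0`. -/
theorem eq_zero_of_sum_smul (h : IsFanoPair g A v u) {c : Fin (d + 1) → ℚ} (hc : ∑ j, c j = 0)
    (hcv : ∀ k, ∑ j, c j * v j k = 0) (i : Fin (d + 1)) : c i = 0 := by
  have h1 : ∑ k, (u i k : ℚ) * ∑ j, c j * v j k = 0 := by simp [hcv]
  have h2 : ∑ k, (u i k : ℚ) * ∑ j, c j * v j k = ∑ j, c j * ((u i ⬝ᵥ v j : ℤ) : ℚ) := by
    simp only [dotProduct, Int.cast_sum, Int.cast_mul, Finset.mul_sum]
    rw [Finset.sum_comm]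
    exact Finset.sum_congr rfl fun j _ => Finset.sum_congr rfl fun k _ => by ring
  rw [h2] at h1
  simp only [h.pairing, Int.cast_sub, Int.cast_natCast, mul_sub, Finset.sum_sub_distrib,
    ← Finset.sum_mul, hc, zero_mul, sub_zero, apply_ite ((↑) : ℤ → ℚ), Int.cast_zero, mul_ite,
    mul_zero, Finset.sum_ite_eq, Finset.mem_univ, if_true] at h1
  exact (mul_eq_zero.mp h1).resolve_right (h.cast_ne_zero i)

theorem affineIndependent (h : IsFanoPair g A v u) :
    AffineIndependent ℚ fun j (i : Fin d) => (v j i : ℚ) := by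
  rw [affineIndependent_iff_of_fintype]
  intro w hw hvw i
  rw [Finset.univ.weightedVSub_eq_weightedVSubOfPoint_of_sum_eq_zero _ _ hw 0,
    Finset.weightedVSubOfPoint_apply] at hvw
  refine h.eq_zero_of_sum_smul hw (fun k => ?_) i
  have := congrFun hvw k
  simpa using this

theorem polytopeVertices_eq (h : IsFanoPair g A v u) :
    polytopeVertices (integralHull v) = Set.range fun j (i : Fin d) => (v j i : ℚ) :=
  polytopeVertices_convexHull h.affineIndependent

end IsFanoPair

theorem stdLattice_eq_closure (d : ℕ) :
    stdLattice d = AddSubgroup.closure (Set.range (Pi.basisFun ℚ (Fin d))) := by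
  refine le_antisymm (fun x hx => ?_) ((AddSubgroup.closure_le _).mpr ?_)
  · obtain ⟨y, rfl⟩ := mem_stdLattice.mp hx
    have : (fun i => (y i : ℚ)) = ∑ i, y i • Pi.basisFun ℚ (Fin d) i := by
      ext k
      simp [Pi.single_apply]
    rw [this]
    exact sum_mem fun i _ => zsmul_mem (AddSubgroup.subset_closure (Set.mem_range_self i)) _
  · rintro _ ⟨i, rfl⟩
    refine mem_stdLattice.mpr ⟨Pi.single i 1, ?_⟩
    ext k
    simp [Pi.single_apply, apply_ite]

/-- The index of one full lattice in another is the absolute determinant of the change of basis. -/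
theorem relIndex_closure_eq_natAbs_det {d : ℕ} {M : Matrix (Fin d) (Fin d) ℤ} (hM : M.det ≠ 0) :
    (AddSubgroup.closure (Set.range fun j (i : Fin d) => (M i j : ℚ))).relIndex (stdLattice d) =
      M.det.natAbs := by
  set N : Matrix (Fin d) (Fin d) ℚ := M.transpose.map (Int.cast : ℤ → ℚ) with hN
  have hdet : N.det = (M.det : ℚ) := by
    rw [hN, ← Matrix.det_transpose M, Int.cast_det]
  have hli : LinearIndependent ℚ N.row := by
    refine Matrix.linearIndependent_rows_of_det_ne_zero (A := N) ?_
    rw [hdet]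
    exact_mod_cast hM
  classical
  set b := basisOfPiSpaceOfLinearIndependent hli with hb
  have hbN : ⇑b = N := by
    rw [hb]
    convert! coe_basisOfPiSpaceOfLinearIndependent hli
  have h := AddSubgroup.relIndex_eq_abs_det
    (AddSubgroup.closure (Set.range fun j (i : Fin d) => (M i j : ℚ))) (stdLattice d)
    (by
      rw [AddSubgroup.closure_le]
      rintro _ ⟨j, rfl⟩
      exact mem_stdLattice.mpr ⟨fun i => M i j, rfl⟩) b (Pi.basisFun ℚ (Fin d))
    (by rw [hbN]; rfl) (stdLattice_eq_closure d)
  have h2 : (Pi.basisFun ℚ (Fin d)).det b = (M.det : ℚ) := by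
    rw [hbN, ← hdet]
    exact Pi.basisFun_det_apply _
  have h3 : ((AddSubgroup.closure (Set.range fun j (i : Fin d) => (M i j : ℚ))).relIndex
      (stdLattice d) : ℚ) = (M.det.natAbs : ℚ) := by
    rw [h, Nat.cast_natAbs, Int.cast_abs]
    exact congrArg abs h2
  exact_mod_cast h3

namespace IsFanoPair

variable {d g : ℕ} {A : Fin (d + 1) → ℤ} {v u : Fin (d + 1) → Fin d → ℤ}

/-- Omitting the last vertex gives a sublattice of the lattice of all vertices, and the index of
that sublattice is the determinant. -/
theorem multiplicity_dvd (h : IsFanoPair g A v u) :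
    simplexMultiplicity (integralHull v) ∣ (vertexMatrix v).det.natAbs := by
  rw [← relIndex_closure_eq_natAbs_det h.det_vertexMatrix_ne_zero, simplexMultiplicity,
    h.polytopeVertices_eq]
  refine AddSubgroup.relIndex_dvd_of_le_left _ (AddSubgroup.closure_mono ?_)
  rintro _ ⟨j, rfl⟩
  exact Set.mem_range_self j.castSucc

theorem multiplicity_eq_of_last (h : IsFanoPair g A v u) {c : Fin d → ℤ}
    (hc : ∀ k, v (Fin.last d) k = ∑ j, c j * v j.castSucc k) :
    simplexMultiplicity (integralHull v) = (vertexMatrix v).det.natAbs := by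
  rw [← relIndex_closure_eq_natAbs_det h.det_vertexMatrix_ne_zero, simplexMultiplicity,
    h.polytopeVertices_eq]
  congr 1
  refine le_antisymm ((AddSubgroup.closure_le _).mpr ?_) (AddSubgroup.closure_mono ?_)
  · rintro _ ⟨j, rfl⟩
    refine Fin.lastCases ?_ (fun j => ?_) j
    · have : (fun i => (v (Fin.last d) i : ℚ)) =
          ∑ j, c j • fun i => ((vertexMatrix v i j : ℤ) : ℚ) := by
        ext k
        simp [hc, vertexMatrix]
      simp only [this]
      exact sum_mem fun i _ => zsmul_mem (AddSubgroup.subset_closure (Set.mem_range_self i)) _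
    · exact AddSubgroup.subset_closure ⟨j, rfl⟩
  · rintro _ ⟨j, rfl⟩
    exact Set.mem_range_self j.castSucc

theorem multiplicity_pos (h : IsFanoPair g A v u) : 0 < simplexMultiplicity (integralHull v) :=
  Nat.pos_of_dvd_of_pos h.multiplicity_dvd (Int.natAbs_pos.mpr h.det_vertexMatrix_ne_zero)

theorem natAbs_det_mul (h : IsFanoPair g A v u) :
    ((functionalMatrix u).det.natAbs : ℤ) * (vertexMatrix v).det.natAbs * A (Fin.last d) ^ 2 =
      g * ∏ i, A i := by
  have h1 := congrArg abs h.det_mul_det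
  have h2 : 0 < ∏ i, A i := Finset.prod_pos fun i _ => h.pos i
  rw [abs_mul, abs_mul, abs_of_nonneg (sq_nonneg (A (Fin.last d))),
    abs_of_nonneg (a := (g : ℤ) * ∏ i, A i) (by positivity)] at h1
  rw [Int.natCast_natAbs, Int.natCast_natAbs, h1]

theorem le_natAbs_det (h : IsFanoPair g A v u) : g ≤ (functionalMatrix u).det.natAbs :=
  Nat.le_of_dvd (Int.natAbs_pos.mpr h.det_functionalMatrix_ne_zero)
    (Int.natCast_dvd.mp h.dvd_det_functionalMatrix)

theorem multiplicity_le_natAbs_det (h : IsFanoPair g A v u) :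
    simplexMultiplicity (integralHull v) ≤ (vertexMatrix v).det.natAbs :=
  Nat.le_of_dvd (Int.natAbs_pos.mpr h.det_vertexMatrix_ne_zero) h.multiplicity_dvd

/-- The determinant identity is weakened by `g ≤ |det u|` and `mult ≤ |det v|`; the factor `g`
cancels. -/
theorem multiplicity_mul_sq_le (h : IsFanoPair g A v u) :
    (simplexMultiplicity (integralHull v) : ℤ) * A (Fin.last d) ^ 2 ≤ ∏ i, A i := by
  have h1 := h.natAbs_det_mul
  have h2 : (g : ℤ) ≤ (functionalMatrix u).det.natAbs := by exact_mod_cast h.le_natAbs_det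
  have h3 : (simplexMultiplicity (integralHull v) : ℤ) ≤ (vertexMatrix v).det.natAbs := by
    exact_mod_cast h.multiplicity_le_natAbs_det
  have hg : (0 : ℤ) < g := by exact_mod_cast h.index_pos
  refine le_of_mul_le_mul_left ?_ hg
  rw [← h1, ← mul_assoc]
  gcongr

/-- Equality in the bound makes both estimates that enter it equalities. -/
theorem det_eq_of_multiplicity_eq (h : IsFanoPair g A v u)
    (heq : (simplexMultiplicity (integralHull v) : ℤ) * A (Fin.last d) ^ 2 = ∏ i, A i) :
    (functionalMatrix u).det.natAbs = g ∧
      (vertexMatrix v).det.natAbs = simplexMultiplicity (integralHull v) := by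
  have h1 := h.natAbs_det_mul
  rw [← heq, ← mul_assoc] at h1
  have hA : A (Fin.last d) ^ 2 ≠ 0 := pow_ne_zero _ (h.pos _).ne'
  have h2 := mul_right_cancel₀ hA h1
  have h3 : (functionalMatrix u).det.natAbs * (vertexMatrix v).det.natAbs =
      g * simplexMultiplicity (integralHull v) := by exact_mod_cast h2
  have hm := h.multiplicity_pos
  have hg := h.index_pos
  have h4 := h.le_natAbs_det
  have h5 := h.multiplicity_le_natAbs_det
  constructor <;> nlinarith

end IsFanoPair

/-! ### Isomorphy -/

theorem integralHull_comp_perm {d : ℕ} (v : Fin (d + 1) → Fin d → ℤ)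
    (σ : Equiv.Perm (Fin (d + 1))) : integralHull (v ∘ σ) = integralHull v := by
  have := σ.surjective.range_comp fun j (i : Fin d) => (v j i : ℚ)
  rw [integralHull, integralHull, ← this]
  rfl

theorem LatticeIsomorphic.symm {d d' : ℕ} {Δ : Set (Fin d → ℚ)} {Δ' : Set (Fin d' → ℚ)}
    (h : LatticeIsomorphic Δ Δ') : LatticeIsomorphic Δ' Δ := by
  obtain ⟨φ, hφ, rfl⟩ := h
  refine ⟨φ.symm, fun x => ?_, ?_⟩
  · rw [← hφ, φ.apply_symm_apply]
  · rw [Set.image_image]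
    simp

theorem LatticeIsomorphic.multiplicity_eq {d d' : ℕ} {Δ : Set (Fin d → ℚ)}
    {Δ' : Set (Fin d' → ℚ)} (h : LatticeIsomorphic Δ Δ') :
    simplexMultiplicity Δ = simplexMultiplicity Δ' := by
  obtain ⟨φ, hφ, rfl⟩ := h
  have h1 : polytopeVertices (φ '' Δ) = φ '' polytopeVertices Δ := (image_extremePoints φ Δ).symm
  have h2 : stdLattice d' = (stdLattice d).map (φ : (Fin d → ℚ) →+ (Fin d' → ℚ)) := by
    ext x
    rw [AddSubgroup.mem_map]
    constructor
    · intro hx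
      exact ⟨φ.symm x, (hφ _).mp (by rwa [φ.apply_symm_apply]), φ.apply_symm_apply x⟩
    · rintro ⟨y, hy, rfl⟩
      exact (hφ y).mpr hy
  have h3 : AddSubgroup.closure (φ '' polytopeVertices Δ) =
      (AddSubgroup.closure (polytopeVertices Δ)).map (φ : (Fin d → ℚ) →+ (Fin d' → ℚ)) :=
    (AddMonoidHom.map_closure (φ : (Fin d → ℚ) →+ (Fin d' → ℚ)) _).symm
  rw [simplexMultiplicity, simplexMultiplicity, h1, h2, h3]
  exact (AddSubgroup.relIndex_map_map_of_injective _ _ φ.injective).symm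

theorem latticeIsomorphic_of_mulVec {d : ℕ} {v v' : Fin (d + 1) → Fin d → ℤ}
    (T : Matrix (Fin d) (Fin d) ℤ) (hT : IsUnit T.det) (h : ∀ j, T.mulVec (v j) = v' j) :
    LatticeIsomorphic (integralHull v) (integralHull v') := by
  set c : ℤ →+* ℚ := Int.castRingHom ℚ
  have hT1 : T * T⁻¹ = 1 := Matrix.mul_nonsing_inv T hT
  have hT2 : T⁻¹ * T = 1 := Matrix.nonsing_inv_mul T hT
  have hm1 : T.map c * T⁻¹.map c = 1 := by
    rw [← Matrix.map_mul, hT1, Matrix.map_one _ (map_zero c) (map_one c)]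
  have hm2 : T⁻¹.map c * T.map c = 1 := by
    rw [← Matrix.map_mul, hT2, Matrix.map_one _ (map_zero c) (map_one c)]
  have hmul : ∀ (S : Matrix (Fin d) (Fin d) ℤ) (y : Fin d → ℤ),
      (S.map c).mulVec (fun i => (y i : ℚ)) = fun i => ((S.mulVec y i : ℤ) : ℚ) := by
    intro S y
    ext i
    simp [Matrix.mulVec, dotProduct, c]
  set φ : (Fin d → ℚ) ≃ₗ[ℚ] (Fin d → ℚ) := Matrix.toLin'OfInv hm2 hm1 with hφ
  have hφa : ∀ x, φ x = (T.map c).mulVec x := fun x => Matrix.toLin'_apply (T.map c) x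
  have hφs : ∀ x, φ.symm x = (T⁻¹.map c).mulVec x := fun x => Matrix.toLin'_apply (T⁻¹.map c) x
  refine ⟨φ, fun x => ⟨fun hx => ?_, fun hx => ?_⟩, ?_⟩
  · obtain ⟨y, hy⟩ := mem_stdLattice.mp hx
    refine mem_stdLattice.mpr ⟨T⁻¹.mulVec y, ?_⟩
    rw [← hmul, ← hy, ← hφs, φ.symm_apply_apply]
  · obtain ⟨y, rfl⟩ := mem_stdLattice.mp hx
    exact mem_stdLattice.mpr ⟨T.mulVec y, by rw [hφa, hmul]⟩
  · rw [integralHull, integralHull]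
    have := LinearMap.image_convexHull (φ : (Fin d → ℚ) →ₗ[ℚ] (Fin d → ℚ))
      (Set.range fun j (i : Fin d) => (v j i : ℚ))
    refine this.trans ?_
    congr 1
    rw [← Set.range_comp]
    congr 1
    ext j i
    have h1 := congrFun (hmul T (v j)) i
    rw [h j] at h1
    exact h1

/-- Simplices having the same image under unimodular matrices are isomorphic. -/
theorem latticeIsomorphic_of_mulVec_eq_mulVec {d : ℕ} {v v' : Fin (d + 1) → Fin d → ℤ}
    (W W' : Matrix (Fin d) (Fin d) ℤ) (hW : IsUnit W.det) (hW' : IsUnit W'.det)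
    (h : ∀ j, W.mulVec (v j) = W'.mulVec (v' j)) :
    LatticeIsomorphic (integralHull v) (integralHull v') := by
  refine latticeIsomorphic_of_mulVec (W'⁻¹ * W) ?_ fun j => ?_
  · rw [Matrix.det_mul]
    exact (Matrix.isUnit_nonsing_inv_det W' hW').mul hW
  · rw [← Matrix.mulVec_mulVec, h, Matrix.mulVec_mulVec, Matrix.nonsing_inv_mul W' hW',
      Matrix.one_mulVec]

/-! ### Fano simplices from their vertices and dual vertices -/

namespace IsFanoPair

variable {d g : ℕ} {A : Fin (d + 1) → ℤ} {v u : Fin (d + 1) → Fin d → ℤ}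

theorem isFanoSimplex (h : IsFanoPair g A v u) : IsFanoSimplex (integralHull v) := by
  refine ⟨⟨_, h.affineIndependent, rfl⟩, ?_, ?_⟩
  · set b := simplexBasis _ h.affineIndependent with hb
    have hw : ∀ i, b.coord i 0 = (g : ℚ) / A i := by
      intro i
      rw [← sub_eq_zero]
      refine h.eq_zero_of_sum_smul (c := fun i => b.coord i 0 - (g : ℚ) / A i) ?_ (fun k => ?_) i
      · rw [Finset.sum_sub_distrib, h.sum_inv, b.sum_coord_apply_eq_one, sub_self]
      · simp only [sub_mul, Finset.sum_sub_distrib, h.relation, sub_zero]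
        have h1 := congrFun (b.linear_combination_coord_eq_self 0) k
        simpa [hb] using h1
    refine b.interior_convexHull_of_pos.mpr fun i => ?_
    rw [hw]
    have h1 : (0 : ℚ) < g := by exact_mod_cast h.index_pos
    have h2 : (0 : ℚ) < A i := by exact_mod_cast h.pos i
    exact div_pos h1 h2
  · rw [h.polytopeVertices_eq]
    rintro _ ⟨j, rfl⟩
    exact isPrimitiveVector_intCast.mpr (h.primitive j)

theorem pairing_cast (h : IsFanoPair g A v u) (i j : Fin (d + 1)) :
    (fun k => (u i k : ℚ)) ⬝ᵥ (fun k => (v j k : ℚ)) = (if i = j then (A i : ℚ) else 0) - g := by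
  have h1 := congrArg (Int.cast : ℤ → ℚ) (h.pairing i j)
  simp only [dotProduct, Int.cast_sum, Int.cast_mul, Int.cast_sub, Int.cast_natCast,
    apply_ite (Int.cast : ℤ → ℚ), Int.cast_zero] at h1
  exact h1

theorem affineIndependent_smul_functionals (h : IsFanoPair g A v u) {c : ℚ} (hc : c ≠ 0) :
    AffineIndependent ℚ fun i => c • fun k => (u i k : ℚ) := by
  rw [affineIndependent_iff_of_fintype]
  intro w hw huw j
  rw [Finset.univ.weightedVSub_eq_weightedVSubOfPoint_of_sum_eq_zero _ _ hw 0,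
    Finset.weightedVSubOfPoint_apply] at huw
  simp only [vsub_eq_sub, sub_zero] at huw
  have h1 := congrArg (fun x => x ⬝ᵥ fun k => (v j k : ℚ)) huw
  simp only [sum_dotProduct, smul_dotProduct, h.pairing_cast, smul_eq_mul, zero_dotProduct,
    mul_sub, Finset.sum_sub_distrib, mul_ite, mul_zero, Finset.sum_ite_eq', Finset.mem_univ,
    if_true, ← Finset.sum_mul, hw, zero_mul, sub_zero] at h1
  exact (mul_eq_zero.mp h1).resolve_right (mul_ne_zero hc (h.cast_ne_zero j))

/-- Shows that the integer data determine the dual, so that Gorenstein indices of explicit simplices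
can be computed from `u`. -/
theorem dualPolytope_eq (h : IsFanoPair g A v u) :
    dualPolytope (integralHull v) =
      convexHull ℚ (Set.range fun i => (1 / g : ℚ) • fun k => (u i k : ℚ)) := by
  have hg : (0 : ℚ) < g := by exact_mod_cast h.index_pos
  have hA : ∀ i, (0 : ℚ) < A i := fun i => by exact_mod_cast h.pos i
  set b := simplexBasis _ h.affineIndependent with hb
  refine Set.Subset.antisymm (fun x hx => ?_) (convexHull_min ?_ ?_)
  -- The slack of `x` at `v i`, weighted by the barycentric coordinate `g / A i` of the origin, is
  -- the coefficient of the `i`-th dual vertex.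
  · set μ : Fin (d + 1) → ℚ := fun i => g / A i * (x ⬝ᵥ (fun k => (v i k : ℚ)) + 1) with hμ
    have hμ0 : ∀ i, 0 ≤ μ i := by
      intro i
      have h1 := hx _ (subset_convexHull ℚ _ ⟨i, rfl⟩)
      exact mul_nonneg (div_nonneg hg.le (hA i).le) (by linarith)
    have hμ1 : ∑ i, μ i = 1 := by
      simp only [hμ, mul_add, mul_one, Finset.sum_add_distrib, h.sum_inv]
      rw [add_eq_right]
      have h1 : ∑ k, x k * ∑ j, (g : ℚ) / A j * v j k = 0 := by simp [h.relation]
      rw [← h1]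
      simp only [dotProduct, Finset.mul_sum]
      rw [Finset.sum_comm]
      exact Finset.sum_congr rfl fun j _ => Finset.sum_congr rfl fun k _ => by ring
    have hz : ∀ j, (∑ i, μ i • ((1 / g : ℚ) • fun k => (u i k : ℚ)) - x) ⬝ᵥ
        (fun k => (v j k : ℚ)) = 0 := by
      intro j
      rw [sub_dotProduct, sum_dotProduct]
      simp only [smul_dotProduct, h.pairing_cast, smul_eq_mul, mul_sub, Finset.sum_sub_distrib,
        mul_ite, mul_zero, Finset.sum_ite_eq', Finset.mem_univ, if_true, ← Finset.sum_mul, hμ1]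
      simp only [hμ]
      have := (hA j).ne'
      field_simp
      ring
    have hz' : ∀ y, (∑ i, μ i • ((1 / g : ℚ) • fun k => (u i k : ℚ)) - x) ⬝ᵥ y = 0 := by
      intro y
      rw [← b.linear_combination_coord_eq_self y, dotProduct_sum]
      refine Finset.sum_eq_zero fun j _ => ?_
      rw [dotProduct_smul, hb, coe_simplexBasis, hz, smul_zero]
    have h0 := sub_eq_zero.mp (dotProduct_self_eq_zero.mp (hz' _))
    rw [← h0]
    exact (convex_convexHull ℚ _).sum_mem (fun i _ => hμ0 i) hμ1
      fun i _ => subset_convexHull ℚ _ ⟨i, rfl⟩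
  · rintro _ ⟨i, rfl⟩ x hx
    have hx' : x ∈ convexHull ℚ (Set.range b) := hx
    rw [b.convexHull_eq_nonneg_coord] at hx'
    have hs : (-1 : ℚ) = ∑ j, -b.coord j x := by
      rw [Finset.sum_neg_distrib, b.sum_coord_apply_eq_one]
    rw [← b.linear_combination_coord_eq_self x, dotProduct_sum, hs]
    refine Finset.sum_le_sum fun j _ => ?_
    rw [dotProduct_smul, hb, coe_simplexBasis, smul_dotProduct, h.pairing_cast, smul_eq_mul,
      smul_eq_mul, ← hb]
    have h1 : -1 ≤ 1 / (g : ℚ) * ((if i = j then (A i : ℚ) else 0) - g) := by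
      have h2 : (0 : ℚ) ≤ if i = j then (A i : ℚ) else 0 := by
        split_ifs
        · exact (hA i).le
        · exact le_rfl
      have h3 : 0 ≤ 1 / (g : ℚ) * (if i = j then (A i : ℚ) else 0) :=
        mul_nonneg (by positivity) h2
      have h4 : 1 / (g : ℚ) * g = 1 := by field_simp
      rw [mul_sub, h4]
      linarith
    have := mul_le_mul_of_nonneg_left h1 (hx' j)
    linarith
  · intro x hx y hy s t hs ht hst w hw
    rw [add_dotProduct, smul_dotProduct, smul_dotProduct, smul_eq_mul, smul_eq_mul]
    have h1 := mul_le_mul_of_nonneg_left (hx w hw) hs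
    have h2 := mul_le_mul_of_nonneg_left (hy w hw) ht
    linarith

theorem isLatticeSimplex_smul_dual_iff (h : IsFanoPair g A v u) {k : ℕ} (hk : 1 ≤ k) :
    IsLatticeSimplex ((k : ℚ) • dualPolytope (integralHull v)) ↔
      ∀ i l, (g : ℤ) ∣ k * u i l := by
  have hg : (g : ℚ) ≠ 0 := by exact_mod_cast h.index_pos.ne'
  have hk0 : (k : ℚ) ≠ 0 := by positivity
  have hc : (k / g : ℚ) ≠ 0 := div_ne_zero hk0 hg
  have he : (k : ℚ) • dualPolytope (integralHull v) =
      convexHull ℚ (Set.range fun i => (k / g : ℚ) • fun l => (u i l : ℚ)) := by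
    rw [h.dualPolytope_eq, ← convexHull_smul, Set.smul_set_range]
    congr 2
    ext i l
    simp only [Pi.smul_apply, smul_eq_mul]
    ring
  have hmem : ∀ i, ((k / g : ℚ) • fun l => (u i l : ℚ)) ∈ stdLattice d ↔
      ∀ l, (g : ℤ) ∣ k * u i l := by
    intro i
    rw [mem_stdLattice]
    constructor
    · rintro ⟨y, hy⟩ l
      refine ⟨y l, ?_⟩
      have h1 := congrFun hy l
      simp only [Pi.smul_apply, smul_eq_mul] at h1
      have h2 : (k : ℚ) * u i l = g * y l := by
        rw [← h1]
        field_simp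
      exact_mod_cast h2
    · intro hl
      choose y hy using hl
      refine ⟨y, funext fun l => ?_⟩
      have h1 : (k : ℚ) * u i l = g * y l := by exact_mod_cast hy l
      simp only [Pi.smul_apply, smul_eq_mul]
      rw [div_mul_eq_mul_div, h1]
      field_simp
  have haff := h.affineIndependent_smul_functionals hc
  rw [he, IsLatticeSimplex, polytopeVertices_convexHull haff]
  constructor
  · rintro ⟨-, h2⟩ i
    exact (hmem i).mp (h2 _ ⟨i, rfl⟩)
  · refine fun h2 => ⟨⟨_, haff, rfl⟩, ?_⟩
    rintro _ ⟨i, rfl⟩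
    exact (hmem i).mpr (h2 i)

/-- A pair only says that `g` times the dual is integral; `hmin` adds that no smaller multiple is.
-/
theorem gorensteinIndex_eq (h : IsFanoPair g A v u)
    (hmin : ∀ k : ℕ, (∀ i l, (g : ℤ) ∣ k * u i l) → g ∣ k) :
    gorensteinIndex (integralHull v) = g := by
  rw [gorensteinIndex, h.isFanoSimplex.rationalityIndex_eq_one, one_mul]
  have hmem : g ∈ {k : ℕ | 1 ≤ k ∧ IsLatticeSimplex ((k : ℚ) • dualPolytope (integralHull v))} :=
    ⟨h.index_pos, (h.isLatticeSimplex_smul_dual_iff h.index_pos).mpr fun i l => dvd_mul_right _ _⟩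
  refine le_antisymm (Nat.sInf_le hmem) (le_csInf ⟨g, hmem⟩ ?_)
  rintro k ⟨hk, hlat⟩
  exact Nat.le_of_dvd hk (hmin k ((h.isLatticeSimplex_smul_dual_iff hk).mp hlat))

/-- The Gorenstein index is exact as soon as two of the functionals differ in some coordinate
by one. -/
theorem gorensteinIndex_eq_of_sub_eq_one (h : IsFanoPair g A v u) {i j : Fin (d + 1)} {l : Fin d}
    (hij : u i l - u j l = 1) : gorensteinIndex (integralHull v) = g := by
  refine h.gorensteinIndex_eq fun k hk => ?_
  have h1 := dvd_sub (hk i l) (hk j l)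
  rw [← mul_sub, hij, mul_one] at h1
  exact_mod_cast h1

end IsFanoPair

/-! ### Sums and products of decreasing sequences -/

/-- Abel summation: the partial sums of `a` are nonnegative and the weights `x` decrease. -/
theorem mul_sum_le_sum_mul_of_antitone {n : ℕ} {x a : ℕ → ℝ}
    (hanti : ∀ i, i + 1 < n + 1 → x (i + 1) ≤ x i)
    (ha : ∀ l ≤ n + 1, 0 ≤ ∑ i ∈ Finset.range l, a i) :
    x n * ∑ i ∈ Finset.range (n + 1), a i ≤ ∑ i ∈ Finset.range (n + 1), x i * a i := by
  induction n with
  | zero => simp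
  | succ n ih =>
    have h1 := ih (fun i hi => hanti i (by omega)) fun l hl => ha l (by omega)
    rw [Finset.sum_range_succ, Finset.sum_range_succ (fun i => x i * a i) (n + 1)]
    have h2 := mul_le_mul_of_nonneg_right (hanti n (by omega)) (ha (n + 1) (by omega))
    linarith

/-- A decreasing sequence whose partial products are bounded by those of another sequence has the
smaller sum. -/
theorem sum_le_sum_of_prod_le_prod {n : ℕ} {x y : ℕ → ℝ} (hx : ∀ i < n, 0 < x i)
    (hy : ∀ i < n, 0 < y i) (hanti : ∀ i, i + 1 < n → x (i + 1) ≤ x i)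
    (hprod : ∀ l ≤ n, ∏ i ∈ Finset.range l, x i ≤ ∏ i ∈ Finset.range l, y i) :
    ∑ i ∈ Finset.range n, x i ≤ ∑ i ∈ Finset.range n, y i ∧
      (∑ i ∈ Finset.range n, x i = ∑ i ∈ Finset.range n, y i → ∀ i < n, x i = y i) := by
  rcases n with _ | n
  · simp
  -- The product hypothesis says that the partial sums of `a` are nonnegative. Abel summation gives
  -- `0 ≤ ∑ x i * a i`, and `log z ≤ z - 1` gives `x i * a i ≤ y i - x i`, with equality only for `x
  -- i = y i`.
  set a : ℕ → ℝ := fun i => Real.log (y i / x i) with ha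
  have hz : ∀ i < n + 1, 0 < y i / x i := fun i hi => div_pos (hy i hi) (hx i hi)
  have hsum : ∀ l ≤ n + 1, 0 ≤ ∑ i ∈ Finset.range l, a i := by
    intro l hl
    rw [← Real.log_prod fun i hi => (hz i (by simp at hi; omega)).ne', Finset.prod_div_distrib]
    refine Real.log_nonneg ((one_le_div ?_).mpr (hprod l hl))
    exact Finset.prod_pos fun i hi => hx i (by simp at hi; omega)
  have h1 := mul_sum_le_sum_mul_of_antitone hanti hsum
  have h2 : 0 ≤ ∑ i ∈ Finset.range (n + 1), x i * a i :=
    (mul_nonneg (hx n (by omega)).le (hsum (n + 1) le_rfl)).trans h1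
  have h3 : ∀ i ∈ Finset.range (n + 1), x i * a i ≤ y i - x i := by
    intro i hi
    have hxi := hx i (by simpa using hi)
    have h4 := Real.log_le_sub_one_of_pos (hz i (by simpa using hi))
    have h5 := mul_le_mul_of_nonneg_left h4 hxi.le
    have h6 : x i * (y i / x i - 1) = y i - x i := by field_simp
    rwa [h6] at h5
  have h4 := Finset.sum_le_sum h3
  rw [Finset.sum_sub_distrib] at h4
  refine ⟨by linarith, fun heq i hi => ?_⟩
  have h5 : ∑ i ∈ Finset.range (n + 1), x i * a i = ∑ i ∈ Finset.range (n + 1), (y i - x i) := by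
    rw [Finset.sum_sub_distrib]
    linarith
  have h6 := (Finset.sum_eq_sum_iff_of_le h3).mp h5 i (by simpa using hi)
  have hxi := hx i hi
  by_contra hne
  have h7 := Real.log_lt_sub_one_of_pos (hz i hi) fun h => hne ((div_eq_one_iff_eq hxi.ne').mp h).symm
  have h8 := mul_lt_mul_of_pos_left h7 hxi
  have h9 : x i * (y i / x i - 1) = y i - x i := by field_simp
  rw [h9] at h8
  exact h8.ne h6

/-- Comparison of a decreasing sequence `x` with a sequence `y` for which the inequalities between
products and remaining sums are equalities up to the index `j`. -/
theorem eq_of_prod_le_of_tight {G : ℝ} (hG : 0 < G) {m n j : ℕ} (hjm : j ≤ m) (hmn : m ≤ n)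
    {x y : ℕ → ℝ} (hx : ∀ i < n, 0 < x i) (hy : ∀ i < n, 0 < y i)
    (hanti : ∀ i, i + 1 < n → x (i + 1) ≤ x i)
    (hsum : ∑ i ∈ Finset.range n, x i = ∑ i ∈ Finset.range n, y i)
    (hxk : ∀ k ≤ j, ∏ i ∈ Finset.range k, x i ≤ G * ∑ i ∈ Finset.Ico k n, x i)
    (hyk : ∀ k ≤ j, ∏ i ∈ Finset.range k, y i = G * ∑ i ∈ Finset.Ico k n, y i)
    (hmid : ∀ i, j < i → i < m → y i ≤ x i) (hend : ∀ i, m ≤ i → i < n → x i ≤ y i)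
    (hprod : ∏ i ∈ Finset.range m, x i ≤ ∏ i ∈ Finset.range m, y i) :
    ∀ i < n, x i = y i := by
  have hxp : ∀ l ≤ n, 0 < ∏ i ∈ Finset.range l, x i := fun l hl =>
    Finset.prod_pos fun i hi => hx i (by simp at hi; omega)
  have hyp : ∀ l ≤ n, 0 < ∏ i ∈ Finset.range l, y i := fun l hl =>
    Finset.prod_pos fun i hi => hy i (by simp at hi; omega)
  have hmidle : ∀ l, j < l → l ≤ m →
      ∏ i ∈ Finset.range l, x i ≤ ∏ i ∈ Finset.range l, y i := by
    intro l hjl hlm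
    have h1 : ∏ i ∈ Finset.Ico l m, y i ≤ ∏ i ∈ Finset.Ico l m, x i := by
      refine Finset.prod_le_prod (fun i hi => ?_) fun i hi => ?_
      · simp at hi
        exact (hy i (by omega)).le
      · simp at hi
        exact hmid i (by omega) hi.2
    have h2 : 0 < ∏ i ∈ Finset.Ico l m, y i := Finset.prod_pos fun i hi => by
      simp at hi
      exact hy i (by omega)
    rw [← Finset.prod_range_mul_prod_Ico x hlm, ← Finset.prod_range_mul_prod_Ico y hlm] at hprod
    have h3 := mul_le_mul_of_nonneg_left h1 (hxp l (by omega)).le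
    exact le_of_mul_le_mul_right (h3.trans hprod) h2
  have hlarge : ∀ l, j < l → l ≤ n →
      ∏ i ∈ Finset.range l, x i ≤ ∏ i ∈ Finset.range l, y i := by
    intro l hjl hln
    rcases le_or_gt l m with hlm | hlm
    · exact hmidle l hjl hlm
    · rw [← Finset.prod_range_mul_prod_Ico x hlm.le, ← Finset.prod_range_mul_prod_Ico y hlm.le]
      refine mul_le_mul hprod (Finset.prod_le_prod (fun i hi => ?_) fun i hi => ?_)
        (Finset.prod_nonneg fun i hi => ?_) (hyp m hmn).le
      · simp at hi
        exact (hx i (by omega)).le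
      · simp at hi
        exact hend i hi.1 (by omega)
      · simp at hi
        exact (hx i (by omega)).le
  -- If some partial product of `x` exceeds that of `y`, take the last such `k`. Beyond it the tails
  -- satisfy the product hypothesis, so the tail sum of `x` is at most that of `y`; but `hxk` and
  -- the tight `hyk` make it strictly larger. Otherwise majorization applies to the whole sequences.
  by_cases hex : ∃ k, k ≤ j ∧ ∏ i ∈ Finset.range k, y i < ∏ i ∈ Finset.range k, x i
  · exfalso
    obtain ⟨k, ⟨hkj, hk⟩, hmax⟩ : ∃ k, (k ≤ j ∧ ∏ i ∈ Finset.range k, y i <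
        ∏ i ∈ Finset.range k, x i) ∧ ∀ l, k < l → l ≤ j →
        ∏ i ∈ Finset.range l, x i ≤ ∏ i ∈ Finset.range l, y i := by
      classical
      obtain ⟨k0, hk0j, hk0⟩ := hex
      refine ⟨Nat.findGreatest (fun k => ∏ i ∈ Finset.range k, y i <
        ∏ i ∈ Finset.range k, x i) j, ⟨Nat.findGreatest_le j, ?_⟩, fun l hl hlj => ?_⟩
      · exact Nat.findGreatest_spec (P := fun k => ∏ i ∈ Finset.range k, y i <
          ∏ i ∈ Finset.range k, x i) hk0j hk0
      · exact not_lt.mp (Nat.findGreatest_is_greatest hl hlj)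
    have hkn : k ≤ n := by omega
    have hshift : ∀ l ≤ n - k, ∏ i ∈ Finset.range l, x (k + i) ≤
        ∏ i ∈ Finset.range l, y (k + i) := by
      intro l hl
      rcases Nat.eq_zero_or_pos l with rfl | hl0
      · simp
      have h1 : ∏ i ∈ Finset.range (k + l), x i ≤ ∏ i ∈ Finset.range (k + l), y i := by
        rcases le_or_gt (k + l) j with h | h
        · exact hmax _ (by omega) h
        · exact hlarge _ h (by omega)
      rw [Finset.prod_range_add, Finset.prod_range_add] at h1
      have h2 : 0 ≤ ∏ i ∈ Finset.range l, x (k + i) := Finset.prod_nonneg fun i hi => by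
        simp at hi
        exact (hx _ (by omega)).le
      have h3 := mul_le_mul_of_nonneg_right hk.le h2
      exact le_of_mul_le_mul_left (h3.trans h1) (hyp k hkn)
    have h1 := (sum_le_sum_of_prod_le_prod (n := n - k) (fun i hi => hx (k + i) (by omega))
      (fun i hi => hy (k + i) (by omega)) (fun i hi => hanti (k + i) (by omega)) hshift).1
    have h2 := hxk k hkj
    have h3 := hyk k hkj
    rw [Finset.sum_Ico_eq_sum_range] at h2 h3
    have h4 := mul_le_mul_of_nonneg_left h1 hG.le
    linarith
  · push Not at hex
    refine (sum_le_sum_of_prod_le_prod hx hy hanti fun l hl => ?_).2 hsum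
    rcases le_or_gt l j with h | h
    · exact hex l h
    · exact hlarge l h hl

/-- Strict quasi-concavity of `c ↦ c ^ a * (τ - b * c)`. -/
theorem min_lt_pow_mul_sub {a : ℕ} {τ b c₁ c c₂ : ℝ} (h0 : 0 < c₁) (h1 : c₁ < c) (h2 : c < c₂)
    (hb : 0 < b) (hτ : 0 < τ - b * c₂) :
    min (c₁ ^ a * (τ - b * c₁)) (c₂ ^ a * (τ - b * c₂)) < c ^ a * (τ - b * c) := by
  have hc : 0 < c := h0.trans h1
  have hτc : 0 < τ - b * c := by nlinarith
  -- If the value at `e` is at least that at `c`, the concave logarithm of the function must have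
  -- slope `a / c - b / (τ - b * c)` at `c` pointing towards `e`. Points on both sides of `c` would
  -- give this slope both signs.
  have key : ∀ e, 0 < e → e ≠ c → 0 < τ - b * e → c ^ a * (τ - b * c) ≤ e ^ a * (τ - b * e) →
      0 < (e - c) * (a / c - b / (τ - b * c)) := by
    intro e he hec hτe hle
    have hl := Real.log_le_log (by positivity) hle
    rw [Real.log_mul (by positivity) hτc.ne', Real.log_mul (by positivity) hτe.ne', Real.log_pow,
      Real.log_pow] at hl
    have hne : (τ - b * e) / (τ - b * c) ≠ 1 := by
      rw [Ne, div_eq_one_iff_eq hτc.ne']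
      intro h
      exact hec (mul_left_cancel₀ hb.ne' (by linarith))
    have h3 := Real.log_lt_sub_one_of_pos (div_pos hτe hτc) hne
    have h4 := Real.log_le_sub_one_of_pos (div_pos he hc)
    rw [Real.log_div hτe.ne' hτc.ne'] at h3
    rw [Real.log_div he.ne' hc.ne'] at h4
    have h5 := mul_le_mul_of_nonneg_left h4 (Nat.cast_nonneg (α := ℝ) a)
    have h6 : (e - c) * (a / c - b / (τ - b * c)) =
        a * (e / c - 1) + ((τ - b * e) / (τ - b * c) - 1) := by
      have h7 : τ - b * e = (τ - b * c) - b * (e - c) := by ring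
      rw [h7]
      generalize τ - b * c = D at hτc
      field_simp
      ring
    rw [h6]
    linarith
  by_contra! hle
  have h3 := key c₁ h0 h1.ne (by nlinarith) (hle.trans (min_le_left _ _))
  have h4 := key c₂ (hc.trans h2) h2.ne' hτ (hle.trans (min_le_right _ _))
  have h5 : 0 < a / c - b / (τ - b * c) := (mul_pos_iff_of_pos_left (by linarith)).mp h4
  nlinarith

/-! ### The Sylvester sequence and unit fraction partitions -/

theorem gSylvesterTrunc_one (g : ℕ) : gSylvesterTrunc g 1 = g := by
  simp [gSylvesterTrunc, gSylvester]

theorem gSylvester_succ (g k : ℕ) : gSylvester g (k + 1) = gSylvesterTrunc g (k + 1) + 1 := by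
  rcases k with _ | k <;> simp [gSylvesterTrunc, gSylvester]

theorem gSylvesterTrunc_succ (g k : ℕ) :
    gSylvesterTrunc g (k + 2) = gSylvesterTrunc g (k + 1) * (gSylvesterTrunc g (k + 1) + 1) := by
  rw [gSylvesterTrunc, gSylvester, gSylvester_succ]
  simp [mul_comm]

theorem gSylvesterTrunc_pos {g : ℕ} (hg : 0 < g) (k : ℕ) : 0 < gSylvesterTrunc g (k + 1) := by
  induction k with
  | zero => rwa [gSylvesterTrunc_one]
  | succ k ih =>
    rw [gSylvesterTrunc_succ]
    positivity

/-- Both sides satisfy the recursion `t_{k+1} = t_k * s_k`. Together with `sum_inv_gSylvester` this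
makes the product inequality of `IsUnitFractionLike` an equality along Sylvester reciprocals. -/
theorem prod_gSylvester (g k : ℕ) :
    g * ∏ i ∈ Finset.range k, gSylvester g (i + 1) = gSylvesterTrunc g (k + 1) := by
  induction k with
  | zero => simp [gSylvesterTrunc_one]
  | succ k ih => rw [Finset.prod_range_succ, ← mul_assoc, ih, gSylvesterTrunc_succ, gSylvester_succ]

theorem sum_inv_gSylvester {K : Type*} [Field K] [CharZero K] {g : ℕ} (hg : 0 < g) (k : ℕ) :
    ∑ i ∈ Finset.range k, (1 : K) / gSylvester g (i + 1) =
      1 / g - 1 / gSylvesterTrunc g (k + 1) := by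
  induction k with
  | zero => simp [gSylvesterTrunc_one]
  | succ k ih =>
    have h0 : (gSylvesterTrunc g (k + 1) : K) ≠ 0 := by exact_mod_cast (gSylvesterTrunc_pos hg k).ne'
    have h1 : (gSylvesterTrunc g (k + 1) : K) + 1 ≠ 0 := by norm_cast
    rw [Finset.sum_range_succ, ih, gSylvesterTrunc_succ, gSylvester_succ]
    push_cast
    field_simp
    ring

/-- The reciprocals of the Sylvester sequence up to `j`, then one value `z`, then the constant
value `c`. -/
noncomputable def blockSeq (g j : ℕ) (z c : ℝ) (i : ℕ) : ℝ :=
  if i < j then 1 / gSylvester g (i + 1) else if i = j then z else c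

theorem blockSeq_pos {g j : ℕ} {z c : ℝ} (hz : 0 < z) (hc : 0 < c) (i : ℕ) :
    0 < blockSeq g j z c i := by
  unfold blockSeq
  split_ifs
  · rw [gSylvester_succ]
    positivity
  · exact hz
  · exact hc

theorem prod_blockSeq {g : ℕ} (hg : 0 < g) {j k : ℕ} (hk : k ≤ j) (z c : ℝ) :
    ∏ i ∈ Finset.range k, blockSeq g j z c i = g / gSylvesterTrunc g (k + 1) := by
  have h1 : ∏ i ∈ Finset.range k, blockSeq g j z c i =
      ∏ i ∈ Finset.range k, ((gSylvester g (i + 1) : ℝ))⁻¹ := by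
    refine Finset.prod_congr rfl fun i hi => ?_
    simp at hi
    rw [blockSeq, if_pos (by omega), one_div]
  have h2 : (g : ℝ) * ∏ i ∈ Finset.range k, (gSylvester g (i + 1) : ℝ) =
    gSylvesterTrunc g (k + 1) := by exact_mod_cast prod_gSylvester g k
  have h0 : (g : ℝ) ≠ 0 := by positivity
  rw [h1, Finset.prod_inv_distrib, ← h2, div_mul_eq_div_div, div_self h0, one_div]

theorem prod_blockSeq_of_lt {g : ℕ} (hg : 0 < g) {j m : ℕ} (hm : j < m) (z c : ℝ) :
    ∏ i ∈ Finset.range m, blockSeq g j z c i =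
      g / gSylvesterTrunc g (j + 1) * (z * c ^ (m - 1 - j)) := by
  rw [← Finset.prod_range_mul_prod_Ico _ hm.le, prod_blockSeq hg le_rfl,
    Finset.prod_eq_prod_Ico_succ_bot hm]
  congr 2
  · simp [blockSeq]
  · rw [Finset.prod_congr rfl (g := fun _ => c), Finset.prod_const, Nat.card_Ico]
    · congr 1
      omega
    · intro i hi
      simp at hi
      rw [blockSeq, if_neg (by omega), if_neg (by omega)]

theorem sum_blockSeq {g : ℕ} (hg : 0 < g) {j k n : ℕ} (hk : k ≤ j) (hj : j < n) {z c : ℝ}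
    (hz : z + (n - 1 - j : ℕ) * c = 1 / gSylvesterTrunc g (j + 1)) :
    ∑ i ∈ Finset.Ico k n, blockSeq g j z c i = 1 / gSylvesterTrunc g (k + 1) := by
  have h1 : ∀ l, l ≤ j → ∑ i ∈ Finset.range l, blockSeq g j z c i =
      1 / g - 1 / gSylvesterTrunc g (l + 1) := by
    intro l hl
    rw [← sum_inv_gSylvester hg l]
    refine Finset.sum_congr rfl fun i hi => ?_
    simp at hi
    rw [blockSeq, if_pos (by omega)]
  have h2 : ∑ i ∈ Finset.Ico j n, blockSeq g j z c i = 1 / gSylvesterTrunc g (j + 1) := by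
    rw [Finset.sum_eq_sum_Ico_succ_bot hj, ← hz]
    congr 1
    · simp [blockSeq]
    · rw [Finset.sum_congr rfl (g := fun _ => c), Finset.sum_const, Nat.card_Ico, nsmul_eq_mul]
      · congr 2
        omega
      · intro i hi
        simp at hi
        rw [blockSeq, if_neg (by omega), if_neg (by omega)]
  have h3 := Finset.sum_range_add_sum_Ico (blockSeq g j z c) hk
  have h4 := h1 k hk
  have h5 := h1 j le_rfl
  rw [← Finset.sum_Ico_consecutive _ hk hj.le, h2]
  linarith

/-- Decreasing positive sequences of length `m + 2` with sum `1 / g` that behave like the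
reciprocals of integers. -/
structure IsUnitFractionLike (g m : ℕ) (x : ℕ → ℝ) : Prop where
  pos : ∀ i < m + 2, 0 < x i
  anti : ∀ i, i + 1 < m + 2 → x (i + 1) ≤ x i
  sum_eq : ∑ i ∈ Finset.range (m + 2), x i = 1 / g
  prod_le : ∀ k ≤ m, ∏ i ∈ Finset.range k, x i ≤ g * ∑ i ∈ Finset.Ico k (m + 2), x i

/-- The comparison principle `eq_of_prod_le_of_tight` applied to a block sequence, which is tight up
to `j`; the value `z` is fixed by the total sum. -/
theorem IsUnitFractionLike.eq_blockSeq {g m : ℕ} (hg : 0 < g) {x : ℕ → ℝ}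
    (hx : IsUnitFractionLike g m x) {j : ℕ} (hj : j < m) {z c : ℝ} (hz0 : 0 < z) (hc0 : 0 < c)
    (hz : z + (m + 1 - j : ℕ) * c = 1 / gSylvesterTrunc g (j + 1))
    (hmid : ∀ i, j < i → i < m → c ≤ x i) (hend : ∀ i, m ≤ i → i < m + 2 → x i ≤ c)
    (hprod : ∏ i ∈ Finset.range m, x i ≤ g / gSylvesterTrunc g (j + 1) * (z * c ^ (m - 1 - j))) :
    ∀ i < m + 2, x i = blockSeq g j z c i := by
  have hz' : z + (m + 2 - 1 - j : ℕ) * c = 1 / gSylvesterTrunc g (j + 1) := hz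
  refine eq_of_prod_le_of_tight (G := g) (by positivity) (m := m) (j := j) hj.le (by omega) hx.pos
    (fun i _ => blockSeq_pos hz0 hc0 i) hx.anti ?_ (fun k hk => hx.prod_le k (by omega)) ?_ ?_ ?_ ?_
  · rw [hx.sum_eq, Finset.range_eq_Ico, sum_blockSeq hg (Nat.zero_le j) (by omega) hz',
      gSylvesterTrunc_one]
  · intro k hk
    rw [prod_blockSeq hg hk, sum_blockSeq hg hk (by omega) hz']
    ring
  · intro i h1 h2
    rw [blockSeq, if_neg (by omega), if_neg (by omega)]
    exact hmid i h1 h2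
  · intro i h1 h2
    rw [blockSeq, if_neg (by omega), if_neg (by omega)]
    exact hend i h1 h2
  · rwa [prod_blockSeq_of_lt hg hj]

/-- The last value of the `j`-th candidate for the minimal product. -/
noncomputable def blockConst (g m j : ℕ) : ℝ :=
  1 / ((m + 2 - j : ℕ) * gSylvesterTrunc g (j + 1))

/-- The product of the reciprocals of the first `m` entries of the `j`-th candidate. -/
noncomputable def blockProd (g m j : ℕ) : ℝ :=
  gSylvesterTrunc g (j + 1) / g * ((m + 2 - j : ℕ) * gSylvesterTrunc g (j + 1) : ℝ) ^ (m - j)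

theorem blockConst_pos {g m j : ℕ} (hg : 0 < g) (hj : j < m) : 0 < blockConst g m j := by
  have h1 : (0 : ℝ) < gSylvesterTrunc g (j + 1) := by exact_mod_cast gSylvesterTrunc_pos hg j
  have h2 : (0 : ℝ) < (m + 2 - j : ℕ) := by exact_mod_cast (by omega : 0 < m + 2 - j)
  unfold blockConst
  positivity

theorem blockProd_pos {g m j : ℕ} (hg : 0 < g) (hj : j < m) : 0 < blockProd g m j := by
  have h1 : (0 : ℝ) < gSylvesterTrunc g (j + 1) := by exact_mod_cast gSylvesterTrunc_pos hg j
  have h2 : (0 : ℝ) < (m + 2 - j : ℕ) := by exact_mod_cast (by omega : 0 < m + 2 - j)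
  unfold blockProd
  positivity

theorem blockConst_add {g m j : ℕ} (hg : 0 < g) (hj : j < m) :
    blockConst g m j + (m + 1 - j : ℕ) * blockConst g m j = 1 / gSylvesterTrunc g (j + 1) := by
  have h1 : (gSylvesterTrunc g (j + 1) : ℝ) ≠ 0 := by exact_mod_cast (gSylvesterTrunc_pos hg j).ne'
  have h2 : ((m + 2 - j : ℕ) : ℝ) = (m + 1 - j : ℕ) + 1 := by
    exact_mod_cast (by omega : m + 2 - j = (m + 1 - j) + 1)
  have h3 : ((m + 1 - j : ℕ) : ℝ) + 1 ≠ 0 := by positivity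
  rw [blockConst, h2]
  field_simp
  ring

theorem inv_blockProd {g m j : ℕ} (hj : j < m) :
    1 / blockProd g m j = g / gSylvesterTrunc g (j + 1) *
      (blockConst g m j * blockConst g m j ^ (m - 1 - j)) := by
  rw [← pow_succ', show m - 1 - j + 1 = m - j by omega, blockProd, blockConst, one_div_pow,
    one_div, mul_inv, inv_div, one_div]

/-- In the family of block sequences for `j`, the constant of candidate `j + 1` makes the free value
`1 / (t_{j+1} + 1)`, the next Sylvester reciprocal. So candidates `j` and `j + 1` are the two ends
of one family. -/
theorem inv_blockProd_succ {g m j : ℕ} (hg : 0 < g) (hj : j + 1 < m) :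
    1 / blockProd g m (j + 1) = g / gSylvesterTrunc g (j + 1) *
      ((1 / gSylvesterTrunc g (j + 1) - (m + 1 - j : ℕ) * blockConst g m (j + 1)) *
        blockConst g m (j + 1) ^ (m - 1 - j)) := by
  have h1 : (gSylvesterTrunc g (j + 1) : ℝ) ≠ 0 := by exact_mod_cast (gSylvesterTrunc_pos hg j).ne'
  have h2 : ((m + 1 - j : ℕ) : ℝ) ≠ 0 := by
    exact_mod_cast (by omega : m + 1 - j ≠ 0)
  have h3 : (gSylvesterTrunc g (j + 1) : ℝ) + 1 ≠ 0 := by norm_cast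
  have h4 : (1 / gSylvesterTrunc g (j + 1) - (m + 1 - j : ℕ) * blockConst g m (j + 1) : ℝ) =
      1 / (gSylvesterTrunc g (j + 1) + 1) := by
    rw [blockConst, gSylvesterTrunc_succ, show m + 2 - (j + 1) = m + 1 - j by omega]
    push_cast
    field_simp
    ring
  rw [h4, inv_blockProd hj, ← pow_succ', show m - 1 - (j + 1) + 1 = m - 1 - j by omega,
    gSylvesterTrunc_succ, ← mul_assoc]
  congr 1
  push_cast
  field_simp

/-- If the first `m` entries have a product that is at most that of every candidate, then the
sequence is one of the candidates. -/
theorem IsUnitFractionLike.eq_candidate {g m : ℕ} (hg : 0 < g) (hm : 0 < m) {x : ℕ → ℝ}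
    (hx : IsUnitFractionLike g m x) {M : ℝ} (hM : ∀ j < m, blockProd g m j ≤ M)
    (hprod : ∏ i ∈ Finset.range m, x i ≤ 1 / M) :
    ∃ j < m, blockProd g m j = M ∧
      ∀ i < m + 2, x i = blockSeq g j (blockConst g m j) (blockConst g m j) i := by
  have hM0 : 0 < M := (blockProd_pos hg hm).trans_le (hM 0 hm)
  have hMinv : ∀ j < m, 1 / M ≤ 1 / blockProd g m j := fun j hj =>
    one_div_le_one_div_of_le (blockProd_pos hg hj) (hM j hj)
  have hanti : ∀ i k, i ≤ k → k < m + 2 → x k ≤ x i := by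
    intro i k hik
    induction k, hik using Nat.le_induction with
    | base => exact fun _ => le_rfl
    | succ k _ ih => exact fun hk => (hx.anti k hk).trans (ih (by omega))
  have finish : ∀ j < m,
      (∀ i < m + 2, x i = blockSeq g j (blockConst g m j) (blockConst g m j) i) →
      ∃ j < m, blockProd g m j = M ∧
        ∀ i < m + 2, x i = blockSeq g j (blockConst g m j) (blockConst g m j) i := by
    intro j hj hxj
    refine ⟨j, hj, le_antisymm (hM j hj) ?_, hxj⟩
    have h1 : ∏ i ∈ Finset.range m, x i = 1 / blockProd g m j := by
      rw [inv_blockProd hj, ← prod_blockSeq_of_lt hg hj]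
      exact Finset.prod_congr rfl fun i hi => hxj i (by simp at hi; omega)
    rw [h1] at hprod
    exact le_of_one_div_le_one_div (blockProd_pos hg hj) hprod
  set c := x (m - 1) with hc
  have hc0 : 0 < c := hx.pos _ (by omega)
  -- The position of `c = x (m - 1)` among the candidate constants decides which block sequence is
  -- compared with `x`.
  rcases le_or_gt c (blockConst g m (m - 1)) with hle | hgt
  · refine finish (m - 1) (by omega) ?_
    refine hx.eq_blockSeq hg (by omega) (blockConst_pos hg (by omega)) (blockConst_pos hg (by omega))
      (blockConst_add hg (by omega)) (fun i h1 h2 => by omega)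
      (fun i h1 h2 => (hanti (m - 1) i (by omega) h2).trans hle) ?_
    rw [← inv_blockProd (by omega)]
    exact hprod.trans (hMinv _ (by omega))
  rcases lt_or_ge (blockConst g m 0) c with hlarge | hsmall
  · exfalso
    have h1 : c ^ m ≤ ∏ i ∈ Finset.range m, x i := by
      rw [← Finset.card_range m, ← Finset.prod_const, Finset.card_range]
      refine Finset.prod_le_prod (fun _ _ => hc0.le) fun i hi => ?_
      simp at hi
      exact hanti i (m - 1) (by omega) (by omega)
    have h2 : 1 / blockProd g m 0 = blockConst g m 0 ^ m := by
      have h0 : (g : ℝ) ≠ 0 := by positivity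
      rw [inv_blockProd hm, ← pow_succ', gSylvesterTrunc_one, div_self h0, one_mul]
      congr 1
      omega
    have h3 := pow_lt_pow_left₀ hlarge (blockConst_pos hg hm).le hm.ne'
    have h4 := hMinv 0 hm
    linarith
  -- Discrete intermediate values: the constants are at least `c` at index 0 and below `c` at `m -
  -- 1`.
  obtain ⟨j, hj, hjc, hcj⟩ : ∃ j, j + 1 < m ∧ blockConst g m (j + 1) < c ∧ c ≤ blockConst g m j := by
    by_contra! hcon
    have : ∀ j < m, c ≤ blockConst g m j := by
      intro j
      induction j with
      | zero => exact fun _ => hsmall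
      | succ j ih =>
        intro hj
        by_contra! h
        exact absurd (hcon j hj h) (not_lt.mpr (ih (by omega)))
    exact absurd (this (m - 1) (by omega)) (not_le.mpr hgt)
  have hTpos : (0 : ℝ) < gSylvesterTrunc g (j + 1) := by exact_mod_cast gSylvesterTrunc_pos hg j
  have hb : (0 : ℝ) < (m + 1 - j : ℕ) := by exact_mod_cast (by omega : 0 < m + 1 - j)
  have hz2 : 1 / (gSylvesterTrunc g (j + 1) : ℝ) - (m + 1 - j : ℕ) * blockConst g m j =
      blockConst g m j := by
    rw [← blockConst_add hg (show j < m by omega)]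
    ring
  have hK : (0 : ℝ) < g / gSylvesterTrunc g (j + 1) := by positivity
  have happly : ∀ z, 0 < z → z + (m + 1 - j : ℕ) * c = 1 / gSylvesterTrunc g (j + 1) →
      ∏ i ∈ Finset.range m, x i ≤ g / gSylvesterTrunc g (j + 1) * (z * c ^ (m - 1 - j)) →
      ∀ i < m + 2, x i = blockSeq g j z c i := by
    intro z hz hzc hle
    exact hx.eq_blockSeq hg (by omega) hz hc0 hzc
      (fun i h1 h2 => hanti i (m - 1) (by omega) (by omega))
      (fun i h1 h2 => hanti (m - 1) i (by omega) h2) hle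
  rcases hcj.eq_or_lt with heq | hlt
  · refine finish j (by omega) ?_
    rw [← heq]
    refine happly c hc0 ?_ ?_
    · rw [heq]
      exact blockConst_add hg (by omega)
    · rw [heq, ← inv_blockProd (by omega)]
      exact hprod.trans (hMinv _ (by omega))
  · exfalso
    -- Strictly between two constants, the block sequence with constant `c` has a larger product
    -- than one of the two candidates, hence one above `1 / M`. The comparison then identifies `x`
    -- with this sequence, whose product is too large.
    have h1 := min_lt_pow_mul_sub (a := m - 1 - j) (blockConst_pos hg hj) hjc hlt hb
      (τ := 1 / gSylvesterTrunc g (j + 1)) (by rw [hz2]; exact blockConst_pos hg (by omega))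
    have h2 := mul_lt_mul_of_pos_left h1 hK
    rw [mul_min_of_nonneg _ _ hK.le, hz2,
      mul_comm (blockConst g m (j + 1) ^ _), ← inv_blockProd_succ hg hj,
      mul_comm (blockConst g m j ^ _), ← inv_blockProd (by omega), mul_comm (c ^ _)] at h2
    have h3 : 1 / M ≤ min (1 / blockProd g m (j + 1)) (1 / blockProd g m j) :=
      le_min (hMinv _ hj) (hMinv _ (by omega))
    have h4 := (hprod.trans h3).trans_lt h2
    have hz0 : 0 < 1 / (gSylvesterTrunc g (j + 1) : ℝ) - (m + 1 - j : ℕ) * c := by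
      have := mul_lt_mul_of_pos_left hlt hb
      have := blockConst_pos hg (show j < m by omega)
      linarith
    have h5 := happly _ hz0 (by ring) h4.le
    have h6 : ∏ i ∈ Finset.range m, x i = g / gSylvesterTrunc g (j + 1) *
        ((1 / gSylvesterTrunc g (j + 1) - (m + 1 - j : ℕ) * c) * c ^ (m - 1 - j)) := by
      rw [← prod_blockSeq_of_lt hg (show j < m by omega)]
      exact Finset.prod_congr rfl fun i hi => h5 i (by simp at hi; omega)
    exact h4.ne h6

/-! ### The maximal products -/

theorem succ_mul_add_two_pow_lt {n : ℕ} (hn : 3 ≤ n) :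
    ((n : ℝ) + 1) * (n + 2) ^ n < (2 * (n + 1)) ^ n := by
  -- The ratio 8/5 is the value of `2 (n + 1) / (n + 2)` at `n = 3`, the smallest value on `n ≥ 3`;
  -- it still suffices there, as `4 < 4.096`.
  have h1 : ∀ n : ℕ, 3 ≤ n → (n : ℝ) + 1 < (8 / 5) ^ n := by
    intro n hn
    induction n, hn using Nat.le_induction with
    | base => norm_num
    | succ n hn ih =>
      have : (3 : ℝ) ≤ n := by exact_mod_cast hn
      rw [pow_succ]
      push_cast
      linarith
  have h2 : (3 : ℝ) ≤ n := by exact_mod_cast hn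
  have h3 : (8 / 5 * ((n : ℝ) + 2)) ^ n ≤ (2 * (n + 1)) ^ n :=
    pow_le_pow_left₀ (by positivity) (by linarith) n
  rw [mul_pow] at h3
  have h4 := mul_lt_mul_of_pos_right (h1 n hn) (show (0 : ℝ) < ((n : ℝ) + 2) ^ n by positivity)
  linarith

theorem mul_two_pow_le {t : ℝ} (ht : 1 ≤ t) {n : ℕ} (hn : 2 ≤ n) : t * 2 ^ n ≤ (t + 1) ^ n := by
  obtain ⟨k, rfl⟩ := Nat.exists_eq_add_of_le' hn
  have h1 : (2 : ℝ) ^ k ≤ (t + 1) ^ k := pow_le_pow_left₀ (by norm_num) (by linarith) k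
  have h2 : t * 2 ^ 2 ≤ (t + 1) ^ 2 := by nlinarith [sq_nonneg (t - 1)]
  rw [pow_add, pow_add]
  have h3 := mul_le_mul h1 h2 (by positivity) (by positivity)
  linarith

theorem blockProd_lt_succ {g m j : ℕ} (hg : 0 < g) (hj : j + 2 < m) :
    blockProd g m j < blockProd g m (j + 1) := by
  obtain ⟨n, rfl⟩ := Nat.exists_eq_add_of_le' (show j + 3 ≤ m by omega)
  have h1 : (1 : ℝ) ≤ gSylvesterTrunc g (j + 1) := by exact_mod_cast gSylvesterTrunc_pos hg j
  rw [blockProd, blockProd, gSylvesterTrunc_succ, show n + (j + 3) + 2 - j = n + 3 + 2 by omega,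
    show n + (j + 3) - j = n + 3 by omega, show n + (j + 3) + 2 - (j + 1) = n + 3 + 1 by omega,
    show n + (j + 3) - (j + 1) = n + 2 by omega]
  push_cast
  set t : ℝ := (gSylvesterTrunc g (j + 1) : ℝ)
  have hg' : (0 : ℝ) < g := by exact_mod_cast hg
  have h2 := succ_mul_add_two_pow_lt (n := n + 3) (by omega)
  have h3 := mul_two_pow_le h1 (n := n + 3) (by omega)
  push_cast at h2
  rw [div_mul_eq_mul_div, div_mul_eq_mul_div, div_lt_div_iff_of_pos_right hg']
  have hn : (0 : ℝ) ≤ n := Nat.cast_nonneg n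
  -- After cancelling powers of `t`, this separates into a bound in `n` alone (`h2`) and a bound in
  -- `t` alone (`h3`), linked by the factor `2 ^ (n + 3)`.
  have h4 : t * ((n : ℝ) + 3 + 2) ^ (n + 3) < ((n : ℝ) + 3 + 1) ^ (n + 2) * (t + 1) ^ (n + 3) := by
    rw [mul_pow, pow_succ (((n : ℝ) + 3 + 1)) (n + 2)] at h2
    have h5 : ((n : ℝ) + 3 + 2) ^ (n + 3) < 2 ^ (n + 3) * ((n : ℝ) + 3 + 1) ^ (n + 2) := by
      refine lt_of_mul_lt_mul_left (a := (n : ℝ) + 3 + 1) ?_ (by positivity)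
      linarith
    have h6 := mul_lt_mul_of_pos_left h5 (show 0 < t by linarith)
    have h7 := mul_le_mul_of_nonneg_right h3
      (show (0 : ℝ) ≤ ((n : ℝ) + 3 + 1) ^ (n + 2) by positivity)
    linarith
  have h5 := mul_lt_mul_of_pos_left h4 (show 0 < t ^ (n + 3) by positivity)
  calc t * (((n : ℝ) + 3 + 2) * t) ^ (n + 3)
      = t ^ (n + 3) * (t * ((n : ℝ) + 3 + 2) ^ (n + 3)) := by rw [mul_pow]; ring
    _ < t ^ (n + 3) * (((n : ℝ) + 3 + 1) ^ (n + 2) * (t + 1) ^ (n + 3)) := h5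
    _ = t * (t + 1) * (((n : ℝ) + 3 + 1) * (t * (t + 1))) ^ (n + 2) := by
        rw [mul_pow, mul_pow]; ring

theorem blockProd_pred (g m : ℕ) :
    blockProd g (m + 1) m = 3 * (gSylvesterTrunc g (m + 1) : ℝ) ^ 2 / g := by
  rw [blockProd, show m + 1 + 2 - m = 3 by omega, show m + 1 - m = 1 by omega]
  push_cast
  ring

theorem blockProd_pred_pred (g m : ℕ) :
    blockProd g (m + 2) m = 16 * (gSylvesterTrunc g (m + 1) : ℝ) ^ 3 / g := by
  rw [blockProd, show m + 2 + 2 - m = 4 by omega, show m + 2 - m = 2 by omega]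
  push_cast
  ring

theorem blockProd_le_pred_pred {g m : ℕ} (hg : 0 < g) {j : ℕ} (hj : j ≤ m) :
    blockProd g (m + 2) j ≤ blockProd g (m + 2) m ∧
      (blockProd g (m + 2) j = blockProd g (m + 2) m → j = m) := by
  have key : ∀ i, i ≤ m → blockProd g (m + 2) (m - i) ≤ blockProd g (m + 2) m ∧
      (blockProd g (m + 2) (m - i) = blockProd g (m + 2) m → i = 0) := by
    intro i
    induction i with
    | zero => simp
    | succ i ih =>
      intro hi
      have h1 := blockProd_lt_succ hg (show m - (i + 1) + 2 < m + 2 by omega)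
      rw [show m - (i + 1) + 1 = m - i by omega] at h1
      have h2 := (ih (by omega)).1
      exact ⟨by linarith, fun h => by linarith⟩
  have h1 := key (m - j) (by omega)
  rw [show m - (m - j) = j by omega] at h1
  exact ⟨h1.1, fun h => by have := h1.2 h; omega⟩

/-- The last two candidates compare by the sign of `t - 3`. This is the source of the exceptional
pairs `(d, g)`. -/
theorem blockProd_pred_sub (g m : ℕ) :
    blockProd g (m + 2) (m + 1) - blockProd g (m + 2) m =
      (gSylvesterTrunc g (m + 1) : ℝ) ^ 2 / g * ((3 * gSylvesterTrunc g (m + 1) - 1) *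
        (gSylvesterTrunc g (m + 1) - 3)) := by
  rw [blockProd_pred, blockProd_pred_pred, gSylvesterTrunc_succ]
  push_cast
  ring

/-! ### Multiplicity bounds -/

/-- Multiplying `1 / g` minus a sum of unit fractions by all denominators gives an integer; when it
is positive it is at least 1, which bounds the remainder from below. -/
theorem exists_int_eq_mul_sub_sum {g : ℕ} (hg : 0 < g) {B : ℕ → ℤ} (hB : ∀ i, 0 < B i) (k : ℕ) :
    ∃ N : ℤ, (N : ℝ) = g * (∏ i ∈ Finset.range k, (B i : ℝ)) *
      (1 / g - ∑ i ∈ Finset.range k, 1 / (B i : ℝ)) := by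
  have hg' : (g : ℝ) ≠ 0 := by positivity
  induction k with
  | zero => exact ⟨1, by simp [hg']⟩
  | succ k ih =>
    obtain ⟨N, hN⟩ := ih
    refine ⟨N * B k - g * ∏ i ∈ Finset.range k, B i, ?_⟩
    have hBk : (B k : ℝ) ≠ 0 := by exact_mod_cast (hB k).ne'
    push_cast
    rw [hN, Finset.prod_range_succ, Finset.sum_range_succ]
    field_simp
    ring

theorem isUnitFractionLike_inv {g m : ℕ} (hg : 0 < g) {B : ℕ → ℤ} (hB : ∀ i, 0 < B i)
    (hmono : ∀ i, i + 1 < m + 2 → B i ≤ B (i + 1))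
    (hsum : ∑ i ∈ Finset.range (m + 2), 1 / (B i : ℝ) = 1 / g) :
    IsUnitFractionLike g m fun i => 1 / (B i : ℝ) := by
  have hB' : ∀ i, (0 : ℝ) < B i := fun i => by exact_mod_cast hB i
  refine ⟨fun i _ => one_div_pos.mpr (hB' i), fun i hi => ?_, hsum, fun k hk => ?_⟩
  · exact one_div_le_one_div_of_le (hB' i) (by exact_mod_cast hmono i hi)
  · obtain ⟨N, hN⟩ := exists_int_eq_mul_sub_sum hg hB k
    have h1 := Finset.sum_range_add_sum_Ico (fun i => 1 / (B i : ℝ)) (show k ≤ m + 2 by omega)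
    have h2 : 0 < ∑ i ∈ Finset.Ico k (m + 2), 1 / (B i : ℝ) :=
      Finset.sum_pos (fun i _ => one_div_pos.mpr (hB' i)) ⟨k, by simp; omega⟩
    have h3 : (1 : ℝ) / g - ∑ i ∈ Finset.range k, 1 / (B i : ℝ) =
        ∑ i ∈ Finset.Ico k (m + 2), 1 / (B i : ℝ) := by
      rw [← hsum]
      linarith
    rw [h3] at hN
    have hP : 0 < ∏ i ∈ Finset.range k, (B i : ℝ) := Finset.prod_pos fun i _ => hB' i
    have hg' : (0 : ℝ) < g := by exact_mod_cast hg
    have h4 : (0 : ℝ) < N := by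
      rw [hN]
      positivity
    have h5 : (1 : ℝ) ≤ N := by
      have : 0 < N := by exact_mod_cast h4
      exact_mod_cast this
    have h6 : ∏ i ∈ Finset.range k, 1 / (B i : ℝ) = 1 / ∏ i ∈ Finset.range k, (B i : ℝ) := by
      simp
    rw [h6, div_le_iff₀ hP]
    linarith

/-- The `j`-th candidate for the numbers `A i` of a simplex with maximal multiplicity. -/
def candidate (g m j i : ℕ) : ℤ :=
  if i < j then gSylvester g (i + 1) else (m + 2 - j : ℕ) * gSylvesterTrunc g (j + 1)

theorem one_div_candidate {g m j i : ℕ} :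
    1 / (candidate g m j i : ℝ) = blockSeq g j (blockConst g m j) (blockConst g m j) i := by
  unfold candidate blockSeq
  split_ifs with h1 h2 <;> simp [blockConst]

/-- Here `d = m + 1`. As `A` increases, `∏ A i / A_d ^ 2` is at most the product `P` of the first
`m` entries, and only candidates can have `P ≥ M`. -/
theorem IsFanoPair.multiplicity_le {g m : ℕ} (hm : 0 < m) {A : Fin (m + 1 + 1) → ℤ}
    {v u : Fin (m + 1 + 1) → Fin (m + 1) → ℤ} (h : IsFanoPair g A v u) (hA : Monotone A) {M : ℝ}
    (hM : ∀ j < m, blockProd g m j ≤ M) :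
    (simplexMultiplicity (integralHull v) : ℝ) ≤ M ∧
      ((simplexMultiplicity (integralHull v) : ℝ) = M →
        (simplexMultiplicity (integralHull v) : ℤ) * A (Fin.last (m + 1)) ^ 2 = ∏ i, A i ∧
        ∃ j < m, blockProd g m j = M ∧ ∀ i, A i = candidate g m j i) := by
  have hg := h.index_pos
  have hM0 : 0 < M := (blockProd_pos hg hm).trans_le (hM 0 hm)
  -- `Fin.ofNat` wraps around, so `B` is positive at every natural index.
  set B : ℕ → ℤ := fun i => A (Fin.ofNat (m + 1 + 1) i) with hB
  have hBA : ∀ i : Fin (m + 1 + 1), B i = A i := by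
    intro i
    simp [hB]
  have hB0 : ∀ i, 0 < B i := fun i => h.pos _
  have hB0' : ∀ i, (0 : ℝ) < B i := fun i => by exact_mod_cast hB0 i
  have hg' : (g : ℝ) ≠ 0 := by positivity
  have hmono : ∀ i, i + 1 < m + 2 → B i ≤ B (i + 1) := by
    intro i hi
    have h1 := hBA ⟨i, by omega⟩
    have h2 := hBA ⟨i + 1, by omega⟩
    simp only at h1 h2
    rw [h1, h2]
    exact hA (by simp [Fin.le_def])
  have hsum : ∑ i ∈ Finset.range (m + 2), 1 / (B i : ℝ) = 1 / g := by
    rw [Finset.sum_range]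
    have h1 : ((∑ i, (g : ℚ) / A i : ℚ) : ℝ) = ((1 : ℚ) : ℝ) := congrArg _ h.sum_inv
    push_cast at h1
    simp only [hBA]
    rw [eq_div_iff hg', Finset.sum_mul]
    refine Eq.trans ?_ h1
    exact Finset.sum_congr rfl fun i _ => by ring
  have hx := isUnitFractionLike_inv hg hB0 hmono hsum
  set P : ℤ := ∏ i ∈ Finset.range m, B i with hP
  have hP0 : 0 < P := Finset.prod_pos fun i _ => hB0 i
  have hP0' : (0 : ℝ) < P := by exact_mod_cast hP0
  have hprod : ∏ i, A i = P * B m * B (m + 1) := by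
    have h1 : ∏ i ∈ Finset.range (m + 2), B i = ∏ i, A i := by
      rw [Finset.prod_range]
      exact Finset.prod_congr rfl fun i _ => hBA i
    rw [← h1, Finset.prod_range_succ, Finset.prod_range_succ]
  have hlast : A (Fin.last (m + 1)) = B (m + 1) := (hBA (Fin.last (m + 1))).symm
  have hmultP : (simplexMultiplicity (integralHull v) : ℤ) ≤ P := by
    have h1 := h.multiplicity_mul_sq_le
    rw [hprod, hlast] at h1
    have h2 := mul_le_mul_of_nonneg_left (hmono m (by omega)) (mul_pos hP0 (hB0 (m + 1))).le
    have h3 : 0 < B (m + 1) ^ 2 := pow_pos (hB0 _) 2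
    refine le_of_mul_le_mul_right ?_ h3
    linarith
  have hxP : ∏ i ∈ Finset.range m, 1 / (B i : ℝ) = 1 / P := by
    rw [hP]
    push_cast
    simp
  -- Gives the bound and the equality case together: `P > M` would also imply `P = M`.
  have hcand : M ≤ P → ((P : ℝ) = M ∧ B m = B (m + 1) ∧
      ∃ j < m, blockProd g m j = M ∧ ∀ i, A i = candidate g m j i) := by
    intro hMP
    obtain ⟨j, hj, hjM, hji⟩ := hx.eq_candidate hg hm hM
      (by rw [hxP]; exact one_div_le_one_div_of_le hM0 hMP)
    have hBc : ∀ i < m + 2, B i = candidate g m j i := by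
      intro i hi
      have h1 := hji i hi
      rw [← one_div_candidate, one_div, one_div, inv_inj] at h1
      exact_mod_cast h1
    refine ⟨?_, ?_, j, hj, hjM, fun i => ?_⟩
    · have h1 : ∏ i ∈ Finset.range m, 1 / (B i : ℝ) = 1 / M := by
        rw [← hjM, inv_blockProd hj, ← prod_blockSeq_of_lt hg hj]
        exact Finset.prod_congr rfl fun i hi => hji i (by simp at hi; omega)
      rw [hxP, one_div, one_div, inv_inj] at h1
      exact h1
    · rw [hBc m (by omega), hBc (m + 1) (by omega), candidate, candidate, if_neg (by omega),
        if_neg (by omega)]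
    · rw [← hBA i, hBc i i.isLt]
  have hmultP' : (simplexMultiplicity (integralHull v) : ℝ) ≤ P := by exact_mod_cast hmultP
  have hPM : (P : ℝ) ≤ M := by
    by_contra! hlt
    exact hlt.ne' (hcand hlt.le).1
  refine ⟨hmultP'.trans hPM, fun heq => ?_⟩
  obtain ⟨h1, h2, h3⟩ := hcand (heq ▸ hmultP')
  refine ⟨?_, h3⟩
  have h4 : (simplexMultiplicity (integralHull v) : ℤ) = P := by
    rw [← h1] at heq
    exact_mod_cast heq
  rw [hprod, hlast, h4, h2]
  ring

/-! ### Dual relations -/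

namespace IsFanoPair

variable {d g : ℕ} {A : Fin (d + 1) → ℤ} {v u : Fin (d + 1) → Fin d → ℤ}

theorem eq_zero_of_dotProduct_vertices (h : IsFanoPair g A v u) {z : Fin d → ℚ}
    (hz : ∀ j, z ⬝ᵥ (fun k => (v j k : ℚ)) = 0) : z = 0 := by
  set b := simplexBasis _ h.affineIndependent with hb
  have h1 : ∀ y, z ⬝ᵥ y = 0 := by
    intro y
    rw [← b.linear_combination_coord_eq_self y, dotProduct_sum]
    refine Finset.sum_eq_zero fun j _ => ?_
    rw [dotProduct_smul, hb, coe_simplexBasis, hz, smul_zero]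
  exact dotProduct_self_eq_zero.mp (h1 z)

/-- The origin has the same barycentric coordinates `g / A i` in the dual simplex; this is checked
by pairing with all vertices. -/
theorem dual_relation (h : IsFanoPair g A v u) (k : Fin d) :
    ∑ i, (g : ℚ) / A i * u i k = 0 := by
  have h1 : (∑ i, ((g : ℚ) / A i) • fun k => (u i k : ℚ)) = 0 := by
    refine h.eq_zero_of_dotProduct_vertices fun j => ?_
    simp only [sum_dotProduct, smul_dotProduct, h.pairing_cast, smul_eq_mul, mul_sub, mul_ite,
      mul_zero, Finset.sum_sub_distrib, Finset.sum_ite_eq', Finset.mem_univ, if_true,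
      ← Finset.sum_mul, h.sum_inv]
    have := h.cast_ne_zero j
    field_simp
    ring
  simpa using congrFun h1 k

theorem sum_mul_dotProduct (h : IsFanoPair g A v u) (x : Fin d → ℤ) :
    ∑ i, (g : ℚ) / A i * (u i ⬝ᵥ x : ℤ) = 0 := by
  have h1 : ∑ k, (x k : ℚ) * ∑ i, (g : ℚ) / A i * u i k = 0 := by simp [h.dual_relation]
  rw [← h1]
  simp only [dotProduct, Int.cast_sum, Int.cast_mul, Finset.mul_sum]
  rw [Finset.sum_comm]
  exact Finset.sum_congr rfl fun j _ => Finset.sum_congr rfl fun k _ => by ring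

/-- Reconstructs a vector from its pairings: both sides have the same pairing with every functional
in `functionalMatrix u`, which is invertible over `ℚ`. -/
theorem sum_dotProduct_div_mul (h : IsFanoPair g A v u) (x : Fin d → ℤ) (k : Fin d) :
    ∑ j, ((u j ⬝ᵥ x : ℤ) : ℚ) / A j * v j k = x k := by
  set N : Matrix (Fin d) (Fin d) ℚ := (functionalMatrix u).map (Int.cast : ℤ → ℚ) with hN
  have hdet : N.det ≠ 0 := by
    rw [hN, ← Int.cast_det]
    exact_mod_cast h.det_functionalMatrix_ne_zero
  set z : Fin d → ℚ := fun k => ∑ j, ((u j ⬝ᵥ x : ℤ) : ℚ) / A j * v j k - x k with hz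
  have hg : (g : ℚ) ≠ 0 := by exact_mod_cast h.index_pos.ne'
  have h0 : ∑ j, ((u j ⬝ᵥ x : ℤ) : ℚ) / A j = 0 := by
    have h1 := h.sum_mul_dotProduct x
    have h2 : ∑ i, (g : ℚ) / A i * (u i ⬝ᵥ x : ℤ) = g * ∑ j, ((u j ⬝ᵥ x : ℤ) : ℚ) / A j := by
      rw [Finset.mul_sum]
      exact Finset.sum_congr rfl fun i _ => by ring
    rw [h2] at h1
    exact (mul_eq_zero.mp h1).resolve_left hg
  have h1 : N.mulVec z = 0 := by
    ext i
    have h2 : z = (∑ j, (((u j ⬝ᵥ x : ℤ) : ℚ) / A j) • fun k => (v j k : ℚ)) -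
        fun k => (x k : ℚ) := by
      ext k
      simp [hz]
    have h3 : N.mulVec z i = (fun k => (u i.castSucc k : ℚ)) ⬝ᵥ z := rfl
    have h4 : (fun k => (u i.castSucc k : ℚ)) ⬝ᵥ (fun k => (x k : ℚ)) =
        ((u i.castSucc ⬝ᵥ x : ℤ) : ℚ) := by simp [dotProduct]
    rw [h3, h2, dotProduct_sub, dotProduct_sum, h4]
    simp only [dotProduct_smul, h.pairing_cast, smul_eq_mul, mul_sub, mul_ite, mul_zero,
      Finset.sum_sub_distrib, Finset.sum_ite_eq, Finset.mem_univ, if_true, ← Finset.sum_mul, h0]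
    have := h.cast_ne_zero i.castSucc
    simp only [Pi.zero_apply]
    field_simp
    ring
  have h2 := congrFun (Matrix.eq_zero_of_mulVec_eq_zero hdet h1) k
  simp only [hz, Pi.zero_apply] at h2
  linarith

/-! ### Uniqueness for small indices -/

theorem mulVec_functionalMatrix (h : IsFanoPair g A v u) (j : Fin (d + 1)) :
    (functionalMatrix u).mulVec (v j) =
      fun i => (if i.castSucc = j then A i.castSucc else 0) - (g : ℤ) :=
  funext fun i => h.pairing i.castSucc j

/-- The functionals are unimodular and send the vertices to vectors that depend only on `A`. -/
theorem latticeIsomorphic_of_index_one {v' u' : Fin (d + 1) → Fin d → ℤ}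
    (h : IsFanoPair 1 A v u) (h' : IsFanoPair 1 A v' u')
    (hu : (functionalMatrix u).det.natAbs = 1) (hu' : (functionalMatrix u').det.natAbs = 1) :
    LatticeIsomorphic (integralHull v) (integralHull v') :=
  latticeIsomorphic_of_mulVec_eq_mulVec _ _ (Int.isUnit_iff_natAbs_eq.mpr hu)
    (Int.isUnit_iff_natAbs_eq.mpr hu') fun j => by
      rw [h.mulVec_functionalMatrix, h'.mulVec_functionalMatrix]

/-- If the determinant of the functionals is exactly divisible by a prime dividing all pairings,
then the values at the vertices of a functional that is a combination with denominator `p` are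
not divisible by `p`. -/
theorem not_dvd_combination {p : ℕ} (hp : p.Prime) (h : IsFanoPair g A v u)
    (hdet : (functionalMatrix u).det.natAbs = p) {j : Fin (d + 1)}
    (hpA : ∀ i, (p : ℤ) ∣ u i ⬝ᵥ v j) {c : Fin d → ℤ} {i₀ : Fin d} (hc : ¬ (p : ℤ) ∣ c i₀)
    {w : Fin d → ℤ} (hw : ∀ l, ∑ i, c i * u i.castSucc l = p * w l) : ¬ (p : ℤ) ∣ w ⬝ᵥ v j := by
  intro hdvd
  -- Replacing row `i₀` by `w` removes the factor `p` from the determinant. If `p` also divided `w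
  -- ⬝ᵥ v j`, then `W` would send `v j` into multiples of `p`, and the adjugate would make `v j`
  -- divisible by `p`.
  set W := (functionalMatrix u).updateRow i₀ w with hW
  have hdetW : (p : ℤ) * W.det = c i₀ * (functionalMatrix u).det := by
    rw [hW, ← Matrix.det_updateRow_smul, ← smul_eq_mul (c i₀), ← Matrix.det_updateRow_sum (functionalMatrix u) i₀ c]
    congr 2
    ext l
    rw [Pi.smul_apply, smul_eq_mul, ← hw, Finset.sum_apply]
    rfl
  have hp0 : (p : ℤ) ≠ 0 := by exact_mod_cast hp.ne_zero
  have hndvd : ¬ (p : ℤ) ∣ W.det := by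
    intro hd
    rcases Int.natAbs_eq (functionalMatrix u).det with he | he
    · rw [hdet] at he
      rw [he, mul_comm (c i₀)] at hdetW
      exact hc (mul_left_cancel₀ hp0 hdetW ▸ hd)
    · rw [hdet] at he
      rw [he, mul_neg, mul_comm (c i₀), ← mul_neg] at hdetW
      rw [mul_left_cancel₀ hp0 hdetW, dvd_neg] at hd
      exact hc hd
  have hpp : Prime (p : ℤ) := Nat.prime_iff_prime_int.mp hp
  have hWv : ∀ i, (p : ℤ) ∣ W.mulVec (v j) i := by
    intro i
    by_cases hi : i = i₀
    · subst hi
      have : W.mulVec (v j) i = w ⬝ᵥ v j := by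
        simp [Matrix.mulVec, hW]
      rwa [this]
    · have : W.mulVec (v j) i = u i.castSucc ⬝ᵥ v j := by
        simp only [Matrix.mulVec, hW, Matrix.updateRow_ne hi]
        rfl
      rw [this]
      exact hpA _
  have hall : ∀ k, (p : ℤ) ∣ v j k := by
    intro k
    have e : W.adjugate.mulVec (W.mulVec (v j)) = W.det • v j := by
      rw [Matrix.mulVec_mulVec, Matrix.adjugate_mul, Matrix.smul_mulVec, Matrix.one_mulVec]
    have e2 := congrFun e k
    rw [Pi.smul_apply, smul_eq_mul] at e2
    refine (hpp.dvd_or_dvd (a := W.det) ?_).resolve_left hndvd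
    rw [← e2]
    change (p : ℤ) ∣ ∑ i, W.adjugate k i * W.mulVec (v j) i
    exact Finset.dvd_sum fun i _ => dvd_mul_of_dvd_right (hWv i) _
  exact hpp.not_isUnit (h.primitive j p hall)

/-- For a prime Gorenstein index `p`, the functionals of a maximal simplex satisfy a linear
relation modulo `p`. -/
theorem exists_relation_mod {p : ℕ} [Fact p.Prime] (h : IsFanoPair p A v u) (a : ℤ)
    (hA : ∀ i, A i = a * p) (hdet : (functionalMatrix u).det.natAbs = p) :
    ∃ c : Fin d → ZMod p, (∀ l, ∑ i, c i * (u i.castSucc l : ZMod p) = 0) ∧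
      (∀ j, a * c j - ∑ i, c i ≠ 0) ∧ ∑ i, c i ≠ 0 := by
  have hp : p.Prime := Fact.out
  have hdet0 : ((functionalMatrix u).map (Int.cast : ℤ → ZMod p)).det = 0 := by
    rw [← Int.cast_det, ZMod.intCast_zmod_eq_zero_iff_dvd, Int.natCast_dvd, hdet]
  obtain ⟨c, hc0, hc⟩ := Matrix.exists_vecMul_eq_zero_iff.mpr hdet0
  have hrel : ∀ l, ∑ i, c i * (u i.castSucc l : ZMod p) = 0 := fun l => congrFun hc l
  obtain ⟨i₀, hi₀⟩ : ∃ i, c i ≠ 0 := by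
    by_contra! hcon
    exact hc0 (funext hcon)
  -- A lift of the kernel vector to integers; `w` is the resulting combination of functionals
  -- divided by `p`. Its pairings with the vertices are the expressions claimed to be nonzero.
  set C : Fin d → ℤ := fun i => (c i).val with hC
  have hCc : ∀ i, (C i : ZMod p) = c i := fun i => by simp [hC]
  have hdvd : ∀ l, (p : ℤ) ∣ ∑ i, C i * u i.castSucc l := by
    intro l
    rw [← ZMod.intCast_zmod_eq_zero_iff_dvd]
    push_cast
    simp only [hCc]
    exact hrel l
  choose w hw using hdvd
  have hi₀' : ¬ (p : ℤ) ∣ C i₀ := by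
    rw [← ZMod.intCast_zmod_eq_zero_iff_dvd, hCc]
    exact hi₀
  have hp0 : (p : ℤ) ≠ 0 := by exact_mod_cast hp.ne_zero
  have hwv : ∀ j, (p : ℤ) * (w ⬝ᵥ v j) = ∑ i, C i * (u i.castSucc ⬝ᵥ v j) := by
    intro j
    simp only [dotProduct, Finset.mul_sum, ← mul_assoc]
    simp only [← hw, Finset.sum_mul]
    rw [Finset.sum_comm]
  have hndvd : ∀ j, ¬ (p : ℤ) ∣ w ⬝ᵥ v j := by
    intro j
    refine h.not_dvd_combination hp hdet (fun i => ?_) hi₀' hw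
    rw [h.pairing, hA]
    refine dvd_sub ?_ dvd_rfl
    split_ifs
    · exact dvd_mul_left _ _
    · exact dvd_zero _
  refine ⟨c, hrel, fun j h0 => hndvd j.castSucc ?_, fun h0 => hndvd (Fin.last d) ?_⟩
  · have h1 : w ⬝ᵥ v j.castSucc = a * C j - ∑ i, C i := by
      refine mul_left_cancel₀ hp0 ?_
      rw [hwv]
      simp only [h.pairing, Fin.castSucc_inj, hA, mul_sub, mul_ite, mul_zero,
        Finset.sum_sub_distrib, Finset.sum_ite_eq', Finset.mem_univ, if_true, ← Finset.sum_mul]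
      ring
    rw [h1, ← ZMod.intCast_zmod_eq_zero_iff_dvd]
    push_cast
    simp only [hCc]
    exact h0
  · have h1 : w ⬝ᵥ v (Fin.last d) = - ∑ i, C i := by
      refine mul_left_cancel₀ hp0 ?_
      rw [hwv]
      simp only [h.pairing, (Fin.castSucc_lt_last _).ne, if_false, zero_sub, ← Finset.sum_mul]
      ring
    rw [h1, dvd_neg, ← ZMod.intCast_zmod_eq_zero_iff_dvd]
    push_cast
    simp only [hCc]
    exact h0

end IsFanoPair

/-! ### Uniqueness in dimension three for Gorenstein index two and three. -/

theorem zmod_two_cases (c : Fin 3 → ZMod 2) (hc : ∑ i, c i ≠ 0) :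
    (∃ i, c = Pi.single i 1) ∨ c = 1 := by
  revert c
  decide

/-- Modulo 3 the conditions say that the sum is nonzero and differs from every entry, so exactly two
entries are nonzero, and they are equal. -/
theorem zmod_three_cases (c : Fin 3 → ZMod 3) (h1 : ∀ j, 4 * c j - ∑ i, c i ≠ 0)
    (h2 : ∑ i, c i ≠ 0) :
    ∃ i j : Fin 3, i ≠ j ∧ (c = Pi.single i 1 + Pi.single j 1 ∨
      c = -(Pi.single i 1 + Pi.single j 1)) := by
  revert c
  decide

namespace IsFanoPair

variable {A : Fin 4 → ℤ} {v u : Fin 4 → Fin 3 → ℤ}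

theorem exists_even_functional (h : IsFanoPair 2 A v u) (hA : ∀ i, A i = 8)
    (hdet : (functionalMatrix u).det.natAbs = 2) : ∃ i, ∀ l, (2 : ℤ) ∣ u i l := by
  obtain ⟨c, hc, -, h2⟩ := h.exists_relation_mod 4 (fun i => by rw [hA]; rfl) hdet
  rcases zmod_two_cases c h2 with ⟨i, rfl⟩ | rfl
  · refine ⟨i.castSucc, fun l => ?_⟩
    have h1 := hc l
    simp only [Pi.single_apply, ite_mul, one_mul, zero_mul, Finset.sum_ite_eq', Finset.mem_univ,
      if_true] at h1
    exact (ZMod.intCast_zmod_eq_zero_iff_dvd _ 2).mp h1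
  -- All `A i` agree, so the four functionals sum to zero and the last one is minus the sum of the
  -- others.
  · refine ⟨Fin.last 3, fun l => ?_⟩
    have h1 := hc l
    have h3 := h.dual_relation l
    simp only [hA] at h3
    rw [← Finset.mul_sum, Fin.sum_univ_castSucc] at h3
    have h4 : ∑ i : Fin 3, u i.castSucc l + u (Fin.last 3) l = 0 := by
      have := (mul_eq_zero.mp h3).resolve_left (by norm_num)
      exact_mod_cast this
    have h5 : u (Fin.last 3) l = - ∑ i : Fin 3, u i.castSucc l := by linarith
    rw [h5, dvd_neg]
    refine (ZMod.intCast_zmod_eq_zero_iff_dvd _ 2).mp ?_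
    push_cast
    simpa using h1

theorem exists_pair_functional (h : IsFanoPair 3 A v u) (hA : ∀ i, A i = 12)
    (hdet : (functionalMatrix u).det.natAbs = 3) :
    ∃ i j, i ≠ j ∧ ∀ l, (3 : ℤ) ∣ u i l + u j l := by
  obtain ⟨c, hc, h1, h2⟩ := h.exists_relation_mod 4 (fun i => by rw [hA]; rfl) hdet
  obtain ⟨i, j, hij, hcij⟩ := zmod_three_cases c (by exact_mod_cast h1) h2
  refine ⟨i.castSucc, j.castSucc, by simpa using hij, fun l => ?_⟩
  have h3 := hc l
  refine (ZMod.intCast_zmod_eq_zero_iff_dvd _ 3).mp ?_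
  push_cast
  rcases hcij with rfl | rfl
  · simpa [Pi.single_apply, add_mul, Finset.sum_add_distrib] using h3
  · rw [← neg_eq_zero]
    simpa [Pi.single_apply, add_mul, Finset.sum_add_distrib] using h3

/-- Halving the even functional, moved to position 0, turns determinant 2 into a unit, and the new
pairings no longer depend on the simplex. -/
theorem exists_unimodular_index_two (h : IsFanoPair 2 A v u) (hA : ∀ i, A i = 8)
    (hm : simplexMultiplicity (integralHull v) = 64) :
    ∃ (σ : Equiv.Perm (Fin 4)) (W : Matrix (Fin 3) (Fin 3) ℤ), IsUnit W.det ∧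
      ∀ j, W.mulVec (v (σ j)) = ![if 0 = j then 3 else -1, (if 1 = j then 8 else 0) - 2,
        (if 2 = j then 8 else 0) - 2] := by
  have hdet : ∀ σ : Equiv.Perm (Fin 4), (functionalMatrix (u ∘ σ)).det.natAbs = 2 := by
    intro σ
    refine ((h.comp_perm σ).det_eq_of_multiplicity_eq ?_).1
    rw [integralHull_comp_perm, hm]
    simp [hA]
  obtain ⟨i, hi⟩ := h.exists_even_functional hA (hdet 1)
  choose w hw using hi
  set σ : Equiv.Perm (Fin 4) := Equiv.swap 0 i with hσ
  have hσ0 : σ 0 = i := Equiv.swap_apply_left _ _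
  have hp := (h.comp_perm σ).pairing
  simp only [Function.comp_apply, hA] at hp
  refine ⟨σ, Matrix.of ![w, u (σ 1), u (σ 2)], ?_, fun j => ?_⟩
  · rw [Int.isUnit_iff_natAbs_eq]
    have h1 : (functionalMatrix (u ∘ σ)).det = 2 * (Matrix.of ![w, u (σ 1), u (σ 2)]).det := by
      rw [Matrix.det_fin_three, Matrix.det_fin_three]
      simp only [functionalMatrix, Matrix.of_apply, Function.comp_apply, Fin.castSucc_zero, hσ0, hw,
        Matrix.cons_val]
      simp only [show (Fin.castSucc 1 : Fin 4) = 1 from rfl, show (Fin.castSucc 2 : Fin 4) = 2 from rfl]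
      ring
    have h2 := hdet σ
    rw [h1, Int.natAbs_mul] at h2
    simpa using h2
  · have h0 := hp 0 j
    rw [hσ0] at h0
    have h0' : 2 * (w ⬝ᵥ v (σ j)) = u i ⬝ᵥ v (σ j) := by
      simp only [dotProduct, hw, Finset.mul_sum, mul_assoc]
    ext k
    fin_cases k
    · change w ⬝ᵥ v (σ j) = if 0 = j then 3 else -1
      split_ifs at h0 ⊢ <;> push_cast at h0 <;> omega
    · exact hp 1 j
    · exact hp 2 j

theorem exists_perm_apply {i j : Fin 4} (hij : i ≠ j) :
    ∃ σ : Equiv.Perm (Fin 4), σ 0 = i ∧ σ 1 = j := by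
  refine ⟨Equiv.swap 0 i * Equiv.swap 1 (Equiv.swap 0 i j), ?_, ?_⟩
  · have h1 : Equiv.swap 0 i j ≠ 0 := by
      intro h0
      rw [Equiv.swap_apply_eq_iff, Equiv.swap_apply_left] at h0
      exact hij h0.symm
    rw [Equiv.Perm.mul_apply, Equiv.swap_apply_of_ne_of_ne (by decide) h1.symm,
      Equiv.swap_apply_left]
  · rw [Equiv.Perm.mul_apply, Equiv.swap_apply_left, Equiv.swap_apply_self]

/-- Replacing `u i` by `(u i + u j) / 3`, with `i` and `j` moved to positions 0 and 1, turns
determinant 3 into a unit. -/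
theorem exists_unimodular_index_three (h : IsFanoPair 3 A v u) (hA : ∀ i, A i = 12)
    (hm : simplexMultiplicity (integralHull v) = 144) :
    ∃ (σ : Equiv.Perm (Fin 4)) (W : Matrix (Fin 3) (Fin 3) ℤ), IsUnit W.det ∧
      ∀ j, W.mulVec (v (σ j)) = ![(if 0 = j then 4 else 0) + (if 1 = j then 4 else 0) - 2,
        (if 1 = j then 12 else 0) - 3, (if 2 = j then 12 else 0) - 3] := by
  have hdet : ∀ σ : Equiv.Perm (Fin 4), (functionalMatrix (u ∘ σ)).det.natAbs = 3 := by
    intro σ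
    refine ((h.comp_perm σ).det_eq_of_multiplicity_eq ?_).1
    rw [integralHull_comp_perm, hm]
    simp [hA]
  obtain ⟨i, j, hij, hdvd⟩ := h.exists_pair_functional hA (hdet 1)
  choose w hw using hdvd
  obtain ⟨σ, hσ0, hσ1⟩ := exists_perm_apply hij
  have hp := (h.comp_perm σ).pairing
  simp only [Function.comp_apply, hA] at hp
  have hw' : ∀ l, u i l = 3 * w l - u j l := fun l => by linarith [hw l]
  refine ⟨σ, Matrix.of ![w, u (σ 1), u (σ 2)], ?_, fun k => ?_⟩
  · rw [Int.isUnit_iff_natAbs_eq]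
    have h1 : (functionalMatrix (u ∘ σ)).det = 3 * (Matrix.of ![w, u (σ 1), u (σ 2)]).det := by
      rw [Matrix.det_fin_three, Matrix.det_fin_three]
      simp only [functionalMatrix, Matrix.of_apply, Function.comp_apply, Fin.castSucc_zero, hσ0,
        Matrix.cons_val]
      simp only [show (Fin.castSucc 1 : Fin 4) = 1 from rfl, show (Fin.castSucc 2 : Fin 4) = 2 from rfl,
        hσ1, hw']
      ring
    have h2 := hdet σ
    rw [h1, Int.natAbs_mul] at h2
    simpa using h2
  · have h0 := hp 0 k
    have h1 := hp 1 k
    rw [hσ0] at h0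
    rw [hσ1] at h1
    have h0' : 3 * (w ⬝ᵥ v (σ k)) = u i ⬝ᵥ v (σ k) + u j ⬝ᵥ v (σ k) := by
      rw [← add_dotProduct]
      simp only [dotProduct, Pi.add_apply, hw, Finset.mul_sum, mul_assoc]
    ext l
    fin_cases l
    · change w ⬝ᵥ v (σ k) = (if 0 = k then 4 else 0) + (if 1 = k then 4 else 0) - 2
      split_ifs at h0 h1 ⊢ <;> push_cast at h0 h1 <;> omega
    · exact hp 1 k
    · exact hp 2 k

theorem latticeIsomorphic_of_index_two {v' u' : Fin 4 → Fin 3 → ℤ} (h : IsFanoPair 2 A v u)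
    (h' : IsFanoPair 2 A v' u') (hA : ∀ i, A i = 8)
    (hm : simplexMultiplicity (integralHull v) = 64)
    (hm' : simplexMultiplicity (integralHull v') = 64) :
    LatticeIsomorphic (integralHull v) (integralHull v') := by
  obtain ⟨σ, W, hW, hWv⟩ := h.exists_unimodular_index_two hA hm
  obtain ⟨σ', W', hW', hWv'⟩ := h'.exists_unimodular_index_two hA hm'
  rw [← integralHull_comp_perm v σ, ← integralHull_comp_perm v' σ']
  exact latticeIsomorphic_of_mulVec_eq_mulVec W W' hW hW' fun j => (hWv j).trans (hWv' j).symm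

theorem latticeIsomorphic_of_index_three {v' u' : Fin 4 → Fin 3 → ℤ} (h : IsFanoPair 3 A v u)
    (h' : IsFanoPair 3 A v' u') (hA : ∀ i, A i = 12)
    (hm : simplexMultiplicity (integralHull v) = 144)
    (hm' : simplexMultiplicity (integralHull v') = 144) :
    LatticeIsomorphic (integralHull v) (integralHull v') := by
  obtain ⟨σ, W, hW, hWv⟩ := h.exists_unimodular_index_three hA hm
  obtain ⟨σ', W', hW', hWv'⟩ := h'.exists_unimodular_index_three hA hm'
  rw [← integralHull_comp_perm v σ, ← integralHull_comp_perm v' σ']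
  exact latticeIsomorphic_of_mulVec_eq_mulVec W W' hW hW' fun j => (hWv j).trans (hWv' j).symm

end IsFanoPair

/-! ### Triangular matrices -/

/-- Append two elements to a finite sequence. -/
def snocTwo {X : Type*} {n : ℕ} (f : Fin n → X) (a b : X) : Fin (n + 2) → X :=
  Fin.snoc (α := fun _ => X) (Fin.snoc (α := fun _ => X) f a) b

section snocTwo

variable {X : Type*} {n : ℕ} (f : Fin n → X) (a b : X)

@[simp] theorem snocTwo_castSucc_castSucc (k : Fin n) :
    snocTwo f a b k.castSucc.castSucc = f k := by
  rw [snocTwo, Fin.snoc_castSucc, Fin.snoc_castSucc]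

@[simp] theorem snocTwo_castSucc_last : snocTwo f a b (Fin.last n).castSucc = a := by
  rw [snocTwo, Fin.snoc_castSucc, Fin.snoc_last]

@[simp] theorem snocTwo_last : snocTwo f a b (Fin.last (n + 1)) = b := by
  rw [snocTwo, Fin.snoc_last]

theorem Fin.forall_castSucc_castSucc {P : Fin (n + 2) → Prop} (h : ∀ k : Fin n, P k.castSucc.castSucc)
    (h₁ : P (Fin.last n).castSucc) (h₂ : P (Fin.last (n + 1))) (i : Fin (n + 2)) : P i :=
  Fin.lastCases h₂ (fun i => Fin.lastCases h₁ h i) i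

theorem eq_snocTwo (F : Fin (n + 2) → X) :
    F = snocTwo (fun k => F k.castSucc.castSucc) (F (Fin.last n).castSucc) (F (Fin.last (n + 1))) := by
  funext i
  refine Fin.forall_castSucc_castSucc (P := fun i => F i = snocTwo _ _ _ i) ?_ ?_ ?_ i <;> simp

end snocTwo

/-- The matrix with the given columns. -/
def columnMatrix {n : ℕ} (w : Fin n → Fin (n + 2) → ℤ) (p q : Fin (n + 2) → ℤ) :
    Matrix (Fin (n + 2)) (Fin (n + 2)) ℤ :=
  Matrix.of fun i j => snocTwo w p q j i

/-- An upper triangular matrix whose first `n` columns are standard basis vectors. -/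
def triangularMatrix {n : ℕ} (c c' : Fin n → ℤ) (x y z : ℤ) :
    Matrix (Fin (n + 2)) (Fin (n + 2)) ℤ :=
  columnMatrix (fun k => Pi.single k.castSucc.castSucc 1) (snocTwo c x 0) (snocTwo c' y z)

theorem columnMatrix_mulVec {n : ℕ} (w : Fin n → Fin (n + 2) → ℤ) (p q z : Fin (n + 2) → ℤ) :
    (columnMatrix w p q).mulVec z = ∑ k, z k.castSucc.castSucc • w k +
      z (Fin.last n).castSucc • p + z (Fin.last (n + 1)) • q := by
  ext i
  simp [Matrix.mulVec, dotProduct, columnMatrix, Fin.sum_univ_castSucc, mul_comm]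

theorem det_triangularMatrix {n : ℕ} (c c' : Fin n → ℤ) (x y z : ℤ) :
    (triangularMatrix c c' x y z).det = x * z := by
  rw [Matrix.det_of_isUpperTriangular]
  · simp [Fin.prod_univ_castSucc, triangularMatrix, columnMatrix]
  · intro i j hij
    simp only [id] at hij
    revert hij
    simp only [triangularMatrix, columnMatrix, Matrix.of_apply]
    refine Fin.forall_castSucc_castSucc
      (P := fun j => j < i → snocTwo _ (snocTwo c x 0) (snocTwo c' y z) j i = 0) ?_ ?_ ?_ j
    · intro k hk
      rw [snocTwo_castSucc_castSucc, Pi.single_eq_of_ne hk.ne']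
    · intro hk
      have : i = Fin.last (n + 1) := by
        rw [Fin.lt_def] at hk
        ext
        simp at hk ⊢
        omega
      subst this
      simp
    · intro hk
      exact absurd (Fin.le_last i) (not_le.mpr hk)

theorem vertexMatrix_eq_columnMatrix {n : ℕ} (v : Fin (n + 2 + 1) → Fin (n + 2) → ℤ) :
    vertexMatrix v = columnMatrix (fun k => v k.castSucc.castSucc.castSucc)
      (v (Fin.last n).castSucc.castSucc) (v (Fin.last (n + 1)).castSucc) := by
  ext i j
  simp only [vertexMatrix, columnMatrix, Matrix.of_apply]
  exact congrFun (congrFun (eq_snocTwo fun j : Fin (n + 2) => v j.castSucc) j) i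

/-- Expresses a change of the last two columns: the triangular factor holds the coordinates of the
vertices in the basis `w, p, q`. -/
theorem columnMatrix_mul_triangularMatrix {n : ℕ} (w : Fin n → Fin (n + 2) → ℤ)
    (p q : Fin (n + 2) → ℤ) (c c' : Fin n → ℤ) (x y z : ℤ) :
    columnMatrix w p q * triangularMatrix c c' x y z =
      columnMatrix w (∑ k, c k • w k + x • p) (∑ k, c' k • w k + y • p + z • q) := by
  have hcol : ∀ (B : Matrix (Fin (n + 2)) (Fin (n + 2)) ℤ) (w' : Fin n → Fin (n + 2) → ℤ) p' q' j,
      (fun i => (B * columnMatrix w' p' q') i j) = B.mulVec (snocTwo w' p' q' j) := by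
    intro B w' p' q' j
    ext i
    simp [Matrix.mul_apply, Matrix.mulVec, dotProduct, columnMatrix]
  ext i j
  rw [triangularMatrix, congrFun (hcol _ _ _ _ j) i, columnMatrix_mulVec]
  conv_rhs => rw [columnMatrix, Matrix.of_apply]
  revert j
  refine Fin.forall_castSucc_castSucc ?_ ?_ ?_
  · intro k
    simp [Pi.single_apply]
  · simp
  · simp

/-! ### Products of Sylvester numbers -/

/-- The product of the first `n` terms of the Sylvester sequence. -/
def sylvesterProd (g n : ℕ) : ℤ := ∏ i : Fin n, (gSylvester g (i + 1) : ℤ)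

/-- The product of the first `n` terms of the Sylvester sequence except one. -/
def sylvesterCofactor (g n : ℕ) (k : Fin n) : ℤ :=
  ∏ i ∈ Finset.univ.erase k, (gSylvester g (i + 1) : ℤ)

theorem gSylvester_mul_cofactor (g n : ℕ) (k : Fin n) :
    (gSylvester g (k + 1) : ℤ) * sylvesterCofactor g n k = sylvesterProd g n :=
  Finset.mul_prod_erase _ (fun i : Fin n => (gSylvester g (i + 1) : ℤ)) (Finset.mem_univ k)

theorem gSylvester_dvd_cofactor (g n : ℕ) {k j : Fin n} (hkj : k ≠ j) :
    (gSylvester g (k + 1) : ℤ) ∣ sylvesterCofactor g n j :=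
  Finset.dvd_prod_of_mem (fun i : Fin n => (gSylvester g (i + 1) : ℤ)) (by simpa using hkj)

theorem gSylvester_pos (g k : ℕ) : (0 : ℤ) < gSylvester g (k + 1) := by
  rw [gSylvester_succ]
  positivity

theorem sylvesterProd_pos (g n : ℕ) : 0 < sylvesterProd g n :=
  Finset.prod_pos fun i _ => gSylvester_pos g i

theorem mul_sylvesterProd (g n : ℕ) : (g : ℤ) * sylvesterProd g n = gSylvesterTrunc g (n + 1) := by
  rw [← prod_gSylvester, sylvesterProd, Finset.prod_range]
  push_cast
  rfl

/-- The Sylvester identity `∑ 1 / s_k = 1 / g - 1 / t` multiplied by `t = g * sylvesterProd g n`. -/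
theorem sum_cofactor {g : ℕ} (hg : 0 < g) (n : ℕ) :
    ∑ k, (g : ℤ) * sylvesterCofactor g n k + 1 = sylvesterProd g n := by
  have h1 := sum_inv_gSylvester (K := ℚ) hg n
  rw [Finset.sum_range] at h1
  have hτ : (sylvesterProd g n : ℚ) ≠ 0 := by exact_mod_cast (sylvesterProd_pos g n).ne'
  have hg' : (g : ℚ) ≠ 0 := by positivity
  have h2 : (gSylvesterTrunc g (n + 1) : ℚ) = g * sylvesterProd g n := by
    exact_mod_cast (mul_sylvesterProd g n).symm
  have h3 : ∀ k : Fin n, (g : ℚ) * sylvesterCofactor g n k =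
      g * sylvesterProd g n * (1 / gSylvester g (k + 1)) := by
    intro k
    have h4 : (gSylvester g (k + 1) : ℚ) * sylvesterCofactor g n k = sylvesterProd g n := by
      exact_mod_cast gSylvester_mul_cofactor g n k
    have h5 : (gSylvester g (k + 1) : ℚ) ≠ 0 := by exact_mod_cast (gSylvester_pos g k).ne'
    rw [← h4]
    field_simp
  have h4 : ∑ k, (g : ℚ) * sylvesterCofactor g n k + 1 = sylvesterProd g n := by
    simp only [h3]
    rw [← Finset.mul_sum, h1, h2]
    field_simp
    ring
  exact_mod_cast h4

/-- Reduce `sum_cofactor` modulo `s_k`: the full product and all other cofactors vanish. -/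
theorem gSylvester_dvd_mul_cofactor_add_one {g : ℕ} (hg : 0 < g) (n : ℕ) (k : Fin n) :
    (gSylvester g (k + 1) : ℤ) ∣ g * sylvesterCofactor g n k + 1 := by
  have h1 := sum_cofactor hg n
  rw [← Finset.add_sum_erase _ _ (Finset.mem_univ k)] at h1
  have h2 : (gSylvester g (k + 1) : ℤ) ∣
      ∑ j ∈ Finset.univ.erase k, (g : ℤ) * sylvesterCofactor g n j :=
    Finset.dvd_sum fun j hj => dvd_mul_of_dvd_right
      (gSylvester_dvd_cofactor g n (Finset.ne_of_mem_erase hj).symm) _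
  have h3 : (g : ℤ) * sylvesterCofactor g n k + 1 = gSylvester g (k + 1) * sylvesterCofactor g n k -
      ∑ j ∈ Finset.univ.erase k, (g : ℤ) * sylvesterCofactor g n j := by
    rw [gSylvester_mul_cofactor]
    linarith
  rw [h3]
  exact dvd_sub (dvd_mul_right _ _) h2

theorem isCoprime_gSylvester_mul_cofactor {g : ℕ} (hg : 0 < g) (n : ℕ) (k : Fin n) :
    IsCoprime (gSylvester g (k + 1) : ℤ) (g * sylvesterCofactor g n k) := by
  obtain ⟨c, hc⟩ := gSylvester_dvd_mul_cofactor_add_one hg n k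
  exact ⟨c, -1, by linear_combination -hc⟩

/-- The integer `(s_k - g) / s_k * (t / g)`. -/
def sylvesterEntryInt (g n : ℕ) (k : Fin n) : ℤ :=
  sylvesterProd g n - g * sylvesterCofactor g n k

theorem sylvesterEntryInt_pos (g n : ℕ) (k : Fin n) : 0 < sylvesterEntryInt g n k := by
  rw [sylvesterEntryInt, ← gSylvester_mul_cofactor g n k, ← sub_mul]
  refine mul_pos ?_ (Finset.prod_pos fun i _ => gSylvester_pos g i)
  have h1 : (g : ℤ) < gSylvester g (k + 1) := by
    have h2 : ∀ j, g < gSylvester g (j + 1) := by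
      intro j
      rw [gSylvester_succ]
      induction j with
      | zero => rw [gSylvesterTrunc_one]; omega
      | succ j ih =>
        rw [gSylvesterTrunc_succ]
        nlinarith [Nat.zero_le (gSylvesterTrunc g (j + 1))]
    exact_mod_cast h2 k
  linarith

theorem cast_sylvesterEntryInt {g : ℕ} (hg : 0 < g) (n : ℕ) (k : Fin n) :
    (sylvesterEntryInt g n k : ℚ) = sylvesterEntry (n + 2) g (k + 1) := by
  have h1 : (gSylvester g (k + 1) : ℚ) * sylvesterCofactor g n k = sylvesterProd g n := by
    exact_mod_cast gSylvester_mul_cofactor g n k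
  have h2 : (gSylvesterTrunc g (n + 1) : ℚ) = g * sylvesterProd g n := by
    exact_mod_cast (mul_sylvesterProd g n).symm
  have h3 : (gSylvester g (k + 1) : ℚ) ≠ 0 := by exact_mod_cast (gSylvester_pos g k).ne'
  have hg' : (g : ℚ) ≠ 0 := by positivity
  rw [sylvesterEntry, sylvesterEntryInt, show n + 2 - 1 = n + 1 by omega, h2, ← h1]
  push_cast
  rw [← h1]
  field_simp

/-! ### The general matrix -/

/-- The vertices of the general simplex with integer parameters. -/
def generalVertices (g n : ℕ) (a : Fin n → ℤ) (b : ℤ) : Fin (n + 2 + 1) → Fin (n + 2) → ℤ :=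
  Fin.snoc (α := fun _ => Fin (n + 2) → ℤ)
    (fun j i => triangularMatrix (sylvesterEntryInt g n) a (sylvesterProd g n) b
      (3 * g * sylvesterProd g n) i j)
    (snocTwo (fun k => -(3 * g * sylvesterCofactor g n k + sylvesterEntryInt g n k + a k))
      (-(sylvesterProd g n + b)) (-(3 * g * sylvesterProd g n)))

section generalVertices

variable (g n : ℕ) (a : Fin n → ℤ) (b : ℤ)

theorem generalVertices_castSucc_castSucc_castSucc (k : Fin n) :
    generalVertices g n a b k.castSucc.castSucc.castSucc = Pi.single k.castSucc.castSucc 1 := by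
  ext i
  simp [generalVertices, triangularMatrix, columnMatrix]

theorem generalVertices_castSucc_castSucc_last :
    generalVertices g n a b (Fin.last n).castSucc.castSucc =
      snocTwo (sylvesterEntryInt g n) (sylvesterProd g n) 0 := by
  ext i
  simp [generalVertices, triangularMatrix, columnMatrix]

theorem generalVertices_castSucc_last :
    generalVertices g n a b (Fin.last (n + 1)).castSucc =
      snocTwo a b (3 * g * sylvesterProd g n) := by
  ext i
  simp [generalVertices, triangularMatrix, columnMatrix]

theorem generalVertices_last :
    generalVertices g n a b (Fin.last (n + 2)) =
      snocTwo (fun k => -(3 * g * sylvesterCofactor g n k + sylvesterEntryInt g n k + a k))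
        (-(sylvesterProd g n + b)) (-(3 * g * sylvesterProd g n)) := by
  ext i
  simp [generalVertices]

theorem vertexMatrix_generalVertices :
    vertexMatrix (generalVertices g n a b) = triangularMatrix (sylvesterEntryInt g n) a
      (sylvesterProd g n) b (3 * g * sylvesterProd g n) := by
  ext i j
  simp [vertexMatrix, generalVertices]

end generalVertices

theorem simplexOfMatrix_matrixGeneral {g : ℕ} (hg : 0 < g) (n : ℕ) (a : ℕ → ℕ) :
    simplexOfMatrix (matrixGeneral (n + 2) g a) =
      integralHull (generalVertices g n (fun k => a (k + 1)) (a (n + 1))) := by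
  have h2 : (gSylvesterTrunc g (n + 1) : ℚ) = g * sylvesterProd g n := by
    exact_mod_cast (mul_sylvesterProd g n).symm
  have hg' : (g : ℚ) ≠ 0 := by positivity
  have hτ : (gSylvesterTrunc g (n + 1) : ℚ) / g = sylvesterProd g n := by
    rw [h2]
    field_simp
  rw [simplexOfMatrix, integralHull]
  congr 2
  funext j i
  have hent := fun k : Fin n => (cast_sylvesterEntryInt hg n k).symm
  have hlast : ∀ k : Fin n, (((gSylvester g (k + 1) : ℚ) + 2 * g) / gSylvester g (k + 1)) *
      sylvesterProd g n = 3 * g * sylvesterCofactor g n k + sylvesterEntryInt g n k := by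
    intro k
    have h1 : (gSylvester g (k + 1) : ℚ) * sylvesterCofactor g n k = sylvesterProd g n := by
      exact_mod_cast gSylvester_mul_cofactor g n k
    have h3 : (gSylvester g (k + 1) : ℚ) ≠ 0 := by exact_mod_cast (gSylvester_pos g k).ne'
    rw [sylvesterEntryInt]
    push_cast
    rw [← h1]
    field_simp
    ring
  revert i
  refine Fin.lastCases ?_ (fun j => ?_) j
  · refine fun i => Fin.forall_castSucc_castSucc (P := fun i => matrixGeneral (n + 2) g a i
      (Fin.last (n + 2)) = (generalVertices g n (fun k => a (k + 1)) (a (n + 1))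
      (Fin.last (n + 2)) i : ℚ)) ?_ ?_ ?_ i
    · intro k
      rw [generalVertices_last, snocTwo_castSucc_castSucc]
      simp [matrixGeneral, hτ, hlast]
    · rw [generalVertices_last]
      simp [matrixGeneral, hτ]
    · rw [generalVertices_last]
      simp [matrixGeneral, h2]
      ring
  · refine Fin.forall_castSucc_castSucc (P := fun j => ∀ i, matrixGeneral (n + 2) g a i
      j.castSucc = (generalVertices g n (fun k => a (k + 1)) (a (n + 1)) j.castSucc i : ℚ))
      ?_ ?_ ?_ j
    · intro k i
      rw [generalVertices_castSucc_castSucc_castSucc]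
      simp [matrixGeneral, Pi.single_apply, Fin.ext_iff]
    · refine Fin.forall_castSucc_castSucc ?_ ?_ ?_
      · intro k
        rw [generalVertices_castSucc_castSucc_last]
        simp [matrixGeneral, hent]
      · rw [generalVertices_castSucc_castSucc_last]
        simp [matrixGeneral, hτ]
      · rw [generalVertices_castSucc_castSucc_last]
        simp [matrixGeneral]
    · refine Fin.forall_castSucc_castSucc ?_ ?_ ?_
      · intro k
        rw [generalVertices_castSucc_last]
        simp [matrixGeneral, show (k : ℕ) ≤ n from k.isLt.le]
      · rw [generalVertices_castSucc_last]
        simp [matrixGeneral]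
      · rw [generalVertices_castSucc_last]
        simp [matrixGeneral, h2]
        ring

/-! ### Maximal simplices of general type -/

theorem candidate_castSucc_castSucc_castSucc (g n : ℕ) (k : Fin n) :
    candidate g (n + 1) n k.castSucc.castSucc.castSucc = gSylvester g (k + 1) := by
  simp [candidate]

theorem candidate_of_le (g : ℕ) {n i : ℕ} (hi : n ≤ i) :
    candidate g (n + 1) n i = 3 * g * sylvesterProd g n := by
  rw [candidate, if_neg (by omega), show n + 1 + 2 - n = 3 by omega, mul_assoc, mul_sylvesterProd]
  rfl

/-- Clears denominators: the weights `g / A i` become `3 g` times the cofactors for the first `n`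
indices and 1 for the last three. -/
theorem sum_candidate {g : ℕ} (hg : 0 < g) {n : ℕ} {A : Fin (n + 2 + 1) → ℤ}
    (hA : ∀ i, A i = candidate g (n + 1) n i) (f : Fin (n + 2 + 1) → ℚ) :
    3 * sylvesterProd g n * ∑ i, (g : ℚ) / A i * f i =
      ∑ k : Fin n, 3 * g * sylvesterCofactor g n k * f k.castSucc.castSucc.castSucc +
        f (Fin.last n).castSucc.castSucc + f (Fin.last (n + 1)).castSucc + f (Fin.last (n + 2)) := by
  have hτ : (sylvesterProd g n : ℚ) ≠ 0 := by exact_mod_cast (sylvesterProd_pos g n).ne'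
  have hg' : (g : ℚ) ≠ 0 := by positivity
  have h1 : A (Fin.last n).castSucc.castSucc = 3 * g * sylvesterProd g n := by
    rw [hA, candidate_of_le g (by simp)]
  have h2 : A (Fin.last (n + 1)).castSucc = 3 * g * sylvesterProd g n := by
    rw [hA, candidate_of_le g (by simp)]
  have h3 : A (Fin.last (n + 2)) = 3 * g * sylvesterProd g n := by
    rw [hA, candidate_of_le g (by simp)]
  rw [Fin.sum_univ_castSucc, Fin.sum_univ_castSucc, Fin.sum_univ_castSucc, mul_add, mul_add, mul_add,
    Finset.mul_sum, h1, h2, h3]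
  push_cast
  have h4 : 3 * (sylvesterProd g n : ℚ) * (g / (3 * g * sylvesterProd g n)) = 1 := by
    field_simp
  simp only [← mul_assoc, h4, one_mul]
  congr 3
  refine Finset.sum_congr rfl fun k _ => ?_
  rw [hA, candidate_castSucc_castSucc_castSucc]
  have h5 : (gSylvester g (k + 1) : ℚ) * sylvesterCofactor g n k = sylvesterProd g n := by
    exact_mod_cast gSylvester_mul_cofactor g n k
  have h6 : (gSylvester g (k + 1) : ℚ) ≠ 0 := by exact_mod_cast (gSylvester_pos g k).ne'
  rw [← h5]
  push_cast
  field_simp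

/-- The image of `N` is a principal ideal of `ℤ`, and a preimage of its generator has minimal
height. -/
theorem exists_mem_dvd_of_mem {M : Type*} [AddCommGroup M] (N : Submodule ℤ M) (f : M →ₗ[ℤ] ℤ) :
    ∃ x ∈ N, ∀ y ∈ N, f x ∣ f y := by
  obtain ⟨a, ha⟩ := (IsPrincipalIdealRing.principal (N.map f : Ideal ℤ)).principal
  have h1 : a ∈ N.map f := by
    rw [ha]
    exact Submodule.mem_span_singleton_self a
  obtain ⟨x, hx, rfl⟩ := h1
  refine ⟨x, hx, fun y hy => ?_⟩
  have h2 : f y ∈ N.map f := ⟨y, hy, rfl⟩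
  rw [ha] at h2
  exact Ideal.mem_span_singleton.mp h2

namespace IsFanoPair

variable {n g : ℕ} {A : Fin (n + 2 + 1) → ℤ} {v u : Fin (n + 2 + 1) → Fin (n + 2) → ℤ}

section general

variable (h : IsFanoPair g A v u) (hA : ∀ i, A i = candidate g (n + 1) n i)

include h hA

theorem sum_cofactor_mul_vertices (l : Fin (n + 2)) :
    ∑ k : Fin n, 3 * g * sylvesterCofactor g n k * v k.castSucc.castSucc.castSucc l +
      v (Fin.last n).castSucc.castSucc l + v (Fin.last (n + 1)).castSucc l +
      v (Fin.last (n + 2)) l = 0 := by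
  have h1 := sum_candidate h.index_pos hA fun i => (v i l : ℚ)
  rw [h.relation, mul_zero] at h1
  exact_mod_cast h1.symm

theorem sum_cofactor_mul_functionals (x : Fin (n + 2) → ℤ) :
    ∑ k : Fin n, 3 * g * sylvesterCofactor g n k * (u k.castSucc.castSucc.castSucc ⬝ᵥ x) +
      u (Fin.last n).castSucc.castSucc ⬝ᵥ x + u (Fin.last (n + 1)).castSucc ⬝ᵥ x +
      u (Fin.last (n + 2)) ⬝ᵥ x = 0 := by
  have h1 := sum_candidate h.index_pos hA fun i => ((u i ⬝ᵥ x : ℤ) : ℚ)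
  rw [h.sum_mul_dotProduct, mul_zero] at h1
  exact_mod_cast h1.symm

theorem sum_cofactor_mul_functionals_mul_vertices (x : Fin (n + 2) → ℤ) (l : Fin (n + 2)) :
    3 * g * sylvesterProd g n * x l =
      ∑ k : Fin n, 3 * g * sylvesterCofactor g n k * ((u k.castSucc.castSucc.castSucc ⬝ᵥ x) *
        v k.castSucc.castSucc.castSucc l) +
      (u (Fin.last n).castSucc.castSucc ⬝ᵥ x) * v (Fin.last n).castSucc.castSucc l +
      (u (Fin.last (n + 1)).castSucc ⬝ᵥ x) * v (Fin.last (n + 1)).castSucc l +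
      (u (Fin.last (n + 2)) ⬝ᵥ x) * v (Fin.last (n + 2)) l := by
  have h1 := sum_candidate h.index_pos hA fun i => ((u i ⬝ᵥ x : ℤ) : ℚ) * v i l
  have h2 : ∑ i, (g : ℚ) / A i * (((u i ⬝ᵥ x : ℤ) : ℚ) * v i l) = g * x l := by
    rw [← h.sum_dotProduct_div_mul x l, Finset.mul_sum]
    exact Finset.sum_congr rfl fun i _ => by ring
  rw [h2] at h1
  have h3 : (3 * g * sylvesterProd g n * x l : ℚ) = 3 * sylvesterProd g n * (g * x l) := by ring
  rw [← h3] at h1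
  exact_mod_cast h1

/-- The two reduced relations for a lattice vector. -/
theorem reduced_relations (x : Fin (n + 2) → ℤ) {α β e : ℤ} {ρ : Fin n → ℤ}
    (he : u (Fin.last (n + 2)) ⬝ᵥ x = e) (hα : u (Fin.last (n + 1)).castSucc ⬝ᵥ x = e + α)
    (hβ : u (Fin.last n).castSucc.castSucc ⬝ᵥ x = e + β)
    (hρ : ∀ k : Fin n, u k.castSucc.castSucc.castSucc ⬝ᵥ x = e + ρ k) :
    3 * g * ∑ k, sylvesterCofactor g n k * ρ k + β + α + 3 * e * sylvesterProd g n = 0 ∧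
    ∀ l, 3 * g * sylvesterProd g n * x l =
      3 * g * ∑ k : Fin n, sylvesterCofactor g n k * ρ k * v k.castSucc.castSucc.castSucc l +
        β * v (Fin.last n).castSucc.castSucc l + α * v (Fin.last (n + 1)).castSucc l := by
  have h1 := h.sum_cofactor_mul_functionals hA x
  have h4 := sum_cofactor h.index_pos n
  rw [← Finset.mul_sum] at h4
  simp only [he, hα, hβ, hρ] at h1
  constructor
  · have h5 : ∑ k : Fin n, 3 * (g : ℤ) * sylvesterCofactor g n k * (e + ρ k) =
        3 * e * (g * ∑ k, sylvesterCofactor g n k) +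
          3 * g * ∑ k, sylvesterCofactor g n k * ρ k := by
      simp only [Finset.mul_sum, ← Finset.sum_add_distrib]
      exact Finset.sum_congr rfl fun k _ => by ring
    rw [h5] at h1
    linear_combination h1 - 3 * e * h4
  · intro l
    have h2 := h.sum_cofactor_mul_functionals_mul_vertices hA x l
    have h3 := h.sum_cofactor_mul_vertices hA l
    simp only [he, hα, hβ, hρ] at h2
    have h5 : ∑ k : Fin n, 3 * (g : ℤ) * sylvesterCofactor g n k * ((e + ρ k) *
        v k.castSucc.castSucc.castSucc l) =
        e * ∑ k : Fin n, 3 * g * sylvesterCofactor g n k * v k.castSucc.castSucc.castSucc l +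
          3 * g * ∑ k : Fin n, sylvesterCofactor g n k * ρ k *
            v k.castSucc.castSucc.castSucc l := by
      simp only [Finset.mul_sum, ← Finset.sum_add_distrib]
      exact Finset.sum_congr rfl fun k _ => by ring
    rw [h5] at h2
    linear_combination h2 + e * h3

/-- The first `n` vertices generate all lattice points at height zero. The coefficient at the `k`-th
vertex is `ρ k / s_k`, an integer because the first reduced relation modulo `s_k` has `ρ k` with a
coefficient prime to `s_k`. -/
theorem exists_eq_sum_of_eq {x : Fin (n + 2) → ℤ}
    (hα : u (Fin.last (n + 1)).castSucc ⬝ᵥ x = u (Fin.last (n + 2)) ⬝ᵥ x)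
    (hβ : u (Fin.last n).castSucc.castSucc ⬝ᵥ x = u (Fin.last (n + 2)) ⬝ᵥ x) :
    ∃ c : Fin n → ℤ, x = ∑ k, c k • v k.castSucc.castSucc.castSucc := by
  obtain ⟨h1, h2⟩ := h.reduced_relations hA x (α := 0) (β := 0) (e := u (Fin.last (n + 2)) ⬝ᵥ x)
    (ρ := fun k => u k.castSucc.castSucc.castSucc ⬝ᵥ x - u (Fin.last (n + 2)) ⬝ᵥ x) rfl
    (by rw [hα, add_zero]) (by rw [hβ, add_zero]) (fun k => by ring)
  set ρ : Fin n → ℤ := fun k => u k.castSucc.castSucc.castSucc ⬝ᵥ x - u (Fin.last (n + 2)) ⬝ᵥ x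
  set e := u (Fin.last (n + 2)) ⬝ᵥ x
  have hdvd : ∀ k : Fin n, (gSylvester g (k + 1) : ℤ) ∣ ρ k := by
    intro k
    have h3 : (g : ℤ) * sylvesterCofactor g n k * ρ k =
        -(e * sylvesterProd g n) - g * ∑ j ∈ Finset.univ.erase k, sylvesterCofactor g n j * ρ j := by
      rw [← Finset.add_sum_erase _ _ (Finset.mem_univ k)] at h1
      linarith
    refine (isCoprime_gSylvester_mul_cofactor h.index_pos n k).dvd_of_dvd_mul_left ?_
    rw [h3]
    refine dvd_sub (dvd_neg.mpr (dvd_mul_of_dvd_right ?_ _)) (dvd_mul_of_dvd_right ?_ _)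
    · rw [← gSylvester_mul_cofactor g n k]
      exact dvd_mul_right _ _
    · exact Finset.dvd_sum fun j hj => dvd_mul_of_dvd_left
        (gSylvester_dvd_cofactor g n (Finset.ne_of_mem_erase hj).symm) _
  choose c hc using hdvd
  refine ⟨c, funext fun l => ?_⟩
  have h3 := h2 l
  have hne : 3 * (g : ℤ) * sylvesterProd g n ≠ 0 := by
    have h4 := sylvesterProd_pos g n
    have h5 : (0 : ℤ) < g := by exact_mod_cast h.index_pos
    positivity
  refine mul_left_cancel₀ hne ?_
  rw [h3, Finset.sum_apply, mul_assoc (3 * (g : ℤ)), Finset.mul_sum (a := sylvesterProd g n)]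
  simp only [zero_mul, add_zero]
  congr 1
  refine Finset.sum_congr rfl fun k _ => ?_
  rw [show u k.castSucc.castSucc.castSucc ⬝ᵥ x - e = _ from hc k, ← gSylvester_mul_cofactor g n k, Pi.smul_apply, smul_eq_mul]
  ring

/-- The first reduced relation gives divisibility by 3. After division by 3 the second one gives
that `g` divides a multiple of a primitive vertex, hence the multiplier. -/
theorem dvd_sub_of_eq {x : Fin (n + 2) → ℤ}
    (hα : u (Fin.last (n + 1)).castSucc ⬝ᵥ x = u (Fin.last (n + 2)) ⬝ᵥ x) :
    (3 * g : ℤ) ∣ u (Fin.last n).castSucc.castSucc ⬝ᵥ x - u (Fin.last (n + 2)) ⬝ᵥ x := by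
  obtain ⟨h1, h2⟩ := h.reduced_relations hA x (α := 0) (e := u (Fin.last (n + 2)) ⬝ᵥ x)
    (β := u (Fin.last n).castSucc.castSucc ⬝ᵥ x - u (Fin.last (n + 2)) ⬝ᵥ x)
    (ρ := fun k => u k.castSucc.castSucc.castSucc ⬝ᵥ x - u (Fin.last (n + 2)) ⬝ᵥ x) rfl
    (by rw [hα, add_zero]) (by ring) (fun k => by ring)
  set β := u (Fin.last n).castSucc.castSucc ⬝ᵥ x - u (Fin.last (n + 2)) ⬝ᵥ x
  obtain ⟨b, hb⟩ : (3 : ℤ) ∣ β := by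
    refine ⟨-(g * ∑ k : Fin n, sylvesterCofactor g n k *
      (u k.castSucc.castSucc.castSucc ⬝ᵥ x - u (Fin.last (n + 2)) ⬝ᵥ x)) -
      (u (Fin.last (n + 2)) ⬝ᵥ x) * sylvesterProd g n, ?_⟩
    linarith
  rw [hb]
  refine mul_dvd_mul_left 3 ?_
  have h3 : ∀ l, (g : ℤ) ∣ b * v (Fin.last n).castSucc.castSucc l := by
    intro l
    refine ⟨sylvesterProd g n * x l - ∑ k : Fin n, sylvesterCofactor g n k *
      (u k.castSucc.castSucc.castSucc ⬝ᵥ x - u (Fin.last (n + 2)) ⬝ᵥ x) *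
      v k.castSucc.castSucc.castSucc l, ?_⟩
    have h4 := h2 l
    rw [hb] at h4
    linarith
  have h4 : (g : ℤ) ∣ b * Finset.univ.gcd (v (Fin.last n).castSucc.castSucc) := by
    rw [← (Finset.gcd_mul_left' Finset.univ (f := v (Fin.last n).castSucc.castSucc)
      b).dvd_iff_dvd_right]
    exact Finset.dvd_gcd fun k _ => h3 k
  exact (IsUnit.dvd_mul_right (h.primitive _ _ fun i => Finset.gcd_dvd (Finset.mem_univ i))).mp h4

end general

end IsFanoPair

/-- The cleared barycentric relation; its last coefficient is 1, so the other vertices generate the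
vertex lattice. -/
theorem generalVertices_last_eq (g n : ℕ) (a : Fin n → ℤ) (b : ℤ) :
    generalVertices g n a b (Fin.last (n + 2)) = -(∑ k : Fin n, (3 * g * sylvesterCofactor g n k) •
      generalVertices g n a b k.castSucc.castSucc.castSucc +
      generalVertices g n a b (Fin.last n).castSucc.castSucc +
      generalVertices g n a b (Fin.last (n + 1)).castSucc) := by
  simp only [generalVertices_castSucc_castSucc_castSucc, generalVertices_castSucc_castSucc_last,
    generalVertices_castSucc_last, generalVertices_last]
  funext i
  revert i
  refine Fin.forall_castSucc_castSucc ?_ ?_ ?_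
  · intro k
    simp [Pi.single_apply]
  · simp
  · simp

namespace IsFanoPair

variable {n g : ℕ} {A : Fin (n + 2 + 1) → ℤ} {v u : Fin (n + 2 + 1) → Fin (n + 2) → ℤ}

theorem pairing_self_sub (h : IsFanoPair g A v u) {i j : Fin (n + 2 + 1)} (hij : i ≠ j) :
    u i ⬝ᵥ v i - u j ⬝ᵥ v i = A i := by
  simp [h.pairing, hij.symm]

theorem pairing_sub_eq_zero (h : IsFanoPair g A v u) {i j k : Fin (n + 2 + 1)} (hi : i ≠ k)
    (hj : j ≠ k) : u i ⬝ᵥ v k = u j ⬝ᵥ v k := by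
  simp [h.pairing, hi, hj]

section general

variable (h : IsFanoPair g A v u) (hA : ∀ i, A i = candidate g (n + 1) n i)
  (hdet : ((vertexMatrix v).det.natAbs : ℤ) = 3 * g * sylvesterProd g n ^ 2)

include h hA hdet

/-- In a simplex of maximal multiplicity there are lattice vectors at the minimal possible heights
over the faces spanned by the first vertices. -/
theorem exists_minimal_heights : ∃ p q : Fin (n + 2) → ℤ,
    u (Fin.last (n + 1)).castSucc ⬝ᵥ p = u (Fin.last (n + 2)) ⬝ᵥ p ∧
    u (Fin.last n).castSucc.castSucc ⬝ᵥ p - u (Fin.last (n + 2)) ⬝ᵥ p = 3 * g ∧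
    u (Fin.last (n + 1)).castSucc ⬝ᵥ q - u (Fin.last (n + 2)) ⬝ᵥ q = 1 := by
  have hne : ∀ k : Fin n, (Fin.last (n + 2)) ≠ k.castSucc.castSucc.castSucc :=
    fun k => (Fin.castSucc_lt_last _).ne'
  have hne1 : (Fin.last (n + 1)).castSucc ≠ (Fin.last n).castSucc.castSucc := by
    simp [Fin.ext_iff]
  have hne2 : (Fin.last (n + 2)) ≠ (Fin.last n).castSucc.castSucc := (Fin.castSucc_lt_last _).ne'
  have hne3 : (Fin.last (n + 2)) ≠ (Fin.last (n + 1)).castSucc := (Fin.castSucc_lt_last _).ne'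
  have hne4 : ∀ k : Fin n, (Fin.last (n + 1)).castSucc ≠ k.castSucc.castSucc.castSucc := by
    intro k
    simp only [ne_eq, Fin.castSucc_inj]
    exact (Fin.castSucc_lt_last _).ne'
  have hne5 : ∀ k : Fin n, (Fin.last n).castSucc.castSucc ≠ k.castSucc.castSucc.castSucc := by
    intro k
    simp only [ne_eq, Fin.castSucc_inj]
    exact (Fin.castSucc_lt_last _).ne'
  set α : (Fin (n + 2) → ℤ) →ₗ[ℤ] ℤ :=
    dotProductBilin ℤ ℤ (u (Fin.last (n + 1)).castSucc - u (Fin.last (n + 2))) with hαdef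
  set β : (Fin (n + 2) → ℤ) →ₗ[ℤ] ℤ :=
    dotProductBilin ℤ ℤ (u (Fin.last n).castSucc.castSucc - u (Fin.last (n + 2))) with hβdef
  have hα : ∀ x, α x = u (Fin.last (n + 1)).castSucc ⬝ᵥ x - u (Fin.last (n + 2)) ⬝ᵥ x := by
    intro x
    simp [hαdef]
  have hβ : ∀ x, β x = u (Fin.last n).castSucc.castSucc ⬝ᵥ x - u (Fin.last (n + 2)) ⬝ᵥ x := by
    intro x
    simp [hβdef]
  have hA1 : A (Fin.last n).castSucc.castSucc = 3 * g * sylvesterProd g n := by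
    rw [hA, candidate_of_le g (by simp)]
  have hA2 : A (Fin.last (n + 1)).castSucc = 3 * g * sylvesterProd g n := by
    rw [hA, candidate_of_le g (by simp)]
  have hαe : ∀ k : Fin n, α (v k.castSucc.castSucc.castSucc) = 0 := by
    intro k
    rw [hα, sub_eq_zero]
    exact h.pairing_sub_eq_zero (hne4 k) (hne k)
  have hβe : ∀ k : Fin n, β (v k.castSucc.castSucc.castSucc) = 0 := by
    intro k
    rw [hβ, sub_eq_zero]
    exact h.pairing_sub_eq_zero (hne5 k) (hne k)
  have hα1 : α (v (Fin.last n).castSucc.castSucc) = 0 := by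
    rw [hα, sub_eq_zero]
    exact h.pairing_sub_eq_zero hne1 hne2
  have hβ1 : β (v (Fin.last n).castSucc.castSucc) = 3 * g * sylvesterProd g n := by
    rw [hβ, ← hA1, h.pairing_self_sub hne2.symm]
  have hα2 : α (v (Fin.last (n + 1)).castSucc) = 3 * g * sylvesterProd g n := by
    rw [hα, ← hA2, h.pairing_self_sub hne3.symm]
  have hcomb : ∀ x, α x = 0 → β x = 0 →
      ∃ c : Fin n → ℤ, x = ∑ k, c k • v k.castSucc.castSucc.castSucc := by
    intro x h1 h2
    rw [hα, sub_eq_zero] at h1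
    rw [hβ, sub_eq_zero] at h2
    exact h.exists_eq_sum_of_eq hA h1 h2
  -- `q` attains the smallest nonzero `α`-height and `p` the smallest `β`-height on the kernel of
  -- `α`; with the first `n` vertices they generate the lattice.
  obtain ⟨p, hp, hpmin⟩ := exists_mem_dvd_of_mem (LinearMap.ker α) β
  obtain ⟨q, -, hqmin⟩ := exists_mem_dvd_of_mem ⊤ α
  have hp0 : α p = 0 := hp
  have hexp : ∀ x, ∃ (c : Fin n → ℤ) (y z : ℤ), α x = α q * z ∧
      x = ∑ k, c k • v k.castSucc.castSucc.castSucc + y • p + z • q := by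
    intro x
    obtain ⟨z, hz⟩ := hqmin x trivial
    have h1 : α (x - z • q) = 0 := by
      rw [map_sub, map_smul, hz, smul_eq_mul]
      ring
    obtain ⟨y, hy⟩ := hpmin (x - z • q) h1
    obtain ⟨c, hc⟩ := hcomb (x - z • q - y • p)
      (by rw [map_sub, h1, map_smul, hp0, smul_zero, sub_zero])
      (by rw [map_sub, hy, map_smul, smul_eq_mul]; ring)
    refine ⟨c, y, z, hz, ?_⟩
    rw [← hc]
    abel
  obtain ⟨y, hy⟩ := hpmin _ (show v (Fin.last n).castSucc.castSucc ∈ LinearMap.ker α from hα1)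
  obtain ⟨c, hc⟩ := hcomb (v (Fin.last n).castSucc.castSucc - y • p)
    (by rw [map_sub, hα1, map_smul, hp0, smul_zero, sub_zero])
    (by rw [map_sub, hy, map_smul, smul_eq_mul]; ring)
  obtain ⟨c', y', z, hz, hc'⟩ := hexp (v (Fin.last (n + 1)).castSucc)
  set B := columnMatrix (fun k => v k.castSucc.castSucc.castSucc) p q with hB
  have hBsurj : Function.Surjective B.mulVec := by
    intro x
    obtain ⟨c, y, z, -, hx⟩ := hexp x
    exact ⟨snocTwo c y z, by rw [hB, columnMatrix_mulVec, hx]; simp⟩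
  have hBunit : IsUnit B.det :=
    (Matrix.isUnit_iff_isUnit_det B).mp (Matrix.mulVec_surjective_iff_isUnit.mp hBsurj)
  have hV : vertexMatrix v = B * triangularMatrix c c' y y' z := by
    rw [hB, columnMatrix_mul_triangularMatrix, vertexMatrix_eq_columnMatrix, ← hc, ← hc',
      sub_add_cancel]
  have hyz : |y * z| = 3 * g * sylvesterProd g n ^ 2 := by
    rw [← hdet, hV, Matrix.det_mul, det_triangularMatrix, Int.natAbs_mul,
      Int.isUnit_iff_natAbs_eq.mp hBunit, one_mul, Int.natCast_natAbs]
  have hgpos : (0 : ℤ) < g := by exact_mod_cast h.index_pos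
  have hτ := sylvesterProd_pos g n
  obtain ⟨b, hb⟩ : (3 * g : ℤ) ∣ β p := by
    have h1 : u (Fin.last (n + 1)).castSucc ⬝ᵥ p = u (Fin.last (n + 2)) ⬝ᵥ p := by
      rw [← sub_eq_zero, ← hα, hp0]
    rw [hβ]
    exact h.dvd_sub_of_eq hA h1
  -- With `β p = 3 g b` the heights of the vertices give `b y = τ` and `α q * z = 3 g τ`, where `τ =
  -- sylvesterProd g n`, while `|y z| = 3 g τ ^ 2` by the index. So `b` and `α q` are units.
  have hprod : |b * α q| * (3 * g * (3 * g * sylvesterProd g n ^ 2)) =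
      3 * g * (3 * g * sylvesterProd g n ^ 2) := by
    have h1 : (b * α q) * (3 * g * (y * z)) = 3 * g * (3 * g * sylvesterProd g n ^ 2) := by
      rw [hβ1, hb] at hy
      rw [hα2] at hz
      have h2 : (3 * g : ℤ) * (b * y) = 3 * g * sylvesterProd g n := by linarith
      have h3 : b * y = sylvesterProd g n := mul_left_cancel₀ (by positivity) h2
      calc (b * α q) * (3 * g * (y * z)) = 3 * g * ((b * y) * (α q * z)) := by ring
        _ = _ := by rw [h3, ← hz]; ring
    have h2 := congrArg abs h1
    rw [abs_mul, abs_mul (3 * (g : ℤ)) (y * z), hyz, abs_of_pos (a := 3 * (g : ℤ)) (by positivity),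
      abs_of_pos (a := 3 * (g : ℤ) * (3 * g * sylvesterProd g n ^ 2)) (by positivity)] at h2
    exact h2
  have hunit : IsUnit (b * α q) := by
    have h1 : |b * α q| = 1 := by
      refine mul_right_cancel₀ (b := 3 * (g : ℤ) * (3 * g * sylvesterProd g n ^ 2)) ?_ ?_
      · positivity
      · rw [hprod, one_mul]
    exact Int.isUnit_iff_abs_eq.mpr h1
  have hb1 : b * b = 1 := Int.isUnit_mul_self (isUnit_of_mul_isUnit_left hunit)
  have hq1 : α q * α q = 1 := Int.isUnit_mul_self (isUnit_of_mul_isUnit_right hunit)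
  -- Multiplying by the units `b` and `α q` normalizes the signs of the heights.
  refine ⟨b • p, α q • q, ?_, ?_, ?_⟩
  · rw [← sub_eq_zero, ← hα, map_smul, hp0, smul_zero]
  · rw [← hβ, map_smul, hb, smul_eq_mul]
    linear_combination 3 * (g : ℤ) * hb1
  · rw [← hα, map_smul, smul_eq_mul, hq1]

/-- A simplex of maximal multiplicity of general type is given by a general matrix. -/
theorem exists_latticeIsomorphic_generalVertices : ∃ (a : Fin n → ℤ) (b : ℤ), (∀ k, 1 ≤ a k) ∧
    1 ≤ b ∧ LatticeIsomorphic (integralHull v) (integralHull (generalVertices g n a b)) := by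
  have hne : ∀ k : Fin n, (Fin.last (n + 2)) ≠ k.castSucc.castSucc.castSucc :=
    fun k => (Fin.castSucc_lt_last _).ne'
  have hne1 : (Fin.last (n + 1)).castSucc ≠ (Fin.last n).castSucc.castSucc := by
    simp [Fin.ext_iff]
  have hne2 : (Fin.last (n + 2)) ≠ (Fin.last n).castSucc.castSucc := (Fin.castSucc_lt_last _).ne'
  have hne3 : (Fin.last (n + 2)) ≠ (Fin.last (n + 1)).castSucc := (Fin.castSucc_lt_last _).ne'
  have hne4 : ∀ k : Fin n, (Fin.last (n + 1)).castSucc ≠ k.castSucc.castSucc.castSucc := by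
    intro k
    simp only [ne_eq, Fin.castSucc_inj]
    exact (Fin.castSucc_lt_last _).ne'
  have hne5 : ∀ k : Fin n, (Fin.last n).castSucc.castSucc ≠ k.castSucc.castSucc.castSucc := by
    intro k
    simp only [ne_eq, Fin.castSucc_inj]
    exact (Fin.castSucc_lt_last _).ne'
  have hA1 : A (Fin.last n).castSucc.castSucc = 3 * g * sylvesterProd g n := by
    rw [hA, candidate_of_le g (by simp)]
  have hA2 : A (Fin.last (n + 1)).castSucc = 3 * g * sylvesterProd g n := by
    rw [hA, candidate_of_le g (by simp)]
  have hgpos : (0 : ℤ) < g := by exact_mod_cast h.index_pos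
  have hτ := sylvesterProd_pos g n
  obtain ⟨p, q, hpα, hpβ, hqα⟩ := h.exists_minimal_heights hA hdet
  set e : Fin n → Fin (n + 2) → ℤ := fun k => v k.castSucc.castSucc.castSucc with he
  set ρ : Fin n → ℤ := fun k => u k.castSucc.castSucc.castSucc ⬝ᵥ p - u (Fin.last (n + 2)) ⬝ᵥ p
    with hρ
  have hαe : ∀ k, u (Fin.last (n + 1)).castSucc ⬝ᵥ e k = u (Fin.last (n + 2)) ⬝ᵥ e k :=
    fun k => h.pairing_sub_eq_zero (hne4 k) (hne k)
  have hβe : ∀ k, u (Fin.last n).castSucc.castSucc ⬝ᵥ e k = u (Fin.last (n + 2)) ⬝ᵥ e k :=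
    fun k => h.pairing_sub_eq_zero (hne5 k) (hne k)
  have hα1 : u (Fin.last (n + 1)).castSucc ⬝ᵥ v (Fin.last n).castSucc.castSucc =
      u (Fin.last (n + 2)) ⬝ᵥ v (Fin.last n).castSucc.castSucc := h.pairing_sub_eq_zero hne1 hne2
  have hβ1 : u (Fin.last n).castSucc.castSucc ⬝ᵥ v (Fin.last n).castSucc.castSucc -
      u (Fin.last (n + 2)) ⬝ᵥ v (Fin.last n).castSucc.castSucc = 3 * g * sylvesterProd g n := by
    rw [h.pairing_self_sub hne2.symm, hA1]
  have hα2 : u (Fin.last (n + 1)).castSucc ⬝ᵥ v (Fin.last (n + 1)).castSucc -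
      u (Fin.last (n + 2)) ⬝ᵥ v (Fin.last (n + 1)).castSucc = 3 * g * sylvesterProd g n := by
    rw [h.pairing_self_sub hne3.symm, hA2]
  obtain ⟨c, hc⟩ := h.exists_eq_sum_of_eq hA
    (x := v (Fin.last n).castSucc.castSucc - sylvesterProd g n • p)
    (by rw [dotProduct_sub, dotProduct_sub, dotProduct_smul, dotProduct_smul, hα1, hpα])
    (by
      rw [dotProduct_sub, dotProduct_sub, dotProduct_smul, dotProduct_smul, smul_eq_mul,
        smul_eq_mul]
      linear_combination hβ1 - sylvesterProd g n * hpβ)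
  have hcρ : ∀ k, c k = -(sylvesterCofactor g n k * ρ k) := by
    intro k
    have h1 : (u k.castSucc.castSucc.castSucc - u (Fin.last (n + 2))) ⬝ᵥ
        (v (Fin.last n).castSucc.castSucc - sylvesterProd g n • p) =
        -(sylvesterProd g n * ρ k) := by
      rw [dotProduct_sub, dotProduct_smul, sub_dotProduct, sub_dotProduct,
        h.pairing_sub_eq_zero (hne5 k).symm hne2, sub_self, zero_sub, smul_eq_mul]
    have h2 : (u k.castSucc.castSucc.castSucc - u (Fin.last (n + 2))) ⬝ᵥ
        (∑ k, c k • v k.castSucc.castSucc.castSucc) = gSylvester g (k + 1) * c k := by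
      rw [dotProduct_sum, Finset.sum_eq_single k]
      · rw [dotProduct_smul, sub_dotProduct, h.pairing_self_sub (hne k).symm, hA,
          candidate_castSucc_castSucc_castSucc, smul_eq_mul, mul_comm]
      · intro j _ hj
        rw [dotProduct_smul, sub_dotProduct,
          h.pairing_sub_eq_zero (by simpa [Fin.ext_iff] using fun hh => hj (Fin.ext hh.symm)) (hne j),
          sub_self, smul_zero]
      · simp
    rw [hc, h2, ← gSylvester_mul_cofactor g n k] at h1
    refine mul_left_cancel₀ (gSylvester_pos g k).ne' ?_
    rw [h1]
    ring
  -- Modulo `s_k` the first reduced relation gives `cofactor * ρ k ≡ -1 ≡ g * cofactor`, and the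
  -- cofactor is invertible.
  have hρdvd : ∀ k : Fin n, (gSylvester g (k + 1) : ℤ) ∣ ρ k - g := by
    intro k
    obtain ⟨h1, -⟩ := h.reduced_relations hA p (α := 0) (β := 3 * g)
      (e := u (Fin.last (n + 2)) ⬝ᵥ p) (ρ := ρ) rfl (by rw [hpα, add_zero]) (by linarith)
      (fun k => by simp only [hρ]; ring)
    obtain ⟨h2, h3⟩ := IsCoprime.mul_right_iff.mp
      (isCoprime_gSylvester_mul_cofactor h.index_pos n k)
    rw [← Finset.add_sum_erase _ _ (Finset.mem_univ k)] at h1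
    have h4 : (gSylvester g (k + 1) : ℤ) ∣
        ∑ j ∈ Finset.univ.erase k, sylvesterCofactor g n j * ρ j :=
      Finset.dvd_sum fun j hj => dvd_mul_of_dvd_left
        (gSylvester_dvd_cofactor g n (Finset.ne_of_mem_erase hj).symm) _
    have h5 : (gSylvester g (k + 1) : ℤ) ∣ sylvesterProd g n :=
      ⟨_, (gSylvester_mul_cofactor g n k).symm⟩
    have h6 : (gSylvester g (k + 1) : ℤ) ∣ g * (sylvesterCofactor g n k * ρ k + 1) := by
      have h7 : (g : ℤ) * (sylvesterCofactor g n k * ρ k + 1) =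
          -(g * ∑ j ∈ Finset.univ.erase k, sylvesterCofactor g n j * ρ j) -
            (u (Fin.last (n + 2)) ⬝ᵥ p) * sylvesterProd g n := by linarith
      rw [h7]
      exact dvd_sub (dvd_neg.mpr (dvd_mul_of_dvd_right h4 _)) (dvd_mul_of_dvd_right h5 _)
    have h7 := h2.dvd_of_dvd_mul_left h6
    have h8 := dvd_sub h7 (gSylvester_dvd_mul_cofactor_add_one h.index_pos n k)
    refine h3.dvd_of_dvd_mul_left ?_
    convert h8 using 1
    ring
  choose z hz using hρdvd
  -- This shift turns the coefficients `-(cofactor * ρ k)` of the vertex into the prescribed `τ - g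
  -- * cofactor`, where `τ = sylvesterProd g n`.
  set p' : Fin (n + 2) → ℤ := p - ∑ k, (1 + z k) • e k with hp'
  have hv1 : v (Fin.last n).castSucc.castSucc =
      ∑ k, sylvesterEntryInt g n k • e k + sylvesterProd g n • p' := by
    have h1 : ∀ k, sylvesterEntryInt g n k = c k + sylvesterProd g n * (1 + z k) := by
      intro k
      rw [hcρ, sylvesterEntryInt, ← gSylvester_mul_cofactor g n k]
      linear_combination (sylvesterCofactor g n k) * hz k
    rw [sub_eq_iff_eq_add] at hc
    rw [hc, hp', smul_sub, Finset.smul_sum]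
    simp only [h1, add_smul, Finset.sum_add_distrib, mul_smul]
    abel
  have hp'α : u (Fin.last (n + 1)).castSucc ⬝ᵥ p' = u (Fin.last (n + 2)) ⬝ᵥ p' := by
    rw [hp', dotProduct_sub, dotProduct_sub, dotProduct_sum, dotProduct_sum, hpα]
    simp only [dotProduct_smul, hαe]
  have hp'β : u (Fin.last n).castSucc.castSucc ⬝ᵥ p' - u (Fin.last (n + 2)) ⬝ᵥ p' = 3 * g := by
    rw [hp', dotProduct_sub, dotProduct_sub, dotProduct_sum, dotProduct_sum, ← hpβ]
    simp only [dotProduct_smul, hβe]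
    ring
  obtain ⟨x, hx⟩ : ∃ x, x = v (Fin.last (n + 1)).castSucc - (3 * g * sylvesterProd g n) • q :=
    ⟨_, rfl⟩
  have hxα : u (Fin.last (n + 1)).castSucc ⬝ᵥ x = u (Fin.last (n + 2)) ⬝ᵥ x := by
    rw [hx, dotProduct_sub, dotProduct_sub, dotProduct_smul, dotProduct_smul, smul_eq_mul,
      smul_eq_mul]
    linear_combination hα2 - 3 * (g : ℤ) * sylvesterProd g n * hqα
  obtain ⟨f, hf⟩ := h.dvd_sub_of_eq hA hxα
  obtain ⟨a, ha⟩ := h.exists_eq_sum_of_eq hA (x := x - f • p')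
    (by rw [dotProduct_sub, dotProduct_sub, dotProduct_smul, dotProduct_smul, hxα, hp'α])
    (by
      rw [dotProduct_sub, dotProduct_sub, dotProduct_smul, dotProduct_smul, smul_eq_mul,
        smul_eq_mul]
      linear_combination hf - f * hp'β)
  -- Replacing `q` by `q - N • (∑ e k + p')` adds `t * N` to every parameter, so this `N` makes all
  -- of them positive.
  set N : ℤ := ∑ k, |a k| + |f| + 1 with hN
  set t : ℤ := 3 * g * sylvesterProd g n with ht
  have ht1 : 1 ≤ t := by
    have : 0 < t := by positivity
    omega
  have hsum0 : 0 ≤ ∑ k, |a k| := Finset.sum_nonneg fun k _ => abs_nonneg _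
  have hNt : ∀ w : ℤ, |w| + 1 ≤ N → 1 ≤ w + t * N := by
    intro w hw
    have h1 := neg_abs_le w
    have h2 : 0 ≤ |w| := abs_nonneg w
    nlinarith
  set q' : Fin (n + 2) → ℤ := q - N • (∑ k, e k + p') with hq'
  have hv2 : v (Fin.last (n + 1)).castSucc =
      ∑ k, (a k + t * N) • e k + (f + t * N) • p' + t • q' := by
    have h1 : v (Fin.last (n + 1)).castSucc = ∑ k, a k • e k + f • p' + t • q := by
      rw [← ha, hx]
      abel
    rw [h1, hq']
    simp only [add_smul, Finset.sum_add_distrib, ← Finset.smul_sum, smul_sub, smul_add, mul_smul]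
    abel
  refine ⟨fun k => a k + t * N, f + t * N, fun k => hNt _ ?_, hNt _ ?_, ?_⟩
  · have h1 := Finset.single_le_sum (f := fun k => |a k|) (fun i _ => abs_nonneg _)
      (Finset.mem_univ k)
    have h2 := abs_nonneg f
    linarith
  · linarith
  · set B := columnMatrix e p' q' with hB
    have hV : vertexMatrix v = B * vertexMatrix (generalVertices g n (fun k => a k + t * N)
        (f + t * N)) := by
      rw [vertexMatrix_generalVertices, hB, columnMatrix_mul_triangularMatrix,
        vertexMatrix_eq_columnMatrix, ← hv1, ← ht, ← hv2]
    have hBdet : IsUnit B.det := by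
      rw [hV, Matrix.det_mul, vertexMatrix_generalVertices, det_triangularMatrix, Int.natAbs_mul]
        at hdet
      rw [Int.isUnit_iff_natAbs_eq]
      push_cast at hdet
      rw [abs_of_pos (a := sylvesterProd g n * (3 * g * sylvesterProd g n)) (by positivity)] at hdet
      have h1 : |B.det| * (3 * g * sylvesterProd g n ^ 2) = 1 * (3 * g * sylvesterProd g n ^ 2) := by
        linarith
      have h2 := mul_right_cancel₀ (by positivity) h1
      rw [← Int.natCast_natAbs] at h2
      exact_mod_cast h2
    have hcol : ∀ j : Fin (n + 2), B.mulVec (generalVertices g n (fun k => a k + t * N)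
        (f + t * N) j.castSucc) = v j.castSucc := by
      intro j
      ext i
      exact (congrFun (congrFun hV i) j).symm
    refine (latticeIsomorphic_of_mulVec B hBdet fun j => ?_).symm
    refine Fin.lastCases ?_ hcol j
    rw [generalVertices_last_eq, Matrix.mulVec_neg, Matrix.mulVec_add, Matrix.mulVec_add,
      Matrix.mulVec_sum]
    simp only [Matrix.mulVec_smul, hcol]
    ext l
    have h1 := h.sum_cofactor_mul_vertices hA l
    simp only [Pi.neg_apply, Pi.add_apply, Finset.sum_apply, Pi.smul_apply, smul_eq_mul]
    linarith

end general

end IsFanoPair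

/-! ### Examples -/

theorem dotProduct_snocTwo {n : ℕ} (f c : Fin n → ℤ) (y z p q : ℤ) :
    snocTwo f y z ⬝ᵥ snocTwo c p q = f ⬝ᵥ c + y * p + z * q := by
  simp [dotProduct, Fin.sum_univ_castSucc]

theorem sum_sylvesterEntryInt {g : ℕ} (hg : 0 < g) (n : ℕ) :
    ∑ k, sylvesterEntryInt g n k = (n - 1) * sylvesterProd g n + 1 := by
  simp only [sylvesterEntryInt, Finset.sum_sub_distrib]
  rw [eq_sub_of_add_eq (sum_cofactor hg n)]
  simp
  ring

theorem isCoprime_sylvesterProd {g : ℕ} (hg : 0 < g) (n : ℕ) :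
    IsCoprime (g : ℤ) (sylvesterProd g n) := by
  refine ⟨-∑ k, sylvesterCofactor g n k, 1, ?_⟩
  rw [← sum_cofactor hg n, ← Finset.mul_sum]
  ring

section generalFunctionals

variable (g n : ℕ)

/-- The vertices of `g` times the dual of the general simplex with multiplicity
`3 * t ^ 2 / g`. -/
def generalFunctionals : Fin (n + 2 + 1) → Fin (n + 2) → ℤ :=
  Fin.snoc (α := fun _ => Fin (n + 2) → ℤ)
    (snocTwo (fun j => snocTwo (fun k => (if j = k then (gSylvester g (k + 1) : ℤ) else 0) - g)
        (g * n - gSylvester g (j + 1)) 0)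
      (snocTwo (fun _ => -(g : ℤ)) (g * (n + 2)) (-1)) (snocTwo (fun _ => -(g : ℤ)) (g * (n - 1)) 1))
    (snocTwo (fun _ => -(g : ℤ)) (g * (n - 1)) 0)

theorem generalFunctionals_castSucc_castSucc_castSucc (j : Fin n) :
    generalFunctionals g n j.castSucc.castSucc.castSucc =
      snocTwo (fun k => (if j = k then (gSylvester g (k + 1) : ℤ) else 0) - g)
        (g * n - gSylvester g (j + 1)) 0 := by
  simp [generalFunctionals]

theorem generalFunctionals_castSucc_castSucc_last :
    generalFunctionals g n (Fin.last n).castSucc.castSucc =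
      snocTwo (fun _ => -(g : ℤ)) (g * (n + 2)) (-1) := by
  simp [generalFunctionals]

theorem generalFunctionals_castSucc_last :
    generalFunctionals g n (Fin.last (n + 1)).castSucc =
      snocTwo (fun _ => -(g : ℤ)) (g * (n - 1)) 1 := by
  simp [generalFunctionals]

theorem generalFunctionals_last :
    generalFunctionals g n (Fin.last (n + 2)) = snocTwo (fun _ => -(g : ℤ)) (g * (n - 1)) 0 := by
  simp [generalFunctionals]

end generalFunctionals

/-- The pairings with all vertices but the last reduce to `sum_sylvesterEntryInt` and the cofactor
identity; those with the last vertex follow from the linear relation. -/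
theorem generalFunctionals_dotProduct {g : ℕ} (hg : 0 < g) (n : ℕ) (i j : Fin (n + 2 + 1)) :
    generalFunctionals g n i ⬝ᵥ
      generalVertices g n (sylvesterEntryInt g n) (sylvesterProd g n) j =
      (if i = j then candidate g (n + 1) n i else 0) - g := by
  have hsum := sum_sylvesterEntryInt hg n
  have hcof := sum_cofactor hg n
  have hconst : ∀ c : Fin n → ℤ, (fun _ => -(g : ℤ)) ⬝ᵥ c = -(g * ∑ k, c k) := by
    intro c
    simp [dotProduct, Finset.mul_sum]
  have hsingle : ∀ (j : Fin n) (c : Fin n → ℤ),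
      (fun k : Fin n => (if j = k then (gSylvester g (k + 1) : ℤ) else 0) - g) ⬝ᵥ c =
        gSylvester g (j + 1) * c j - g * ∑ k, c k := by
    intro j c
    simp [dotProduct, sub_mul, Finset.sum_sub_distrib, Finset.mul_sum]
  have hne : ∀ k : Fin n, Fin.last (n + 2) ≠ k.castSucc.castSucc.castSucc :=
    fun k => (Fin.castSucc_lt_last _).ne'
  have hne1 : Fin.last (n + 2) ≠ (Fin.last n).castSucc.castSucc := (Fin.castSucc_lt_last _).ne'
  have hne2 : Fin.last (n + 2) ≠ (Fin.last (n + 1)).castSucc := (Fin.castSucc_lt_last _).ne'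
  have hne3 : Fin.last (n + 1) ≠ (Fin.last n).castSucc := (Fin.castSucc_lt_last _).ne'
  have hne4 : ∀ k : Fin n, Fin.last (n + 1) ≠ k.castSucc.castSucc :=
    fun k => (Fin.castSucc_lt_last _).ne'
  have hne5 : ∀ k : Fin n, Fin.last n ≠ k.castSucc := fun k => (Fin.castSucc_lt_last _).ne'
  have hfirst : ∀ j : Fin (n + 2), ∀ i, generalFunctionals g n i ⬝ᵥ
      generalVertices g n (sylvesterEntryInt g n) (sylvesterProd g n) j.castSucc =
      (if i = j.castSucc then candidate g (n + 1) n i else 0) - g := by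
    refine Fin.forall_castSucc_castSucc ?_ ?_ ?_
    · intro k i
      rw [generalVertices_castSucc_castSucc_castSucc, dotProduct_single_one]
      refine Fin.lastCases ?_ (fun i => Fin.forall_castSucc_castSucc (P := fun i =>
        generalFunctionals g n i.castSucc k.castSucc.castSucc = (if i.castSucc =
        k.castSucc.castSucc.castSucc then candidate g (n + 1) n i.castSucc else 0) - g)
        ?_ ?_ ?_ i) i
      · simp [generalFunctionals_last, hne]
      · intro l
        simp only [generalFunctionals_castSucc_castSucc_castSucc, snocTwo_castSucc_castSucc,
          Fin.castSucc_inj]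
        congr 1
        split_ifs with hl
        · rw [hl]
          exact (candidate_castSucc_castSucc_castSucc g n k).symm
        · rfl
      · simp [generalFunctionals_castSucc_castSucc_last, hne5]
      · simp [generalFunctionals_castSucc_last, hne4]
    · intro i
      rw [generalVertices_castSucc_castSucc_last]
      refine Fin.lastCases ?_ (fun i => Fin.forall_castSucc_castSucc (P := fun i =>
        generalFunctionals g n i.castSucc ⬝ᵥ snocTwo (sylvesterEntryInt g n) (sylvesterProd g n) 0
        = (if i.castSucc = (Fin.last n).castSucc.castSucc then candidate g (n + 1) n i.castSucc
        else 0) - g) ?_ ?_ ?_ i) i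
      · rw [generalFunctionals_last, dotProduct_snocTwo, hconst, hsum, if_neg hne1]
        ring
      · intro l
        rw [generalFunctionals_castSucc_castSucc_castSucc, dotProduct_snocTwo, hsingle, hsum,
          if_neg (by simp), sylvesterEntryInt]
        linear_combination (-(g : ℤ)) * gSylvester_mul_cofactor g n l
      · rw [generalFunctionals_castSucc_castSucc_last, dotProduct_snocTwo, hconst, hsum, if_pos rfl,
          candidate_of_le g (by simp)]
        ring
      · rw [generalFunctionals_castSucc_last, dotProduct_snocTwo, hconst, hsum,
          if_neg (by simpa [Fin.castSucc_inj] using hne3)]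
        ring
    · intro i
      rw [generalVertices_castSucc_last]
      refine Fin.lastCases ?_ (fun i => Fin.forall_castSucc_castSucc (P := fun i =>
        generalFunctionals g n i.castSucc ⬝ᵥ snocTwo (sylvesterEntryInt g n) (sylvesterProd g n)
        (3 * g * sylvesterProd g n) = (if i.castSucc = (Fin.last (n + 1)).castSucc then
        candidate g (n + 1) n i.castSucc else 0) - g) ?_ ?_ ?_ i) i
      · rw [generalFunctionals_last, dotProduct_snocTwo, hconst, hsum, if_neg hne2]
        ring
      · intro l
        rw [generalFunctionals_castSucc_castSucc_castSucc, dotProduct_snocTwo, hsingle, hsum,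
          if_neg (by simp), sylvesterEntryInt]
        linear_combination (-(g : ℤ)) * gSylvester_mul_cofactor g n l
      · rw [generalFunctionals_castSucc_castSucc_last, dotProduct_snocTwo, hconst, hsum,
          if_neg (by simp)]
        ring
      · rw [generalFunctionals_castSucc_last, dotProduct_snocTwo, hconst, hsum, if_pos rfl,
          candidate_of_le g (by simp)]
        ring
  have hcof3 : ∑ k, 3 * (g : ℤ) * sylvesterCofactor g n k = 3 * (sylvesterProd g n - 1) := by
    rw [← hcof, add_sub_cancel_right, Finset.mul_sum]
    exact Finset.sum_congr rfl fun k _ => by ring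
  revert j
  refine Fin.lastCases ?_ (fun j => hfirst j i)
  rw [generalVertices_last_eq, dotProduct_neg, dotProduct_add, dotProduct_add, dotProduct_sum]
  simp only [dotProduct_smul, hfirst, smul_eq_mul, mul_sub, Finset.sum_sub_distrib,
    ← Finset.sum_mul, hcof3]
  revert i
  refine Fin.lastCases ?_ (Fin.forall_castSucc_castSucc ?_ ?_ ?_)
  · simp only [hne, hne1, hne2, if_true, if_false, mul_zero, Finset.sum_const_zero]
    rw [candidate_of_le g (by simp)]
    ring
  · intro l
    rw [if_neg (hne l).symm, if_neg (by simp),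
      if_neg (by simp)]
    rw [Finset.sum_eq_single l]
    · rw [if_pos rfl]
      have h1 : candidate g (n + 1) n (l.castSucc.castSucc.castSucc : Fin (n + 2 + 1)) = _ :=
        candidate_castSucc_castSucc_castSucc g n l
      rw [h1]
      linear_combination (-3 * (g : ℤ)) * gSylvester_mul_cofactor g n l
    · intro k _ hk
      rw [if_neg (by simpa [Fin.castSucc_inj] using hk.symm), mul_zero]
    · simp
  · rw [if_neg hne1.symm, if_pos rfl, if_neg (by simp),
      candidate_of_le g (by simp)]
    simp only [Fin.castSucc_inj, hne5, if_false, mul_zero, Finset.sum_const_zero]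
    ring
  · rw [if_neg hne2.symm, if_pos rfl, if_neg (by simpa [Fin.castSucc_inj] using hne3),
      candidate_of_le g (by simp)]
    simp only [Fin.castSucc_inj, hne4, if_false, mul_zero, Finset.sum_const_zero]
    ring

theorem sum_mul_generalVertices {g : ℕ} (hg : 0 < g) {n : ℕ} (a : Fin n → ℤ) (b : ℤ)
    {A : Fin (n + 2 + 1) → ℤ} (hA : ∀ i, A i = candidate g (n + 1) n i) (k : Fin (n + 2)) :
    ∑ j, (g : ℚ) / A j * generalVertices g n a b j k = 0 := by
  have h1 := sum_candidate hg hA fun j => (generalVertices g n a b j k : ℚ)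
  have h2 := congrArg (Int.cast : ℤ → ℚ) (congrFun (generalVertices_last_eq g n a b) k)
  have h3 : (3 * sylvesterProd g n : ℚ) ≠ 0 := by
    exact_mod_cast (mul_pos three_pos (sylvesterProd_pos g n)).ne'
  refine (mul_eq_zero.mp ?_).resolve_left h3
  rw [h1, h2]
  simp

theorem sum_div_candidate {g : ℕ} (hg : 0 < g) {n : ℕ}
    {A : Fin (n + 2 + 1) → ℤ} (hA : ∀ i, A i = candidate g (n + 1) n i) :
    ∑ j, (g : ℚ) / A j = 1 := by
  have h1 := sum_candidate hg hA fun _ => 1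
  have h2 := congrArg (Int.cast : ℤ → ℚ) (sum_cofactor hg n)
  have h3 : (3 * sylvesterProd g n : ℚ) ≠ 0 := by
    exact_mod_cast (mul_pos three_pos (sylvesterProd_pos g n)).ne'
  refine mul_left_cancel₀ h3 ?_
  simp only [mul_one] at h1 ⊢
  push_cast at h2
  rw [h1, ← h2]
  simp only [mul_assoc, ← Finset.mul_sum]
  ring

theorem isFanoPair_general {g : ℕ} (hg : Odd g) (n : ℕ) :
    IsFanoPair g (fun i : Fin (n + 2 + 1) => candidate g (n + 1) n i)
      (generalVertices g n (sylvesterEntryInt g n) (sylvesterProd g n))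
      (generalFunctionals g n) where
  index_pos := hg.pos
  pos i := by
    rcases lt_or_ge (i : ℕ) n with hi | hi
    · simp only [candidate, if_pos hi]
      exact gSylvester_pos g i
    · simp only [candidate_of_le g hi]
      have := sylvesterProd_pos g n
      have := hg.pos
      positivity
  pairing i j := generalFunctionals_dotProduct hg.pos n i j
  sum_inv := sum_div_candidate hg.pos fun _ => rfl
  relation := sum_mul_generalVertices hg.pos _ _ fun _ => rfl
  primitive j k hk := by
    -- A common divisor of the coordinates divides `g`, as some functional takes the value `-g` at
    -- the vertex. For the last three vertices coordinate `n`, counted from zero, is `τ`, `τ` or `-2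
    -- τ` with `τ = sylvesterProd g n`, and `g` is prime to `2 τ` because it is odd.
    have hkg : k ∣ g := by
      obtain ⟨i, hij⟩ := exists_ne j
      have h1 := generalFunctionals_dotProduct hg.pos n i j
      rw [if_neg hij, zero_sub] at h1
      rw [← dvd_neg, ← h1]
      exact Finset.dvd_sum fun l _ => dvd_mul_of_dvd_right (hk l) _
    have hcop : IsCoprime k (2 * sylvesterProd g n) := by
      refine IsCoprime.of_isCoprime_of_dvd_left (IsCoprime.mul_right ?_
        (isCoprime_sylvesterProd hg.pos n)) hkg
      exact_mod_cast (Nat.isCoprime_iff_coprime.mpr (Nat.coprime_two_right.mpr hg))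
    refine (Fin.lastCases (fun hk => ?_) (Fin.forall_castSucc_castSucc (fun l hk => ?_)
      (fun hk => ?_) (fun hk => ?_)) j :
        (∀ i, k ∣ generalVertices g n (sylvesterEntryInt g n) (sylvesterProd g n) j i) →
          IsUnit k) hk
    · have h1 := hk (Fin.last n).castSucc
      rw [generalVertices_last, snocTwo_castSucc_last, dvd_neg, ← two_mul] at h1
      exact hcop.isUnit_of_dvd' dvd_rfl h1
    · have h1 := hk l.castSucc.castSucc
      rw [generalVertices_castSucc_castSucc_castSucc, Pi.single_eq_same] at h1
      exact isUnit_of_dvd_one h1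
    · have h1 := hk (Fin.last n).castSucc
      rw [generalVertices_castSucc_castSucc_last, snocTwo_castSucc_last] at h1
      exact hcop.isUnit_of_dvd' dvd_rfl (dvd_mul_of_dvd_right h1 2)
    · have h1 := hk (Fin.last n).castSucc
      rw [generalVertices_castSucc_last, snocTwo_castSucc_last] at h1
      exact hcop.isUnit_of_dvd' dvd_rfl (dvd_mul_of_dvd_right h1 2)

theorem gorensteinIndex_general {g : ℕ} (hg : Odd g) (n : ℕ) :
    gorensteinIndex (integralHull
      (generalVertices g n (sylvesterEntryInt g n) (sylvesterProd g n))) = g := by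
  refine (isFanoPair_general hg n).gorensteinIndex_eq_of_sub_eq_one
    (i := (Fin.last (n + 1)).castSucc) (j := Fin.last (n + 2)) (l := Fin.last (n + 1)) ?_
  rw [generalFunctionals_castSucc_last, generalFunctionals_last, snocTwo_last, snocTwo_last, sub_zero]

theorem simplexMultiplicity_general {g : ℕ} (hg : Odd g) (n : ℕ) :
    (simplexMultiplicity (integralHull
      (generalVertices g n (sylvesterEntryInt g n) (sylvesterProd g n))) : ℤ) =
      3 * g * sylvesterProd g n ^ 2 := by
  rw [(isFanoPair_general hg n).multiplicity_eq_of_last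
    (c := snocTwo (fun k => -(3 * g * sylvesterCofactor g n k)) (-1) (-1)),
    vertexMatrix_generalVertices, det_triangularMatrix, Int.natCast_natAbs, abs_of_pos]
  · ring
  · have := sylvesterProd_pos g n
    have := hg.pos
    positivity
  · intro k
    rw [generalVertices_last_eq]
    simp [Fin.sum_univ_castSucc]
    ring

/-! ### Explicit simplices in dimensions three and four. -/

theorem isUnit_of_dvd_of_gcd_eq_one {a b k : ℤ} (hab : Int.gcd a b = 1) (ha : k ∣ a) (hb : k ∣ b) :
    IsUnit k :=
  (Int.isCoprime_iff_gcd_eq_one.mpr hab).isUnit_of_dvd' ha hb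

theorem simplexOfMatrix_eq_integralHull {d : ℕ} {P : Matrix (Fin d) (Fin (d + 1)) ℚ}
    {v : Matrix (Fin (d + 1)) (Fin d) ℤ} (h : ∀ i j, P i j = v j i) :
    simplexOfMatrix P = integralHull v := by
  unfold simplexOfMatrix integralHull
  simp only [h]

/-- The vertices of the simplex given by `matrixDimThree`. -/
def verticesDimThree (g : ℤ) : Matrix (Fin 4) (Fin 3) ℤ :=
  !![1, 0, 0; 4 * g - 3, 4 * g, 0; 4 * g - 3, 0, 4 * g; 5 - 8 * g, -4 * g, -4 * g]

/-- The vertices of `g` times the dual of the simplex given by `matrixDimThree`. -/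
def functionalsDimThree (g : ℤ) : Matrix (Fin 4) (Fin 3) ℤ :=
  !![3 * g, 2 - 3 * g, 2 - 3 * g; -g, g, g - 1; -g, g - 1, g; -g, g - 1, g - 1]

theorem simplexOfMatrix_matrixDimThree (g : ℕ) :
    simplexOfMatrix (matrixDimThree g) = integralHull (verticesDimThree g) := by
  refine simplexOfMatrix_eq_integralHull fun i j => ?_
  fin_cases i <;> fin_cases j <;> simp [matrixDimThree, verticesDimThree]

theorem isFanoPair_dimThree {g : ℕ} (hg : g = 1 ∨ g = 2) :
    IsFanoPair g (fun _ => 4 * g) (verticesDimThree g) (functionalsDimThree g) where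
  index_pos := by omega
  pos _ := by omega
  pairing := by rcases hg with rfl | rfl <;> decide
  sum_inv := by
    rcases hg with rfl | rfl <;> norm_num
  relation := by
    rcases hg with rfl | rfl <;> intro k <;> fin_cases k <;>
      norm_num [Fin.sum_univ_succ, verticesDimThree]
  primitive j k hk := by
    have h1 : ∀ j, Int.gcd (verticesDimThree g j 0) (verticesDimThree g j 1) = 1 ∨
        Int.gcd (verticesDimThree g j 0) (verticesDimThree g j 2) = 1 := by
      rcases hg with rfl | rfl <;> decide
    rcases h1 j with h | h
    · exact isUnit_of_dvd_of_gcd_eq_one h (hk 0) (hk 1)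
    · exact isUnit_of_dvd_of_gcd_eq_one h (hk 0) (hk 2)

theorem gorensteinIndex_dimThree {g : ℕ} (hg : g = 1 ∨ g = 2) :
    gorensteinIndex (integralHull (verticesDimThree g)) = g :=
  (isFanoPair_dimThree hg).gorensteinIndex_eq_of_sub_eq_one (i := 1) (j := 3) (l := 1)
    (by simp [functionalsDimThree])

theorem simplexMultiplicity_dimThree {g : ℕ} (hg : g = 1 ∨ g = 2) :
    simplexMultiplicity (integralHull (verticesDimThree g)) = 16 * g ^ 2 := by
  rw [(isFanoPair_dimThree hg).multiplicity_eq_of_last (c := fun _ => -1)]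
  · rcases hg with rfl | rfl <;> rw [Matrix.det_fin_three] <;> decide
  · rcases hg with rfl | rfl <;> decide

/-- The vertices of the simplex given by `matrixThreeThree`. -/
def verticesThreeThree : Matrix (Fin 4) (Fin 3) ℤ :=
  !![1, 0, 0; 1, 12, 0; 5, 0, 12; -7, -12, -12]

/-- The vertices of three times the dual of the simplex given by `matrixThreeThree`. -/
def functionalsThreeThree : Matrix (Fin 4) (Fin 3) ℤ :=
  !![9, -1, -4; -3, 1, 1; -3, 0, 2; -3, 0, 1]

theorem simplexOfMatrix_matrixThreeThree :
    simplexOfMatrix matrixThreeThree = integralHull verticesThreeThree := by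
  refine simplexOfMatrix_eq_integralHull fun i j => ?_
  fin_cases i <;> fin_cases j <;> simp [matrixThreeThree, verticesThreeThree]

theorem isFanoPair_threeThree :
    IsFanoPair 3 (fun _ => 12) verticesThreeThree functionalsThreeThree where
  index_pos := by norm_num
  pos _ := by norm_num
  pairing := by decide
  sum_inv := by norm_num
  relation k := by
    fin_cases k <;> norm_num [Fin.sum_univ_succ, verticesThreeThree]
  primitive j _ hk :=
    isUnit_of_dvd_of_gcd_eq_one ((by decide : ∀ j, Int.gcd (verticesThreeThree j 0)
      (verticesThreeThree j 2) = 1) j) (hk 0) (hk 2)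

theorem simplexMultiplicity_threeThree :
    simplexMultiplicity (integralHull verticesThreeThree) = 144 := by
  rw [isFanoPair_threeThree.multiplicity_eq_of_last (c := fun _ => -1)]
  · rw [Matrix.det_fin_three]
    decide
  · decide

/-- The vertices of the simplex given by `matrixDimFour`. -/
def verticesDimFour : Matrix (Fin 5) (Fin 4) ℤ :=
  !![1, 0, 0, 0; 1, 2, 0, 0; 1, 2, 8, 0; 1, 2, 0, 8; -7, -6, -8, -8]

/-- The vertices of the dual of the simplex given by `matrixDimFour`. -/
def functionalsDimFour : Matrix (Fin 5) (Fin 4) ℤ :=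
  !![1, -1, 0, 0; -1, 4, -1, -1; -1, 0, 1, 0; -1, 0, 0, 1; -1, 0, 0, 0]

theorem simplexOfMatrix_matrixDimFour :
    simplexOfMatrix matrixDimFour = integralHull verticesDimFour := by
  refine simplexOfMatrix_eq_integralHull fun i j => ?_
  fin_cases i <;> fin_cases j <;> simp [matrixDimFour, verticesDimFour]

theorem isFanoPair_dimFour :
    IsFanoPair 1 ![2, 8, 8, 8, 8] verticesDimFour functionalsDimFour where
  index_pos := by norm_num
  pos := by decide
  pairing := by decide
  sum_inv := by norm_num [Fin.sum_univ_succ]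
  relation k := by
    fin_cases k <;> norm_num [Fin.sum_univ_succ, verticesDimFour]
  primitive j _ hk :=
    isUnit_of_dvd_of_gcd_eq_one ((by decide : ∀ j, Int.gcd (verticesDimFour j 0)
      (verticesDimFour j 1) = 1) j) (hk 0) (hk 1)

theorem gorensteinIndex_dimFour : gorensteinIndex (integralHull verticesDimFour) = 1 :=
  isFanoPair_dimFour.gorensteinIndex_eq_of_sub_eq_one (i := 2) (j := 4) (l := 2)
    (by simp [functionalsDimFour])

theorem simplexMultiplicity_dimFour :
    simplexMultiplicity (integralHull verticesDimFour) = 128 := by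
  rw [isFanoPair_dimFour.multiplicity_eq_of_last (c := ![-4, -1, -1, -1])]
  · rw [Matrix.det_succ_row_zero]
    simp only [Matrix.det_fin_three]
    decide
  · decide

/-! ### Maximal multiplicities -/

theorem exists_isFanoPair_monotone {d g : ℕ} (hg : 1 ≤ g) {Δ : Set (Fin d → ℚ)}
    (hΔ : IsFanoSimplex Δ) (hind : gorensteinIndex Δ = g) :
    ∃ A v u, IsFanoPair g A v u ∧ Monotone A ∧ Δ = integralHull v := by
  obtain ⟨A, v, u, h, rfl⟩ := exists_isFanoPair hg hΔ hind
  exact ⟨_, _, _, h.comp_perm (Tuple.sort A), Tuple.monotone_sort A,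
    (integralHull_comp_perm v _).symm⟩

theorem multiplicity_le_dimThree {g : ℕ} (hg : g = 1 ∨ g = 2) {A : Fin 4 → ℤ}
    {v u : Fin 4 → Fin 3 → ℤ} (h : IsFanoPair g A v u) (hA : Monotone A) :
    simplexMultiplicity (integralHull v) ≤ 16 * g ^ 2 ∧
      (simplexMultiplicity (integralHull v) = 16 * g ^ 2 →
        (simplexMultiplicity (integralHull v) : ℤ) * A (Fin.last 3) ^ 2 = ∏ i, A i ∧
          ∀ i, A i = 4 * g) := by
  have hval : blockProd g 2 0 = (16 * g ^ 2 : ℕ) := by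
    have hg0 : (g : ℝ) ≠ 0 := by
      have := h.index_pos
      positivity
    rw [blockProd_pred_pred g 0, gSylvesterTrunc_one]
    push_cast
    field_simp
  have hlt : blockProd g 2 1 < blockProd g 2 0 := by
    have h1 := blockProd_pred_sub g 0
    rw [gSylvesterTrunc_one] at h1
    rw [← sub_neg]
    rcases hg with rfl | rfl <;> norm_num at h1 ⊢ <;> linarith
  obtain ⟨h1, h2⟩ := h.multiplicity_le (m := 2) two_pos hA (M := (16 * g ^ 2 : ℕ)) (by
    intro j hj
    rw [← hval]
    interval_cases j
    · exact le_rfl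
    · exact hlt.le)
  refine ⟨by exact_mod_cast h1, fun heq => ?_⟩
  obtain ⟨h3, j, hj, hjM, hjA⟩ := h2 (by exact_mod_cast heq)
  refine ⟨h3, fun i => ?_⟩
  have hj0 : j = 0 := by
    rw [← hval] at hjM
    interval_cases j
    · rfl
    · exact absurd hjM hlt.ne
  rw [hjA, hj0]
  simp [candidate, gSylvesterTrunc_one]

theorem latticeIsomorphic_dimThree {g : ℕ} (hg : g = 1 ∨ g = 2) {A : Fin 4 → ℤ}
    {v u : Fin 4 → Fin 3 → ℤ} (h : IsFanoPair g A v u) (hA : Monotone A)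
    (heq : simplexMultiplicity (integralHull v) = 16 * g ^ 2) :
    LatticeIsomorphic (integralHull v) (integralHull (verticesDimThree g)) := by
  obtain ⟨h1, h2⟩ := (multiplicity_le_dimThree hg h hA).2 heq
  have h3 := isFanoPair_dimThree hg
  have h4 := simplexMultiplicity_dimThree hg
  obtain rfl : A = fun _ => 4 * (g : ℤ) := funext h2
  rcases hg with rfl | rfl
  · exact h.latticeIsomorphic_of_index_one h3 (h.det_eq_of_multiplicity_eq h1).1
      (h3.det_eq_of_multiplicity_eq (by rw [h4]; simp)).1
  · exact h.latticeIsomorphic_of_index_two h3 (fun _ => by norm_num) heq h4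

theorem multiplicity_le_dimFour {A : Fin 5 → ℤ} {v u : Fin 5 → Fin 4 → ℤ}
    (h : IsFanoPair 1 A v u) (hA : Monotone A) :
    simplexMultiplicity (integralHull v) ≤ 128 ∧
      (simplexMultiplicity (integralHull v) = 128 →
        (simplexMultiplicity (integralHull v) : ℤ) * A (Fin.last 4) ^ 2 = ∏ i, A i ∧
          A = ![2, 8, 8, 8, 8]) := by
  have ht : gSylvesterTrunc 1 2 = 2 := by simp [gSylvesterTrunc_succ, gSylvesterTrunc_one]
  have hval : blockProd 1 3 1 = (128 : ℕ) := by
    rw [blockProd_pred_pred 1 1, ht]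
    norm_num
  have hlt : blockProd 1 3 2 < blockProd 1 3 1 := by
    have h1 := blockProd_pred_sub 1 1
    rw [ht] at h1
    norm_num at h1
    linarith
  have hle : ∀ j ≤ 1, _ := fun j hj => blockProd_le_pred_pred (g := 1) (m := 1) one_pos (j := j) hj
  obtain ⟨h1, h2⟩ := h.multiplicity_le (m := 3) three_pos hA (M := (128 : ℕ)) (by
    intro j hj
    rw [← hval]
    rcases Nat.lt_or_ge 1 j with h1 | h1
    · obtain rfl : j = 2 := by omega
      exact hlt.le
    · exact (hle j h1).1)
  refine ⟨by exact_mod_cast h1, fun heq => ?_⟩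
  obtain ⟨h3, j, hj, hjM, hjA⟩ := h2 (by exact_mod_cast heq)
  refine ⟨h3, funext fun i => ?_⟩
  rw [← hval] at hjM
  have hj1 : j = 1 := by
    rcases Nat.lt_or_ge 1 j with h1 | h1
    · obtain rfl : j = 2 := by omega
      exact absurd hjM hlt.ne
    · exact (hle j h1).2 hjM
  rw [hjA, hj1]
  fin_cases i <;> simp [candidate, ht, gSylvester]

theorem latticeIsomorphic_dimFour {A : Fin 5 → ℤ} {v u : Fin 5 → Fin 4 → ℤ}
    (h : IsFanoPair 1 A v u) (hA : Monotone A)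
    (heq : simplexMultiplicity (integralHull v) = 128) :
    LatticeIsomorphic (integralHull v) (integralHull verticesDimFour) := by
  obtain ⟨h1, rfl⟩ := (multiplicity_le_dimFour h hA).2 heq
  exact h.latticeIsomorphic_of_index_one isFanoPair_dimFour (h.det_eq_of_multiplicity_eq h1).1
    (isFanoPair_dimFour.det_eq_of_multiplicity_eq
      (by rw [simplexMultiplicity_dimFour]; decide)).1

/-- With `d = n + 3` this number is `t_{g,d-2}`, whose comparison with 3 decides between the last
two candidates. -/
theorem three_le_gSylvesterTrunc {g n : ℕ} (hg : 1 ≤ g) (h₁ : ¬ (n = 0 ∧ (g = 1 ∨ g = 2)))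
    (h₂ : ¬ (n = 1 ∧ g = 1)) : 3 ≤ gSylvesterTrunc g (n + 1) ∧
      (gSylvesterTrunc g (n + 1) = 3 → n = 0 ∧ g = 3) := by
  match n with
  | 0 =>
    rw [gSylvesterTrunc_one]
    omega
  | 1 =>
    rw [gSylvesterTrunc_succ, gSylvesterTrunc_one]
    have : 2 ≤ g := by omega
    have : 6 ≤ g * (g + 1) := by nlinarith
    omega
  | n + 2 =>
    rw [gSylvesterTrunc_succ, gSylvesterTrunc_succ]
    have h1 : 1 ≤ gSylvesterTrunc g (n + 1) := gSylvesterTrunc_pos hg n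
    generalize gSylvesterTrunc g (n + 1) = t at h1
    have h2 : 2 ≤ t * (t + 1) := by nlinarith
    have : 6 ≤ t * (t + 1) * (t * (t + 1) + 1) := by nlinarith
    omega

/-- Outside the exceptional pairs the last candidate is maximal; the only tie occurs at `t = 3`, in
dimension `n + 2 = 3` with `g = 3`. -/
theorem blockProd_le_pred {g n : ℕ} (hg : 1 ≤ g) (h₁ : ¬ (n = 1 ∧ (g = 1 ∨ g = 2)))
    (h₂ : ¬ (n = 2 ∧ g = 1)) {j : ℕ} (hj : j < n + 1) :
    blockProd g (n + 1) j ≤ blockProd g (n + 1) n ∧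
      (blockProd g (n + 1) j = blockProd g (n + 1) n → j = n ∨ (j = 0 ∧ n = 1 ∧ g = 3)) := by
  rcases Nat.lt_or_ge j n with hjn | hjn
  · obtain ⟨n, rfl⟩ := Nat.exists_eq_succ_of_ne_zero (by omega : n ≠ 0)
    simp only [Nat.succ_eq_add_one] at *
    obtain ⟨h3, h4⟩ := three_le_gSylvesterTrunc (n := n) hg (by omega) (by omega)
    obtain ⟨h5, h6⟩ := blockProd_le_pred_pred (g := g) hg (Nat.lt_succ_iff.mp hjn)
    have h7 := blockProd_pred_sub g n
    have h8 : (3 : ℝ) ≤ gSylvesterTrunc g (n + 1) := by exact_mod_cast h3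
    have hg0 : (0 : ℝ) < g := by exact_mod_cast hg
    have h9 : 0 < (gSylvesterTrunc g (n + 1) : ℝ) ^ 2 / g := by positivity
    have h10 : 0 ≤ (3 * (gSylvesterTrunc g (n + 1) : ℝ) - 1) * (gSylvesterTrunc g (n + 1) - 3) :=
      mul_nonneg (by linarith) (by linarith)
    have h11 := mul_nonneg h9.le h10
    refine ⟨by linarith, fun heq => Or.inr ?_⟩
    have hjn' := h6 (by linarith)
    have h12 : (gSylvesterTrunc g (n + 1) : ℝ) ^ 2 / g * ((3 * gSylvesterTrunc g (n + 1) - 1) *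
        (gSylvesterTrunc g (n + 1) - 3)) = 0 := by linarith
    have h13 := ((mul_eq_zero.mp h12).resolve_left h9.ne')
    have h14 := (mul_eq_zero.mp h13).resolve_left (by linarith)
    have h15 := h4 (by exact_mod_cast sub_eq_zero.mp h14)
    omega
  · obtain rfl : j = n := by omega
    simp

theorem multiplicity_le_general {g n : ℕ} (h₁ : ¬ (n = 1 ∧ (g = 1 ∨ g = 2)))
    (h₂ : ¬ (n = 2 ∧ g = 1)) {A : Fin (n + 2 + 1) → ℤ} {v u : Fin (n + 2 + 1) → Fin (n + 2) → ℤ}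
    (h : IsFanoPair g A v u) (hA : Monotone A) :
    (simplexMultiplicity (integralHull v) : ℤ) ≤ 3 * g * sylvesterProd g n ^ 2 ∧
      ((simplexMultiplicity (integralHull v) : ℤ) = 3 * g * sylvesterProd g n ^ 2 →
        (n = 1 ∧ g = 3 ∧ ∀ i, A i = 12) ∨
          ((vertexMatrix v).det.natAbs : ℤ) = 3 * g * sylvesterProd g n ^ 2 ∧
            ∀ i, A i = candidate g (n + 1) n i) := by
  have hg := h.index_pos
  have hval : blockProd g (n + 1) n = (3 * g * sylvesterProd g n ^ 2 : ℤ) := by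
    have hg0 : (g : ℝ) ≠ 0 := by positivity
    have h1 : (gSylvesterTrunc g (n + 1) : ℝ) = g * sylvesterProd g n := by
      exact_mod_cast (mul_sylvesterProd g n).symm
    rw [blockProd_pred, h1]
    push_cast
    field_simp
  obtain ⟨h3, h4⟩ := h.multiplicity_le (m := n + 1) n.succ_pos hA
    (M := (3 * g * sylvesterProd g n ^ 2 : ℤ)) (by
      intro j hj
      rw [← hval]
      exact (blockProd_le_pred hg h₁ h₂ hj).1)
  refine ⟨by exact_mod_cast h3, fun heq => ?_⟩
  obtain ⟨h5, j, hj, hjM, hjA⟩ := h4 (by exact_mod_cast heq)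
  rw [← hval] at hjM
  rcases (blockProd_le_pred hg h₁ h₂ hj).2 hjM with rfl | ⟨rfl, rfl, rfl⟩
  · refine Or.inr ⟨?_, hjA⟩
    rw [(h.det_eq_of_multiplicity_eq h5).2, heq]
  · refine Or.inl ⟨rfl, rfl, fun i => ?_⟩
    rw [hjA]
    simp [candidate, gSylvesterTrunc_one]

theorem cast_mul_sylvesterProd_sq {g : ℕ} (hg : 0 < g) (n : ℕ) :
    3 * (gSylvesterTrunc g (n + 1) : ℚ) ^ 2 / g = (3 * g * sylvesterProd g n ^ 2 : ℤ) := by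
  have hg0 : (g : ℚ) ≠ 0 := by positivity
  have h1 : (gSylvesterTrunc g (n + 1) : ℚ) = g * sylvesterProd g n := by
    exact_mod_cast (mul_sylvesterProd g n).symm
  rw [h1]
  push_cast
  field_simp

/-- The extension of integers `a` and `b` to a sequence starting at the index one. -/
def paramSeq {n : ℕ} (a : Fin n → ℤ) (b : ℤ) (j : ℕ) : ℕ :=
  -- Truncated subtraction makes index 0 repeat index 1, so every value stays positive.
  if h : j - 1 < n then (a ⟨j - 1, h⟩).toNat else b.toNat

section paramSeq

variable {n : ℕ} {a : Fin n → ℤ} {b : ℤ}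

theorem one_le_paramSeq (ha : ∀ k, 1 ≤ a k) (hb : 1 ≤ b) (j : ℕ) : 1 ≤ paramSeq a b j := by
  unfold paramSeq
  split_ifs with h
  · have := ha ⟨j - 1, h⟩
    omega
  · omega

theorem cast_paramSeq_succ (ha : ∀ k, 1 ≤ a k) (k : Fin n) : (paramSeq a b (k + 1) : ℤ) = a k := by
  have := ha k
  simp only [paramSeq, Nat.add_sub_cancel, k.isLt, dite_true, Fin.eta]
  omega

theorem cast_paramSeq_last (hb : 1 ≤ b) : (paramSeq a b (n + 1) : ℤ) = b := by
  simp only [paramSeq, Nat.add_sub_cancel, lt_irrefl, dite_false]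
  omega

theorem simplexOfMatrix_paramSeq {g : ℕ} (hg : 0 < g) (ha : ∀ k, 1 ≤ a k) (hb : 1 ≤ b) :
    simplexOfMatrix (matrixGeneral (n + 2) g (paramSeq a b)) =
      integralHull (generalVertices g n a b) := by
  rw [simplexOfMatrix_matrixGeneral hg, cast_paramSeq_last hb]
  simp only [cast_paramSeq_succ ha]

end paramSeq

/-! ### Assembly of the three cases. -/

theorem theorem1p2 :
    -- dimension three, Gorenstein index one or two
    (∀ g : ℕ, (g = 1 ∨ g = 2) →
      (IsFanoSimplex (simplexOfMatrix (matrixDimThree g)) ∧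
        gorensteinIndex (simplexOfMatrix (matrixDimThree g)) = g) ∧
      ∀ Δ : Set (Fin 3 → ℚ), IsFanoSimplex Δ → gorensteinIndex Δ = g →
        simplexMultiplicity Δ ≤ 16 * g ^ 2 ∧
        (simplexMultiplicity Δ = 16 * g ^ 2 ↔
          LatticeIsomorphic Δ (simplexOfMatrix (matrixDimThree g)))) ∧
    -- dimension four, Gorenstein index one
    ((IsFanoSimplex (simplexOfMatrix matrixDimFour) ∧
        gorensteinIndex (simplexOfMatrix matrixDimFour) = 1) ∧
      ∀ Δ : Set (Fin 4 → ℚ), IsFanoSimplex Δ → gorensteinIndex Δ = 1 →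
        simplexMultiplicity Δ ≤ 128 ∧
        (simplexMultiplicity Δ = 128 ↔
          LatticeIsomorphic Δ (simplexOfMatrix matrixDimFour))) ∧
    -- all other cases
    (∀ d g : ℕ, 2 ≤ d → 1 ≤ g →
      ¬ (d = 3 ∧ (g = 1 ∨ g = 2)) → ¬ (d = 4 ∧ g = 1) →
      (∀ Δ : Set (Fin d → ℚ), IsFanoSimplex Δ → gorensteinIndex Δ = g →
        (simplexMultiplicity Δ : ℚ) ≤ 3 * (gSylvesterTrunc g (d - 1) : ℚ) ^ 2 / g ∧
        ((simplexMultiplicity Δ : ℚ) = 3 * (gSylvesterTrunc g (d - 1) : ℚ) ^ 2 / g →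
          ((d = 3 ∧ g = 3) ∧
            LatticeIsomorphic Δ (simplexOfMatrix matrixThreeThree)) ∨
          ∃ a : ℕ → ℕ, (∀ k, 1 ≤ k → k ≤ d - 1 → 1 ≤ a k) ∧
            LatticeIsomorphic Δ (simplexOfMatrix (matrixGeneral d g a)))) ∧
      (Odd g →
        ∃ a : ℕ → ℕ, (∀ k, 1 ≤ k → k ≤ d - 1 → 1 ≤ a k) ∧
          (∀ k, 1 ≤ k → k ≤ d - 2 → (a k : ℚ) = sylvesterEntry d g k) ∧
          (a (d - 1) : ℚ) = (gSylvesterTrunc g (d - 1) : ℚ) / g ∧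
          IsFanoSimplex (simplexOfMatrix (matrixGeneral d g a)) ∧
          gorensteinIndex (simplexOfMatrix (matrixGeneral d g a)) = g ∧
          (simplexMultiplicity (simplexOfMatrix (matrixGeneral d g a)) : ℚ) =
            3 * (gSylvesterTrunc g (d - 1) : ℚ) ^ 2 / g)) := by
  refine ⟨fun g hg => ?_, ?_, fun d g hd hg h₁ h₂ => ?_⟩
  · rw [simplexOfMatrix_matrixDimThree]
    refine ⟨⟨(isFanoPair_dimThree hg).isFanoSimplex, gorensteinIndex_dimThree hg⟩,
      fun Δ hΔ hind => ?_⟩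
    obtain ⟨A, v, u, h, hA, rfl⟩ := exists_isFanoPair_monotone (by omega) hΔ hind
    exact ⟨(multiplicity_le_dimThree hg h hA).1, latticeIsomorphic_dimThree hg h hA,
      fun hiso => hiso.multiplicity_eq.trans (simplexMultiplicity_dimThree hg)⟩
  · rw [simplexOfMatrix_matrixDimFour]
    refine ⟨⟨isFanoPair_dimFour.isFanoSimplex, gorensteinIndex_dimFour⟩, fun Δ hΔ hind => ?_⟩
    obtain ⟨A, v, u, h, hA, rfl⟩ := exists_isFanoPair_monotone le_rfl hΔ hind
    exact ⟨(multiplicity_le_dimFour h hA).1, latticeIsomorphic_dimFour h hA,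
      fun hiso => hiso.multiplicity_eq.trans simplexMultiplicity_dimFour⟩
  · obtain ⟨n, rfl⟩ := Nat.exists_eq_add_of_le' hd
    rw [show n + 2 - 1 = n + 1 by omega, cast_mul_sylvesterProd_sq hg]
    refine ⟨fun Δ hΔ hind => ?_, fun hodd => ?_⟩
    · obtain ⟨A, v, u, h, hA, rfl⟩ := exists_isFanoPair_monotone hg hΔ hind
      obtain ⟨h3, h4⟩ := multiplicity_le_general (by omega) (by omega) h hA
      refine ⟨by exact_mod_cast h3, fun heq => ?_⟩
      have heq' : (simplexMultiplicity (integralHull v) : ℤ) = 3 * g * sylvesterProd g n ^ 2 := by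
        exact_mod_cast heq
      rcases h4 heq' with ⟨rfl, rfl, hA12⟩ | ⟨hdet, hcand⟩
      · refine Or.inl ⟨⟨rfl, rfl⟩, ?_⟩
        rw [simplexOfMatrix_matrixThreeThree]
        refine h.latticeIsomorphic_of_index_three
          ((funext hA12 : A = fun _ => 12) ▸ isFanoPair_threeThree) hA12 ?_
          simplexMultiplicity_threeThree
        have h5 : sylvesterProd 3 1 = 4 := by simp [sylvesterProd, gSylvester]
        rw [h5] at heq'
        exact_mod_cast heq'
      · obtain ⟨a, b, ha, hb, hiso⟩ := h.exists_latticeIsomorphic_generalVertices hcand hdet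
        refine Or.inr ⟨paramSeq a b, fun k _ _ => one_le_paramSeq ha hb k, ?_⟩
        rwa [simplexOfMatrix_paramSeq hg ha hb]
    · have ha : ∀ k, 1 ≤ sylvesterEntryInt g n k := sylvesterEntryInt_pos g n
      have hb : 1 ≤ sylvesterProd g n := sylvesterProd_pos g n
      refine ⟨paramSeq (sylvesterEntryInt g n) (sylvesterProd g n),
        fun k _ _ => one_le_paramSeq ha hb k, fun k hk hkn => ?_, ?_, ?_⟩
      · obtain ⟨k, rfl⟩ := Nat.exists_eq_add_of_le' hk
        rw [← cast_sylvesterEntryInt hg n ⟨k, by omega⟩, ← cast_paramSeq_succ ha ⟨k, by omega⟩]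
        rfl
      · have h3 : (gSylvesterTrunc g (n + 1) : ℚ) = g * sylvesterProd g n := by
          exact_mod_cast (mul_sylvesterProd g n).symm
        have hg0 : (g : ℚ) ≠ 0 := by positivity
        rw [h3, mul_div_cancel_left₀ _ hg0]
        exact_mod_cast cast_paramSeq_last (a := sylvesterEntryInt g n) hb
      · rw [simplexOfMatrix_paramSeq hg ha hb]
        refine ⟨(isFanoPair_general hodd n).isFanoSimplex, gorensteinIndex_general hodd n, ?_⟩
        exact_mod_cast congrArg (Int.cast : ℤ → ℚ) (simplexMultiplicity_general hodd n)
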